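/- **Setting.** Let $\Omega\subset\mathbb R^N$ ($N\ge1$) be open, bounded, non-empty and without cracks ($\Omega=\mathrm{int}\,\overline\Omega$). Consider $\partial_t(\mathcal G u)+\sum_j\partial_j(\mathcal L^j u)=0$ for $u$ with values in $\mathbb R^L$ ($L\ge1$), where $\mathcal G,\mathcal L^j$ are bounded symmetric matrix fields on $\Omega$, $\mathcal G$ is uniformly positive definite and $\sum_j\partial_j\mathcal L^j=0$ in the sense of distributions. Let $c$ be the maximal wave speed (the supremum of all $|\lambda|$ with $\sum_j\nu_j\mathcal L^j(x)e=\lambda\,\mathcal G(x)e$, $e\ne0$, $|\nu|=1$, $x\in\Omega$), and let $\hat c>c$. For a normal $n$ put $\mathcal D=\sum_j n_j\mathcal L^j$. The boundary condition is $(\mathcal D-\mathcal B)u=0$ on $\partial\Omega$ with $\ker(\mathcal D-\mathcal B)+\ker(\mathcal D+\mathcal B)=\mathbb R^L$ and $\mathcal B+\mathcal B^t\ge0$. Take a conforming simplicial mesh of $\Omega$, shape regular with constant $\gamma$, such that $\mathcal G,\mathcal L^j$ are constant on each element. Let $\mathtt v$ be a mesh vertex with vertex patch $\Omega_h^{\mathtt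 v}$ (the elements that contain $\mathtt v$), $h_{\mathtt v}=\max_{K\in\Omega_h^{\mathtt v}}\operatorname{diam}K$, and let $V_h^{\mathtt v}$ be the $\mathbb R^L$-valued functions that are polynomials of degree at most $p$ on each element of the patch ($p\ge0$ arbitrary), with the $L^2$ inner product $(\cdot,\cdot)_{\mathtt v}$. A causal tent on the patch lies between the graphs of continuous functions $\varphi_{\rm bot},\varphi_{\rm top}$ that are affine on each element, agree at all vertices but $\mathtt v$, satisfy $\varphi_{\rm bot}(\mathtt v)<\varphi_{\rm top}(\mathtt v)$, and have gradients of length at most $1/\hat c$. Put $\delta=\varphi_{\rm top}-\varphi_{\rm bot}$. For $w,v\in V_h^{\mathtt v}$ let $$a(w,v)=\sum_{K}\Big[\sum_j(\delta\mathcal L^jw,\partial_jv)_K-(\delta\hat F_w,v)_{\partial K}\Big],$$ where, with $n$ the outward unit normal of $K$, $\hat F_w=\tfrac12\mathcal D(w+w_o)+S(w-w_o)$ on $\partial K\setminus\partial\Omega$ ($w_o$ is the value from the neighbouring element) and $\hat F_w=\tfrac12(\mathcal D+B)w$ on $\partial K\cap\partial\Omega$. The measurable matrix fields $B,S$ satisfy,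 with a constant $C_d$, at almost all points of the boundary facets (for $B$) and of the interior facets (for $S$): $\ker(\mathcal D-\mathcal B)\subseteq\ker(\mathcal D-B)$; $B+B^t\ge0$, $S+S^t\ge0$; $\|B\|_2,\|S\|_2\le C_d$; $(\mathcal D+B)y\cdot z\le C_d\|y\|_2|z|_B$; $Sy\cdot z\le C_d|y|_S|z|_S$; $\mathcal Dy\cdot z\le C_d\|y\|_2|z|_S$, where $|y|_B^2=By\cdot y$ and $|y|_S^2=Sy\cdot y$. Define operators on $V_h^{\mathtt v}$ by $(A_hw,v)_{\mathtt v}=a(w,v)$, $(M_0w,v)_{\mathtt v}=(\mathcal Gw,v)_{\mathtt v}-\sum_j((\partial_j\varphi_{\rm bot})\mathcal L^jw,v)_{\mathtt v}$, $(M_1w,v)_{\mathtt v}=\sum_j((\partial_j\delta)\mathcal L^jw,v)_{\mathtt v}$, $M(\tau)=M_0-\tau M_1$. Put $\|w\|_{M(\tau)}=(M(\tau)w,w)_{\mathtt v}^{1/2}$ and $|w|_d^2=-(2A_hw+M_1w,w)_{\mathtt v}$. Let $X_0=I$, $X_k=M_0^{-1}(A_h+kM_1)X_{k-1}$, and $$R^{\rm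 sat}_{h2}(\tau)=I+\tau X_1+\tfrac{\tau^2}{2}M(\tau)^{-1}M_0X_2 .$$ For $r\ge1$ let $R^{\rm sat}_{rh2}=R_{[r]}\circ\cdots\circ R_{[1]}$, where $R_{[\ell]}$ is the operator $R^{\rm sat}_{h2}(1)$ of the $\ell$-th subtent, which lies between $\varphi_{\rm bot}+\frac{\ell-1}r\delta$ and $\varphi_{\rm bot}+\frac{\ell}r\delta$. Let $$Z(\tau,v)=\tfrac14\big[2(M_1X_1v,X_1v)_{\mathtt v}-|X_1v|_d^2+\tau\|M(\tau)^{-1}M_0X_2v\|_{M(\tau)}^2\big],\qquad \kappa_2=\sup_{0\le\tau\le1}\ \sup_{0\ne v\in V_h^{\mathtt v}}\frac{Z(\tau,v)}{\|v\|_{M_0}^2}.$$ Let $Z_t(\tau,v)$ be obtained from $Z(\tau,v)$ by replacing $M_0$ by $M(t)$ and $M(\tau)$ by $M(t+\tau)$ throughout (also in $X_1,X_2$), and let $\hat\kappa_2$ be the supremum of $Z_t(\tau,v)/\|v\|_{M(t)}^2$ over $v\ne0$ and $t,\tau\ge0$ with $t+\tau\le1$. Let $r$ and $\hat r$ be the smallest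 positive integers not smaller than $\kappa_2^{1/3}/h_{\mathtt v}^{1/2}$ and $\hat\kappa_2^{1/3}/h_{\mathtt v}^{1/2}$, respectively. **Proposition.** In the following, "mesh-independent" means depending only on the hyperbolic system with its domain, on $p,\gamma,C_d,\hat c$, and on what is named, and not on the mesh, the vertex, $B$, $S$ or the tent. 1. For every causal tent $\kappa_2$ is finite, and for all $v\in V_h^{\mathtt v}$ and $0\le\tau\le1/r$, $$\|R^{\rm sat}_{h2}(\tau)v\|_{M(\tau)}\le(1+h_{\mathtt v}^{3/2})^{1/2}\|v\|_{M_0}.$$ 2. For every $\kappa_0>0$ there is a mesh-independent $C_{\rm sta}\ge0$ (depending also on $\kappa_0$) such that $\|R^{\rm sat}_{rh2}v\|_{M(1)}\le(1+C_{\rm sta}h_{\mathtt v})\|v\|_{M(0)}$ for all $v\in V_h^{\mathtt v}$ on all causal tents with $\kappa_2\ge\kappa_0$ or $\kappa_2\le h_{\mathtt v}^{3/2}$. 3. There are mesh-independent constants $C,C_{\rm sta}\ge0$ such that on all causal tents $\kappa_2\le\hat\kappa_2\le C$ and $\|R^{\rm sat}_{\hat rh2}v\|_{M(1)}\le(1+C_{\rm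 sta}h_{\mathtt v})\|v\|_{M(0)}$ for all $v\in V_h^{\mathtt v}$. In particular $\hat r\le C^{1/3}h_{\mathtt v}^{-1/2}+1$ subtents suffice for stability (a "3/2-CFL" condition). -/

import Mathlib

open MeasureTheory Set
open scoped Matrix

noncomputable section

namespace MTP

/-- Physical space `ℝ^N` with its Euclidean norm. -/
abbrev Space (N : ℕ) : Type := EuclideanSpace ℝ (Fin N)

/-- The Euclidean norm of a vector of `ℝ^L`. -/
def eucl {L : ℕ} (y : Fin L → ℝ) : ℝ := √(y ⬝ᵥ y)

/-- The `j`-th partial derivative of a scalar function. -/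
def partialD {N : ℕ} (j : Fin N) (f : Space N → ℝ) (x : Space N) : ℝ :=
  fderiv ℝ f x (EuclideanSpace.single j 1)

/-! ### The symmetric hyperbolic system -/

/-- The data of the system `∂_t (G u) + ∑_j ∂_j (A_j u) = 0` on `Ω × (0, T)` with the boundary
condition `(D - bc) u = 0` on `∂Ω`, where `D = ∑_j n_j A_j`. -/
structure HyperbolicSystem (N L : ℕ) where
  Ω : Set (Space N)
  A : Fin N → Space N → Matrix (Fin L) (Fin L) ℝ
  G : Space N → Matrix (Fin L) (Fin L) ℝ
  bc : Space N → Matrix (Fin L) (Fin L) ℝ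

namespace HyperbolicSystem

variable {N L : ℕ}

/-- The largest `|μ|` among the solutions of `(∑_j ν_j A_j(x)) e = μ G(x) e`, `e ≠ 0`, over points
`x` of `Ω` and unit vectors `ν`. -/
def waveSpeed (H : HyperbolicSystem N L) : ℝ :=
  sSup {s : ℝ | ∃ x ∈ H.Ω, ∃ ν : Space N, ‖ν‖ = 1 ∧ ∃ μ : ℝ, ∃ e : Fin L → ℝ, e ≠ 0 ∧
    (∑ j, ν j • H.A j x) *ᵥ e = μ • (H.G x *ᵥ e) ∧ s = |μ|}

/-- The standing assumptions on the domain and on the coefficients. The equality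
`interior (closure Ω) = Ω` excludes cracks, across which `∂Ω` has no well-defined outward normal.
The last field is `∑_j ∂_j A_j = 0` in the sense of distributions on `Ω`. -/
structure IsAdmissible (H : HyperbolicSystem N L) : Prop where
  isOpen : IsOpen H.Ω
  nonempty : H.Ω.Nonempty
  bounded : Bornology.IsBounded H.Ω
  no_crack : interior (closure H.Ω) = H.Ω
  symm_A : ∀ j, ∀ x ∈ H.Ω, (H.A j x).IsSymm
  symm_G : ∀ x ∈ H.Ω, (H.G x).IsSymm
  bounded_A : ∃ c : ℝ, ∀ j, ∀ x ∈ H.Ω, ∀ l k, |H.A j x l k| ≤ c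
  bounded_G : ∃ c : ℝ, ∀ x ∈ H.Ω, ∀ l k, |H.G x l k| ≤ c
  posDef_G : ∃ g : ℝ, 0 < g ∧ ∀ x ∈ H.Ω, ∀ y : Fin L → ℝ, g * (y ⬝ᵥ y) ≤ (H.G x *ᵥ y) ⬝ᵥ y
  div_A : ∀ ψ : Space N → ℝ, ContDiff ℝ (⊤ : ℕ∞) ψ → HasCompactSupport ψ → tsupport ψ ⊆ H.Ω →
    ∀ l k, ∑ j, ∫ x in H.Ω, H.A j x l k * partialD j ψ x = 0

end HyperbolicSystem

/-! ### Simplicial meshes -/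

/-- The closed simplex with a given finite set of vertices. -/
def hull {N : ℕ} (K : Finset (Space N)) : Set (Space N) := convexHull ℝ (K : Set (Space N))

/-- The barycenter of a simplex. -/
def barycenter {N : ℕ} (K : Finset (Space N)) : Space N := (K.card : ℝ)⁻¹ • ∑ a ∈ K, a

/-- A finite conforming simplicial mesh: a finite geometric simplicial complex in which each
simplex is a face of an `N`-dimensional one. -/
structure Mesh (N : ℕ) where
  complex : Geometry.SimplicialComplex ℝ (Space N)
  finite : complex.faces.Finite
  pure : ∀ s ∈ complex.faces, ∃ K ∈ complex.faces, s ⊆ K ∧ K.card = N + 1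

namespace Mesh

variable {N : ℕ}

open Classical in
/-- The mesh elements, i.e. the `N`-simplices of the mesh, given by their vertices. -/
def elements (𝒯 : Mesh N) : Finset (Finset (Space N)) :=
  𝒯.finite.toFinset.filter fun K => K.card = N + 1

open Classical in
/-- The elements of the patch of a vertex `v`: all mesh elements that have `v` as a vertex. -/
def patch (𝒯 : Mesh N) (v : Space N) : Finset (Finset (Space N)) :=
  𝒯.elements.filter fun K => v ∈ K

/-- The facet `F` of the mesh belongs to just one mesh element, i.e. it lies on the boundary of
the meshed domain. -/
def IsBoundaryFacet (𝒯 : Mesh N) (F : Finset (Space N)) : Prop :=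
  ∀ K ∈ 𝒯.elements, ∀ K' ∈ 𝒯.elements, F ⊆ K → F ⊆ K' → K = K'

/-- The elements subdivide `closure Ω`, and they are shape regular with constant `γ`: each
element `K` contains a ball of radius `diam K / γ`. -/
structure IsShapeRegularMeshOf (𝒯 : Mesh N) (Ω : Set (Space N)) (γ : ℝ) : Prop where
  cover : ⋃ K ∈ 𝒯.elements, hull K = closure Ω
  regular : ∀ K ∈ 𝒯.elements, ∃ x, Metric.closedBall x (Metric.diam (hull K) / γ) ⊆ hull K

end Mesh

open Classical in
/-- The facet of the simplex `K` opposite to its vertex `a`. -/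
def facet {N : ℕ} (K : Finset (Space N)) (a : Space N) : Finset (Space N) := K.erase a

/-- The outward unit normal of the simplex `K` on its facet opposite to the vertex `a`: the
normalized component of (a point of the facet minus `a`) that is orthogonal to the facet. -/
def normal {N : ℕ} (K : Finset (Space N)) (a : Space N) : Space N :=
  let u := (vectorSpan ℝ (facet K a : Set (Space N)))ᗮ.starProjection (barycenter (facet K a) - a)
  ‖u‖⁻¹ • u

/-- The integral over the facet of `K` opposite to `a`, with respect to the `(N-1)`-dimensional
surface measure. -/
def facetIntegral {N : ℕ} (K : Finset (Space N)) (a : Space N) (f : Space N → ℝ) : ℝ :=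
  ∫ x in hull (facet K a), f x ∂(Measure.euclideanHausdorffMeasure (N - 1))

/-- A property that holds at almost every point of the facet of `K` opposite to `a`. -/
def FacetAE {N : ℕ} (K : Finset (Space N)) (a : Space N) (q : Space N → Prop) : Prop :=
  ∀ᵐ x ∂((Measure.euclideanHausdorffMeasure (N - 1) : Measure (Space N)).restrict
    (hull (facet K a))), q x

/-- The matrix `D = ∑_j n_j A_j` on the facet of `K` opposite to `a`, with the trace of `A_j` from
`K` (`A_j` is constant in the interior of `K`) and the outward normal `n` of `K`. -/
def bdryMatrix {N L : ℕ} (H : HyperbolicSystem N L) (K : Finset (Space N)) (a : Space N) :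
    Matrix (Fin L) (Fin L) ℝ :=
  ∑ j, normal K a j • H.A j (barycenter K)

/-! ### The discontinuous Galerkin setting on a vertex patch -/

/-- A mesh, one of its vertices, the matrix `B` of the numerical flux on boundary facets and the
stabilization matrix `S` on interior facets. -/
structure DGPatch (N L : ℕ) where
  mesh : Mesh N
  vertex : Space N
  B : Space N → Matrix (Fin L) (Fin L) ℝ
  S : Space N → Matrix (Fin L) (Fin L) ℝ

/-- The standing assumptions on the mesh, on the coefficients relative to the mesh, on the boundary
condition, and the design conditions on `B` and `S`, with the constant `Cd` in all bounds. -/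
structure DGPatch.IsAdmissible {N L : ℕ} (P : DGPatch N L) (H : HyperbolicSystem N L)
    (γ Cd : ℝ) : Prop where
  mesh_Ω : P.mesh.IsShapeRegularMeshOf H.Ω γ
  vertex_mem : P.vertex ∈ P.mesh.complex.vertices
  const_A : ∀ K ∈ P.mesh.elements, ∀ j, ∃ A₀, ∀ x ∈ interior (hull K), H.A j x = A₀
  const_G : ∀ K ∈ P.mesh.elements, ∃ G₀, ∀ x ∈ interior (hull K), H.G x = G₀
  measurable_B : ∀ l k, Measurable fun x => P.B x l k
  measurable_S : ∀ l k, Measurable fun x => P.S x l k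
  bc_ker : ∀ K ∈ P.mesh.elements, ∀ a ∈ K, P.mesh.IsBoundaryFacet (facet K a) →
    FacetAE K a fun x => ∀ y : Fin L → ℝ, ∃ y₁ y₂, y = y₁ + y₂ ∧
      (bdryMatrix H K a - H.bc x) *ᵥ y₁ = 0 ∧ (bdryMatrix H K a + H.bc x) *ᵥ y₂ = 0
  bc_nonneg : ∀ K ∈ P.mesh.elements, ∀ a ∈ K, P.mesh.IsBoundaryFacet (facet K a) →
    FacetAE K a fun x => ∀ y : Fin L → ℝ, 0 ≤ (H.bc x *ᵥ y) ⬝ᵥ y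
  ker_B : ∀ K ∈ P.mesh.elements, ∀ a ∈ K, P.mesh.IsBoundaryFacet (facet K a) →
    FacetAE K a fun x => ∀ y : Fin L → ℝ, (bdryMatrix H K a - H.bc x) *ᵥ y = 0 →
      (bdryMatrix H K a - P.B x) *ᵥ y = 0
  B_nonneg : ∀ K ∈ P.mesh.elements, ∀ a ∈ K, P.mesh.IsBoundaryFacet (facet K a) →
    FacetAE K a fun x => ∀ y : Fin L → ℝ, 0 ≤ (P.B x *ᵥ y) ⬝ᵥ y
  B_bound : ∀ K ∈ P.mesh.elements, ∀ a ∈ K, P.mesh.IsBoundaryFacet (facet K a) →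
    FacetAE K a fun x => ∀ y : Fin L → ℝ, eucl (P.B x *ᵥ y) ≤ Cd * eucl y
  DB_bound : ∀ K ∈ P.mesh.elements, ∀ a ∈ K, P.mesh.IsBoundaryFacet (facet K a) →
    FacetAE K a fun x => ∀ y z : Fin L → ℝ,
      ((bdryMatrix H K a + P.B x) *ᵥ y) ⬝ᵥ z ≤ Cd * eucl y * √((P.B x *ᵥ z) ⬝ᵥ z)
  S_nonneg : ∀ K ∈ P.mesh.elements, ∀ a ∈ K, ¬ P.mesh.IsBoundaryFacet (facet K a) →
    FacetAE K a fun x => ∀ y : Fin L → ℝ, 0 ≤ (P.S x *ᵥ y) ⬝ᵥ y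
  S_bound : ∀ K ∈ P.mesh.elements, ∀ a ∈ K, ¬ P.mesh.IsBoundaryFacet (facet K a) →
    FacetAE K a fun x => ∀ y : Fin L → ℝ, eucl (P.S x *ᵥ y) ≤ Cd * eucl y
  S_seminorm : ∀ K ∈ P.mesh.elements, ∀ a ∈ K, ¬ P.mesh.IsBoundaryFacet (facet K a) →
    FacetAE K a fun x => ∀ y z : Fin L → ℝ,
      (P.S x *ᵥ y) ⬝ᵥ z ≤ Cd * √((P.S x *ᵥ y) ⬝ᵥ y) * √((P.S x *ᵥ z) ⬝ᵥ z)
  DS_bound : ∀ K ∈ P.mesh.elements, ∀ a ∈ K, ¬ P.mesh.IsBoundaryFacet (facet K a) →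
    FacetAE K a fun x => ∀ y z : Fin L → ℝ,
      (bdryMatrix H K a *ᵥ y) ⬝ᵥ z ≤ Cd * eucl y * √((P.S x *ᵥ z) ⬝ᵥ z)

/-- The patch mesh size `h_v = max_K diam K`. -/
def DGPatch.h {N L : ℕ} (P : DGPatch N L) : ℝ :=
  ⨆ K : P.mesh.patch P.vertex, Metric.diam (hull (K : Finset (Space N)))

/-- The bottom and the top of a tent, as functions of the spatial point. -/
structure Tent (N : ℕ) where
  bot : Space N → ℝ
  top : Space N → ℝ

namespace Tent

variable {N L : ℕ}

/-- `δ = φ_top - φ_bot`. -/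
def δ (T : Tent N) (x : Space N) : ℝ := T.top x - T.bot x

/-- The tent bottom and top are piecewise linear on the patch of the vertex, they differ by raising
the value at the vertex alone, and they satisfy the causality condition with the speed `cHat`. -/
structure IsCausal (T : Tent N) (P : DGPatch N L) (cHat : ℝ) : Prop where
  affine_bot : ∀ K ∈ P.mesh.patch P.vertex, ∃ g : Space N →ᵃ[ℝ] ℝ, ∀ x ∈ hull K, T.bot x = g x
  affine_top : ∀ K ∈ P.mesh.patch P.vertex, ∃ g : Space N →ᵃ[ℝ] ℝ, ∀ x ∈ hull K, T.top x = g x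
  fixed : ∀ K ∈ P.mesh.patch P.vertex, ∀ a ∈ K, a ≠ P.vertex → T.top a = T.bot a
  raised : T.bot P.vertex < T.top P.vertex
  causal_bot : ∀ K ∈ P.mesh.patch P.vertex, ∀ x ∈ interior (hull K),
    ‖gradient T.bot x‖ ≤ 1 / cHat
  causal_top : ∀ K ∈ P.mesh.patch P.vertex, ∀ x ∈ interior (hull K),
    ‖gradient T.top x‖ ≤ 1 / cHat

/-- The subtent number `l` of `r`, for `l = 1, …, r`: it lies between the graphs of
`φ_bot + ((l-1)/r) δ` and `φ_bot + (l/r) δ`. -/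
def subtent (T : Tent N) (r l : ℕ) : Tent N where
  bot x := T.bot x + ((l : ℝ) - 1) / r * T.δ x
  top x := T.bot x + (l : ℝ) / r * T.δ x

/-- The tent moved up to the pseudotime `t`, i.e. with bottom `φ_bot + t δ` and the same `δ`. Its
mass matrix at pseudotime `τ` is `M(t + τ)`; in particular its `M_0` is `M(t)`. -/
def restart (T : Tent N) (t : ℝ) : Tent N where
  bot x := T.bot x + t * T.δ x
  top x := T.top x + t * T.δ x

end Tent

/-- The space `V_h^v` of piecewise polynomials of degree at most `p` with values in `ℝ^L` on the
patch of the vertex: one polynomial for each element and each component. -/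
abbrev V {N L : ℕ} (P : DGPatch N L) (p : ℕ) : Type :=
  P.mesh.patch P.vertex → Fin L → MvPolynomial.restrictTotalDegree (Fin N) ℝ p

section Operators

variable {N L : ℕ} (H : HyperbolicSystem N L) (P : DGPatch N L) (T : Tent N) {p : ℕ}

variable {P} in
/-- The value at `x` of the polynomial of `w` on the element `K`. -/
def val (w : V P p) (K : P.mesh.patch P.vertex) (x : Space N) : Fin L → ℝ :=
  fun l => MvPolynomial.eval (fun i => x i) (w K l : MvPolynomial (Fin N) ℝ)

variable {P} in
/-- The value at `x` of the `j`-th partial derivative of the polynomial of `w` on `K`. -/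
def valD (j : Fin N) (w : V P p) (K : P.mesh.patch P.vertex) (x : Space N) : Fin L → ℝ :=
  fun l => MvPolynomial.eval (fun i => x i)
    (MvPolynomial.pderiv j (w K l : MvPolynomial (Fin N) ℝ))

variable {P} in
open Classical in
/-- The value `w_o` of `w` from the element of the patch on the other side of the facet of `K`
opposite to `a`. There is at most one such element; if there is none then this is `0`, which is
used only for facets where `δ` vanishes. -/
def valO (w : V P p) (K : P.mesh.patch P.vertex) (a x : Space N) : Fin L → ℝ :=
  ∑ K' : P.mesh.patch P.vertex,
    if K' ≠ K ∧ facet (K : Finset (Space N)) a ⊆ (K' : Finset (Space N)) then val w K' x else 0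

variable {P} in
open Classical in
/-- The numerical flux on the facet of `K` opposite to `a`: `D {w} + S [w]` in the interior of the
domain and `(D + B) w / 2` on its boundary. -/
def flux (w : V P p) (K : P.mesh.patch P.vertex) (a x : Space N) : Fin L → ℝ :=
  if P.mesh.IsBoundaryFacet (facet (K : Finset (Space N)) a) then
    (1 / 2 : ℝ) • ((bdryMatrix H K a + P.B x) *ᵥ val w K x)
  else
    bdryMatrix H K a *ᵥ ((1 / 2 : ℝ) • (val w K x + valO w K a x)) +
      P.S x *ᵥ (val w K x - valO w K a x)

variable {P} in
/-- The `L²` inner product on the patch. -/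
def ip (w v : V P p) : ℝ :=
  ∑ K : P.mesh.patch P.vertex, ∫ x in hull (K : Finset (Space N)), val w K x ⬝ᵥ val v K x

variable {P}

/-- The DG bilinear form `a(w, v)`. -/
def formA (w v : V P p) : ℝ :=
  ∑ K : P.mesh.patch P.vertex,
    ((∑ j, ∫ x in hull (K : Finset (Space N)), T.δ x * ((H.A j x *ᵥ val w K x) ⬝ᵥ valD j v K x)) -
      ∑ a ∈ (K : Finset (Space N)),
        facetIntegral K a fun x => T.δ x * (flux H w K a x ⬝ᵥ val v K x))

/-- The form `(G w, v) - ∑_j ((∂_j φ_bot) A_j w, v)`. -/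
def formM0 (w v : V P p) : ℝ :=
  ∑ K : P.mesh.patch P.vertex,
    ((∫ x in hull (K : Finset (Space N)), (H.G x *ᵥ val w K x) ⬝ᵥ val v K x) -
      ∑ j, ∫ x in hull (K : Finset (Space N)),
        partialD j T.bot x * ((H.A j x *ᵥ val w K x) ⬝ᵥ val v K x))

/-- The form `∑_j ((∂_j δ) A_j w, v)`. -/
def formM1 (w v : V P p) : ℝ :=
  ∑ K : P.mesh.patch P.vertex, ∑ j, ∫ x in hull (K : Finset (Space N)),
    partialD j T.δ x * ((H.A j x *ᵥ val w K x) ⬝ᵥ val v K x)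

/-- The operator on `V_h^v` that represents a bilinear form `b` in the `L²` inner product: it takes
`w` to the unique `u` with `(u, v) = b(w, v)` for all `v`. -/
def represent (b : V P p → V P p → ℝ) (w : V P p) : V P p :=
  Classical.epsilon fun u => ∀ v, ip u v = b w v

def opA (w : V P p) : V P p := represent (formA H T) w

def opM0 (w : V P p) : V P p := represent (formM0 H T) w

def opM1 (w : V P p) : V P p := represent (formM1 H T) w

/-- `M(τ) = M_0 - τ M_1`. -/
def opM (τ : ℝ) (w : V P p) : V P p := opM0 H T w - τ • opM1 H T w

/-- `M(τ)⁻¹`. -/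
def invM (τ : ℝ) : V P p → V P p := Function.invFun (opM H T τ)

/-- `M_0⁻¹`. -/
def invM0 : V P p → V P p := Function.invFun (opM0 H T)

/-- `‖w‖_{M(τ)} = (M(τ) w, w)^{1/2}`. -/
def normM (τ : ℝ) (w : V P p) : ℝ := √(ip (opM H T τ w) w)

/-- `‖w‖_{M_0} = (M_0 w, w)^{1/2}`. -/
def normM0 (w : V P p) : ℝ := √(ip (opM0 H T w) w)

/-- `d(w, v) = -[a(w, v) + a(v, w) + (M_1 w, v)]`. -/
def formD (w v : V P p) : ℝ :=
  -(formA H T w v + formA H T v w + ip (opM1 H T w) v)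

/-- `|w|_d = d(w, w)^{1/2}`. -/
def seminormD (w : V P p) : ℝ := √(formD H T w w)

/-- `X_0 = I` and `X_k = M_0⁻¹ (A_h + k M_1) X_{k-1}`. -/
def opX : ℕ → V P p → V P p
  | 0, w => w
  | k + 1, w => invM0 H T (opA H T (opX k w) + ((k : ℝ) + 1) • opM1 H T (opX k w))

/-- The `s`-stage SAT flow
`∑_{k<s} (τ^k / k!) X_k v + (τ^s / s!) M(τ)⁻¹ M_0 X_s v`. -/
def satFlow (s : ℕ) (τ : ℝ) (w : V P p) : V P p :=
  (∑ k ∈ Finset.range s, (τ ^ k / (k.factorial : ℝ)) • opX H T k w) +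
    (τ ^ s / (s.factorial : ℝ)) • invM H T τ (opM0 H T (opX H T s w))

/-- The composition of the SAT flows, at pseudotime `1`, of the first `n` of `r` subtents. -/
def satSubtents (s r : ℕ) : ℕ → V P p → V P p
  | 0, w => w
  | n + 1, w => satFlow H (T.subtent r (n + 1)) s 1 (satSubtents s r n w)

/-- The `s`-stage SAT propagator that uses `r` subtents. -/
def satPropagator (s r : ℕ) (w : V P p) : V P p := satSubtents H T s r r w

/-- `Z(τ, v) = [2 (M_1 X_1 v, X_1 v) - |X_1 v|_d² + τ ‖M(τ)⁻¹ M_0 X_2 v‖_{M(τ)}²] / 4`. -/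
def Z (τ : ℝ) (w : V P p) : ℝ :=
  (2 * ip (opM1 H T (opX H T 1 w)) (opX H T 1 w) - seminormD H T (opX H T 1 w) ^ 2 +
    τ * normM H T τ (invM H T τ (opM0 H T (opX H T 2 w))) ^ 2) / 4

variable (P p)

/-- The quotients `Z(τ, v) / ‖v‖_{M_0}²` with `0 ≤ τ ≤ 1` and `v ≠ 0`. -/
def kappaSet : Set ℝ :=
  {q | ∃ τ : ℝ, 0 ≤ τ ∧ τ ≤ 1 ∧ ∃ w : V P p, w ≠ 0 ∧ q = Z H T τ w / normM0 H T w ^ 2}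

/-- `κ_2`, the supremum of the quotients above. -/
def kappa : ℝ := sSup (kappaSet H P T p)

/-- The same quotients for all starting pseudotimes: `Z_t(τ, v) / ‖v‖_{M(t)}²` with `t, τ ≥ 0`,
`t + τ ≤ 1` and `v ≠ 0`, where `Z_t` is `Z` with `M(t)` and `M(t + τ)` in place of `M_0` and
`M(τ)`. -/
def kappaHatSet : Set ℝ :=
  {q | ∃ t τ : ℝ, 0 ≤ t ∧ 0 ≤ τ ∧ t + τ ≤ 1 ∧ ∃ w : V P p, w ≠ 0 ∧
    q = Z H (T.restart t) τ w / normM0 H (T.restart t) w ^ 2}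

/-- The supremum of the quotients over all starting pseudotimes. -/
def kappaHat : ℝ := sSup (kappaHatSet H P T p)

end Operators

/-- The smallest positive integer that is not smaller than `κ^{1/3} / h^{1/2}` (the real cube root
of a negative `κ` is negative, so this number is `1` for `κ ≤ 0`). -/
def numSubtents (κ h : ℝ) : ℕ := max 1 ⌈(max κ 0) ^ (1 / 3 : ℝ) / h ^ (1 / 2 : ℝ)⌉₊

end MTP

end

noncomputable section

namespace MTP

open Filter Topology
open scoped RealInnerProductSpace

/-! Energy identity. A step of length `τ` from pseudotime `t` is `u = w + τ x + (τ²/2) y` with `M(t)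
x = (A_h + M_1) w` and `M(t+τ) y = (A_h + 2 M_1) x`. Expanding `‖u‖²` in `M(t+τ) = M(t) - τ M_1` and
inserting the two stage equations gives, exactly, `‖u‖²_{M(t+τ)} = ‖w‖²_{M(t)} - τ |w + (τ/2) x|_d²
+ τ³ Z_t(τ, w)`. The terms of first and second order complete a square of the dissipation, so a step
can gain energy only through `τ³ Z` (`normM_satFlow_le`).

Dissipativity (`diss_nonneg`). The divergence theorem for `δ (L^j w) · w` on each element turns `-(2
A_h + M_1)` into facet terms. On `∂Ω` the form of `B` remains, on an interior facet twice the form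
of `S` at the jump, and on facets opposite to the vertex `δ` vanishes. The cancellation on interior
facets needs the flux matrices of the two elements to be opposite (`bdryMatrix_eq_neg`); this is the
divergence constraint, tested with a bump function around the barycenter of the facet.

Uniform bounds (`exists_Z_le`). The slopes of the tent are at most `1/ĉ`, so `δ` is at most `(2/ĉ)
diam K`. This power of the mesh size compensates the loss in the inverse and trace inequalities, and
`A_h` is bounded in `L²` independently of the mesh, as is `M_1`. Since `c < ĉ`, the matrices `M(t)`
are uniformly positive: the wave speed bounds the generalized Rayleigh quotients of the `L^j`
relative to `G`. Hence `x` is controlled by `w`, `y` by `x`, and `Z_t` by a mesh-independent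
multiple of `‖w‖²_{M(t)}`.

Counting subtents. The flow of subtent `ℓ` of `r` is a step of length `1/r` of the whole tent from
`t = (ℓ-1)/r` (`satFlow_subtent`). If `Z_t ≤ κ ‖·‖²` at all these times, then `r` steps amplify the
squared norm by at most `(1 + κ/r³)^r ≤ exp(κ/r²)` (`normM_satPropagator_le`), and `r ≥ κ^{1/3}
h^{-1/2}` makes `κ/r²` at most `κ^{1/3} h`. The number `κ_2` controls only a step that starts at `t
= 0`. This suffices for a single step; with several subtents one needs either `κ̂_2`, or a lower
bound on `κ_2` that makes `r` large enough for the universal bound of `Z_t`.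

The divergence theorem on a simplex, with Hausdorff measure on its facets, is obtained from smooth
cutoffs and Fubini along the facet normals; it also yields the trace inequality. -/

/-- The surface measure on the hyperplane `⟪g, x⟫ + c = 0`. -/
def hyperplaneMeasure {N : ℕ} (g : Space N) (c : ℝ) : Measure (Space N) :=
  (Measure.euclideanHausdorffMeasure (N - 1)).restrict {x | ⟪g, x⟫ + c = 0}

/-! ### Surface measure on hyperplanes, and Fubini along the normal -/

section Hyperplane

variable {N : ℕ} {g : Space N} (hg : g ≠ 0) (c : ℝ)
include hg

/-- The foot of the perpendicular from the origin is `-(c/‖g‖²) g`. The hyperplane thus becomes an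
isometric copy of `(ℝ ∙ g)ᗮ`, on which Lebesgue measure is available. -/
lemma range_hyperplane :
    range (fun w : (ℝ ∙ g)ᗮ => (w : Space N) + (-(c / ‖g‖ ^ 2)) • g) = {x | ⟪g, x⟫ + c = 0} := by
  have hg' : ‖g‖ ^ 2 ≠ 0 := by simpa using hg
  ext x
  constructor
  · rintro ⟨w, rfl⟩
    have hw : ⟪g, (w : Space N)⟫ = 0 := Submodule.mem_orthogonal_singleton_iff_inner_right.1 w.2
    simp only [mem_ofPred_eq, inner_add_right, inner_smul_right, hw, real_inner_self_eq_norm_sq]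
    field_simp
    ring
  · intro hx
    refine ⟨⟨x + (c / ‖g‖ ^ 2) • g, ?_⟩, by simp⟩
    rw [Submodule.mem_orthogonal_singleton_iff_inner_right, inner_add_right, inner_smul_right,
      real_inner_self_eq_norm_sq]
    simp only [mem_ofPred_eq] at hx
    field_simp
    exact hx

lemma finrank_orthogonal_span : Module.finrank ℝ (ℝ ∙ g)ᗮ = N - 1 := by
  have h := (ℝ ∙ g).finrank_add_finrank_orthogonal
  rw [finrank_span_singleton hg, finrank_euclideanSpace_fin] at h
  omega

/-- Isometries transport Hausdorff measure, and in an inner product space of dimension `N - 1` the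
normalized one is the volume. -/
lemma hyperplaneMeasure_eq_map :
    hyperplaneMeasure g c =
      Measure.map (fun w : (ℝ ∙ g)ᗮ => (w : Space N) + (-(c / ‖g‖ ^ 2)) • g) volume := by
  have hiso : Isometry (fun w : (ℝ ∙ g)ᗮ => (w : Space N) + (-(c / ‖g‖ ^ 2)) • g) :=
    fun x y => by rw [edist_add_right]; rfl
  have h := hiso.map_euclideanHausdorffMeasure (d := N - 1)
  rw [hyperplaneMeasure, ← range_hyperplane hg c, ← h, ← finrank_orthogonal_span hg,
    InnerProductSpace.euclideanHausdorffMeasure_eq_volume]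

lemma hyperplane_isClosedEmbedding :
    IsClosedEmbedding (fun w : (ℝ ∙ g)ᗮ => (w : Space N) + (-(c / ‖g‖ ^ 2)) • g) := by
  have hiso : Isometry (fun w : (ℝ ∙ g)ᗮ => (w : Space N) + (-(c / ‖g‖ ^ 2)) • g) :=
    fun x y => by rw [edist_add_right]; rfl
  exact hiso.isClosedEmbedding

lemma hyperplaneMeasure_lt_top {s : Set (Space N)} (hs : Bornology.IsBounded s) :
    hyperplaneMeasure g c s < ⊤ := by
  obtain ⟨R, hR⟩ := hs.subset_closedBall 0
  refine (measure_mono hR).trans_lt ?_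
  rw [hyperplaneMeasure_eq_map hg, (hyperplane_isClosedEmbedding hg c).measurableEmbedding.map_apply]
  exact ((hyperplane_isClosedEmbedding hg c).isCompact_preimage
    (isCompact_closedBall _ _)).measure_lt_top

lemma sigmaFinite_hyperplaneMeasure : SigmaFinite (hyperplaneMeasure g c) := by
  have : IsLocallyFiniteMeasure (hyperplaneMeasure g c) :=
    ⟨fun x => ⟨Metric.ball x 1, Metric.ball_mem_nhds _ one_pos,
      hyperplaneMeasure_lt_top hg c Metric.isBounded_ball⟩⟩
  infer_instance

lemma hyperplaneMeasure_pos {U : Set (Space N)} (hU : IsOpen U) {x : Space N} (hx : x ∈ U)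
    (hxg : ⟪g, x⟫ + c = 0) : 0 < hyperplaneMeasure g c U := by
  have he := hyperplane_isClosedEmbedding hg c
  rw [hyperplaneMeasure_eq_map hg, he.measurableEmbedding.map_apply]
  have : x ∈ range (fun w : (ℝ ∙ g)ᗮ => (w : Space N) + (-(c / ‖g‖ ^ 2)) • g) := by
    rw [range_hyperplane hg]; exact hxg
  obtain ⟨w, rfl⟩ := this
  exact (hU.preimage he.continuous).measure_pos _ ⟨w, hx⟩

/-- In the parametrization by `(ℝ ∙ g)ᗮ` the intersection is an affine subspace; the point `x` shows
that it is proper, hence null. -/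
lemma hyperplaneMeasure_inter_eq_zero {g' x : Space N} {c' : ℝ} (hx : ⟪g, x⟫ + c = 0)
    (hx' : ⟪g', x⟫ + c' ≠ 0) : hyperplaneMeasure g c {y | ⟪g', y⟫ + c' = 0} = 0 := by
  have he := hyperplane_isClosedEmbedding hg c
  rw [hyperplaneMeasure_eq_map hg, he.measurableEmbedding.map_apply]
  let A : (ℝ ∙ g)ᗮ →ᵃ[ℝ] ℝ :=
    ((innerₛₗ ℝ g').comp (ℝ ∙ g)ᗮ.subtype).toAffineMap +
      AffineMap.const ℝ _ (⟪g', (-(c / ‖g‖ ^ 2)) • g⟫ + c')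
  have hA : ∀ w, A w = ⟪g', (w : Space N) + (-(c / ‖g‖ ^ 2)) • g⟫ + c' := by
    intro w
    simp [A, inner_add_right, add_assoc]
  have hset : (fun w : (ℝ ∙ g)ᗮ => (w : Space N) + (-(c / ‖g‖ ^ 2)) • g) ⁻¹'
      {y | ⟪g', y⟫ + c' = 0} = ((AffineSubspace.mk' (0 : ℝ) ⊥).comap A : Set _) := by
    ext w
    simp only [mem_preimage, mem_ofPred_eq, ← hA, AffineSubspace.coe_comap, SetLike.mem_coe,
      AffineSubspace.mem_mk']
    simp
  rw [hset]
  apply Measure.addHaar_affineSubspace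
  intro htop
  have : x ∈ range (fun w : (ℝ ∙ g)ᗮ => (w : Space N) + (-(c / ‖g‖ ^ 2)) • g) := by
    rw [range_hyperplane hg]; exact hx
  obtain ⟨w, rfl⟩ := this
  have hw : w ∈ (AffineSubspace.mk' (0 : ℝ) ⊥).comap A := by rw [htop]; trivial
  rw [AffineSubspace.mem_comap, AffineSubspace.mem_mk'] at hw
  apply hx'
  rw [← hA]
  simpa using hw

/-- Fubini's theorem along the normal of a hyperplane. -/
lemma integral_eq_integral_hyperplane {F : Space N → ℝ} (hF : Integrable F) :
    ∫ x, F x = ‖g‖⁻¹ * ∫ t : ℝ, ∫ y, F (y + (t / ‖g‖ ^ 2) • g) ∂(hyperplaneMeasure g c) := by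
  have hg' : ‖g‖ ≠ 0 := by simpa using hg
  set q : Space N := (-(c / ‖g‖ ^ 2)) • g with hq
  have hmp := ((ℝ ∙ g).measurePreserving_measurableEquivProd q).symm
  rw [finrank_euclideanSpace_fin, EuclideanSpace.euclideanHausdorffMeasure_eq_volume] at hmp
  have e1 : ∫ x, F x = ∫ z : (ℝ ∙ g) × (ℝ ∙ g)ᗮ, F ((z.1 : Space N) + z.2 + q) := by
    rw [← hmp.integral_comp' F]
    congr 1
  have hint : Integrable (fun z : (ℝ ∙ g) × (ℝ ∙ g)ᗮ => F ((z.1 : Space N) + z.2 + q)) := by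
    have := hmp.integrable_comp_of_integrable hF
    refine this.congr (ae_of_all _ fun z => ?_)
    simp
  rw [Measure.volume_eq_prod] at e1 hint
  rw [e1, integral_prod _ hint]
  have hv : ‖(‖g‖⁻¹ • g)‖ = 1 := by
    rw [norm_smul, norm_inv, norm_norm, inv_mul_cancel₀ hg']
  have e2 : ∀ G : Space N → ℝ, ∫ z : (ℝ ∙ g), G z = ∫ t : ℝ, G (t • (‖g‖⁻¹ • g)) := by
    intro G
    -- The isometry with `ℝ` exists for the span of a unit vector. Since the integration variable
    -- lives in a subtype, the equality of the two spans is used through a generic `s`.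
    have key : ∀ s : Submodule ℝ (Space N), (ℝ ∙ (‖g‖⁻¹ • g)) = s →
        ∫ z : s, G z = ∫ t : ℝ, G (t • (‖g‖⁻¹ • g)) := by
      rintro _ rfl
      have := (LinearIsometryEquiv.toSpanUnitSingleton (𝕜 := ℝ) (‖g‖⁻¹ • g) hv).measurePreserving
      rw [← this.integral_comp (LinearIsometryEquiv.toSpanUnitSingleton (𝕜 := ℝ) (‖g‖⁻¹ • g)
        hv).toHomeomorph.measurableEmbedding]
      congr 1
    exact key _ (Submodule.span_singleton_smul_eq (IsUnit.mk0 _ (inv_ne_zero hg')) g)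
  have e3 : ∀ u : Space N, ∫ w : (ℝ ∙ g)ᗮ, F (u + w + q) =
      ∫ y, F (y + u) ∂(hyperplaneMeasure g c) := by
    intro u
    rw [hyperplaneMeasure_eq_map hg,
      (hyperplane_isClosedEmbedding hg c).measurableEmbedding.integral_map]
    refine integral_congr_ae (ae_of_all _ fun w => ?_)
    simp only [hq]
    congr 1
    abel
  simp_rw [e3]
  rw [e2 (fun u => ∫ y, F (y + u) ∂(hyperplaneMeasure g c))]
  have := Measure.integral_comp_mul_left
    (fun t => ∫ y, F (y + t • (‖g‖⁻¹ • g)) ∂(hyperplaneMeasure g c)) (‖g‖⁻¹)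
  rw [inv_inv, abs_norm] at this
  have e4 : ∀ t : ℝ, (t / ‖g‖ ^ 2) • g = (‖g‖⁻¹ * t) • (‖g‖⁻¹ • g) := by
    intro t
    rw [smul_smul]
    congr 1
    field_simp
  simp_rw [e4]
  rw [this, smul_eq_mul, ← mul_assoc, inv_mul_cancel₀ hg', one_mul]

end Hyperplane

/-! ### The smooth transition function as a regularized step -/

section Transition

lemma continuous_deriv_smoothTransition : Continuous (deriv Real.smoothTransition) :=
  (Real.smoothTransition.contDiff (n := 1)).continuous_deriv le_rfl

/-- Such a `t` is a global minimizer; the argument includes the endpoint `t = 0`. -/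
lemma deriv_smoothTransition_of_nonpos {t : ℝ} (ht : t ≤ 0) : deriv Real.smoothTransition t = 0 := by
  apply IsLocalMin.deriv_eq_zero
  refine Eventually.of_forall fun x => ?_
  rw [Real.smoothTransition.zero_of_nonpos ht]
  exact Real.smoothTransition.nonneg x

lemma deriv_smoothTransition_of_one_le {t : ℝ} (ht : 1 ≤ t) :
    deriv Real.smoothTransition t = 0 := by
  apply IsLocalMax.deriv_eq_zero
  refine Eventually.of_forall fun x => ?_
  rw [Real.smoothTransition.one_of_one_le ht]
  exact Real.smoothTransition.le_one x

lemma integrable_deriv_smoothTransition : Integrable (deriv Real.smoothTransition) := by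
  apply continuous_deriv_smoothTransition.integrable_of_hasCompactSupport
  refine HasCompactSupport.of_support_subset_isCompact (isCompact_Icc (a := (0 : ℝ)) (b := 1)) ?_
  intro t ht
  constructor
  · by_contra h
    exact ht (deriv_smoothTransition_of_nonpos (not_le.1 h).le)
  · by_contra h
    exact ht (deriv_smoothTransition_of_one_le (not_le.1 h).le)

lemma integral_deriv_smoothTransition : ∫ t, deriv Real.smoothTransition t = 1 := by
  have h := integral_of_hasDerivAt_of_tendsto (f := Real.smoothTransition)
    (f' := deriv Real.smoothTransition) (m := 0) (n := 1)
    (fun x => ((Real.smoothTransition.contDiff (n := 1)).differentiable (by norm_num)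
      x).hasDerivAt) integrable_deriv_smoothTransition ?_ ?_
  · rw [h, sub_zero]
  · refine tendsto_const_nhds.congr' ?_
    filter_upwards [Iic_mem_atBot 0] with t ht
    exact (Real.smoothTransition.zero_of_nonpos ht).symm
  · refine tendsto_const_nhds.congr' ?_
    filter_upwards [Ici_mem_atTop 1] with t ht
    exact (Real.smoothTransition.one_of_one_le ht).symm

lemma tendsto_smoothTransition_div {l : ℝ} (hl : 0 < l) {ι : Type*} {F : Filter ι} {ε a : ι → ℝ}
    (hε : Tendsto ε F (𝓝[>] 0)) (ha : Tendsto a F (𝓝 l)) :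
    ∀ᶠ i in F, Real.smoothTransition (a i / ε i) = 1 := by
  have h1 : ∀ᶠ i in F, l / 2 < a i := ha.eventually_const_lt (by linarith)
  have h2 : ∀ᶠ i in F, ε i < l / 2 :=
    (hε.mono_right nhdsWithin_le_nhds).eventually_lt_const (by linarith)
  have h3 : ∀ᶠ i in F, 0 < ε i := hε.eventually self_mem_nhdsWithin
  filter_upwards [h1, h2, h3] with i h1 h2 h3
  apply Real.smoothTransition.one_of_one_le
  rw [one_le_div h3]
  linarith

lemma tendsto_smoothTransition_div_neg {l : ℝ} (hl : l < 0) {ι : Type*} {F : Filter ι}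
    {ε a : ι → ℝ} (hε : Tendsto ε F (𝓝[>] 0)) (ha : Tendsto a F (𝓝 l)) :
    ∀ᶠ i in F, Real.smoothTransition (a i / ε i) = 0 := by
  have h1 : ∀ᶠ i in F, a i < 0 := ha.eventually_lt_const (by linarith)
  have h3 : ∀ᶠ i in F, 0 < ε i := hε.eventually self_mem_nhdsWithin
  filter_upwards [h1, h3] with i h1 h3
  apply Real.smoothTransition.zero_of_nonpos
  exact div_nonpos_of_nonpos_of_nonneg h1.le h3.le

end Transition

lemma ae_inner_add_ne_zero {N : ℕ} {g : Space N} (hg : g ≠ 0) (c : ℝ) :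
    ∀ᵐ x : Space N, ⟪g, x⟫ + c ≠ 0 := by
  let A : Space N →ᵃ[ℝ] ℝ := (innerₛₗ ℝ g).toAffineMap + AffineMap.const ℝ _ c
  have hA : ∀ x, A x = ⟪g, x⟫ + c := fun x => by simp [A]
  have hset : {x | ¬ (⟪g, x⟫ + c ≠ 0)} = ((AffineSubspace.mk' (0 : ℝ) ⊥).comap A : Set _) := by
    ext w
    simp only [mem_ofPred_eq, ← hA, AffineSubspace.coe_comap, SetLike.mem_coe,
      AffineSubspace.mem_mk', mem_preimage]
    simp
  rw [ae_iff, hset]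
  apply Measure.addHaar_affineSubspace
  intro htop
  have hw : ((1 - c) / ‖g‖ ^ 2) • g ∈ (AffineSubspace.mk' (0 : ℝ) ⊥).comap A := by
    rw [htop]; trivial
  rw [AffineSubspace.mem_comap, AffineSubspace.mem_mk'] at hw
  have hg' : ‖g‖ ≠ 0 := by simpa using hg
  simp only [hA, inner_smul_right, real_inner_self_eq_norm_sq, vsub_eq_sub, sub_zero,
    Submodule.mem_bot] at hw
  field_simp at hw
  norm_num at hw

/-! ### The divergence theorem on polytopes -/

section Polytope

variable {N : ℕ} {ι : Type*} [Fintype ι] [DecidableEq ι] (g : ι → Space N) (c : ι → ℝ)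

/-- The intersection of finitely many half spaces. -/
def polytope : Set (Space N) := {x | ∀ i, 0 ≤ ⟪g i, x⟫ + c i}

omit [Fintype ι] [DecidableEq ι] in
lemma isClosed_polytope : IsClosed (polytope g c) := by
  have : polytope g c = ⋂ i, {x | 0 ≤ ⟪g i, x⟫ + c i} := by
    ext; simp [polytope]
  rw [this]
  exact isClosed_iInter fun i => isClosed_le continuous_const (by fun_prop)

variable {g c} (hg : ∀ i, g i ≠ 0) (hK : IsCompact (polytope g c))
  (hsep : ∀ i k, i ≠ k → ∃ x, ⟪g i, x⟫ + c i = 0 ∧ ⟪g k, x⟫ + c k ≠ 0)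
include hg hK hsep

/-- This is the term that arises when the derivative of the cutoff `∏ s((⟪g k, x⟫ + c k)/ε)` hits
the factor `i`. Fubini along `g i` leaves an integral over the rescaled normal variable `t` against
`deriv s`, which vanishes off `(0, 1)` and has total mass one. For fixed `t` the integral over the
shifted hyperplane tends to the facet integral: off a null set, by `hsep`, the other factors tend to
the indicator of the polytope. Dominated convergence is used in the hyperplane and then in `t`. -/
lemma tendsto_slab {f : Space N → ℝ} (hf : Continuous f) (i : ι) :
    Tendsto (fun ε : ℝ => ∫ x, ε⁻¹ * (deriv Real.smoothTransition ((⟪g i, x⟫ + c i) / ε) *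
      (f x * ∏ k ∈ Finset.univ.erase i, Real.smoothTransition ((⟪g k, x⟫ + c k) / ε))))
      (𝓝[>] 0)
      (𝓝 (‖g i‖⁻¹ * ∫ y in polytope g c, f y ∂(hyperplaneMeasure (g i) (c i)))) := by
  have hsig := sigmaFinite_hyperplaneMeasure (hg i) (c i)
  set μ := hyperplaneMeasure (g i) (c i) with hμ
  set s := Real.smoothTransition with hs
  have hsc : Continuous s := Real.smoothTransition.continuous
  -- Scaled so that moving by `t • v` changes `⟪g i, ·⟫` by exactly `t`.
  set v : Space N := (1 / ‖g i‖ ^ 2) • g i with hv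
  have hgi : ‖g i‖ ≠ 0 := by simpa using hg i
  have hgv : ⟪g i, v⟫ = 1 := by
    rw [hv, inner_smul_right, real_inner_self_eq_norm_sq]; field_simp
  obtain ⟨Cf, hCf⟩ := hK.exists_bound_of_continuousOn hf.continuousOn
  obtain ⟨R, hR⟩ := hK.isBounded.subset_closedBall 0
  set P : ℝ → Space N → ℝ := fun ε x =>
    f x * ∏ k ∈ Finset.univ.erase i, s ((⟪g k, x⟫ + c k) / ε) with hP
  have hPc : ∀ ε, Continuous (P ε) := by
    intro ε
    refine hf.mul (continuous_finsetProd _ fun k _ => hsc.comp ?_)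
    fun_prop
  have hprod_le : ∀ ε x, |∏ k ∈ Finset.univ.erase i, s ((⟪g k, x⟫ + c k) / ε)| ≤ 1 := by
    intro ε x
    rw [Finset.abs_prod]
    refine Finset.prod_le_one (fun _ _ => abs_nonneg _) fun k _ => ?_
    rw [abs_of_nonneg (Real.smoothTransition.nonneg _)]
    exact Real.smoothTransition.le_one _
  have hprod_mem : ∀ ε x, 0 < ε → ∏ k ∈ Finset.univ.erase i, s ((⟪g k, x⟫ + c k) / ε) ≠ 0 →
      0 ≤ ⟪g i, x⟫ + c i → x ∈ polytope g c := by
    intro ε x hε hne hi k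
    by_cases hk : k = i
    · rw [hk]; exact hi
    · by_contra hlt
      apply hne
      refine Finset.prod_eq_zero (i := k) (by simp [hk]) ?_
      exact Real.smoothTransition.zero_of_nonpos
        (div_nonpos_of_nonpos_of_nonneg (not_le.1 hlt).le hε.le)
  have hμae : ∀ᵐ y ∂μ, ⟪g i, y⟫ + c i = 0 := by
    rw [hμ, hyperplaneMeasure]
    exact ae_restrict_mem (isClosed_eq (by fun_prop) continuous_const).measurableSet
  -- Fubini along the normal, and rescaling of the normal variable
  have step1 : ∀ ε : ℝ, 0 < ε →
      ∫ x, ε⁻¹ * (deriv s ((⟪g i, x⟫ + c i) / ε) * P ε x) =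
        ‖g i‖⁻¹ * ∫ t : ℝ, deriv s t * ∫ y, P ε (y + (ε * t) • v) ∂μ := by
    intro ε hε
    have hint : Integrable
        (fun x => ε⁻¹ * (deriv s ((⟪g i, x⟫ + c i) / ε) * P ε x)) := by
      apply Continuous.integrable_of_hasCompactSupport
      · refine continuous_const.mul (Continuous.mul ?_ (hPc ε))
        exact continuous_deriv_smoothTransition.comp (by fun_prop)
      · refine HasCompactSupport.of_support_subset_isCompact hK fun x hx => ?_
        have h1 : deriv s ((⟪g i, x⟫ + c i) / ε) ≠ 0 := by
          intro h; apply hx; simp [h]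
        have h2 : ∏ k ∈ Finset.univ.erase i, s ((⟪g k, x⟫ + c k) / ε) ≠ 0 := by
          intro h; apply hx; simp [hP, h]
        refine hprod_mem ε x hε h2 ?_
        by_contra hlt
        exact h1 (deriv_smoothTransition_of_nonpos
          (div_nonpos_of_nonpos_of_nonneg (not_le.1 hlt).le hε.le))
    rw [integral_eq_integral_hyperplane (hg i) (c i) hint]
    congr 1
    have e : ∀ t : ℝ, ∫ y, ε⁻¹ * (deriv s ((⟪g i, y + (t / ‖g i‖ ^ 2) • g i⟫ + c i) / ε) *
        P ε (y + (t / ‖g i‖ ^ 2) • g i)) ∂(hyperplaneMeasure (g i) (c i)) =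
        ε⁻¹ * (deriv s (ε⁻¹ * t) * ∫ y, P ε (y + (ε * (ε⁻¹ * t)) • v) ∂μ) := by
      intro t
      rw [integral_const_mul, ← integral_const_mul (deriv s (ε⁻¹ * t))]
      congr 1
      refine integral_congr_ae ?_
      filter_upwards [hμae] with y hy
      have h1 : (t / ‖g i‖ ^ 2) • g i = t • v := by rw [hv, smul_smul]; congr 1; ring
      have h2 : ε * (ε⁻¹ * t) = t := by field_simp
      rw [h1, h2, inner_add_right, inner_smul_right, hgv]
      congr 2
      rw [show ⟪g i, y⟫ + t * 1 + c i = (⟪g i, y⟫ + c i) + t by ring, hy]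
      field_simp
      ring
    simp_rw [e]
    rw [integral_const_mul, Measure.integral_comp_mul_left
      (fun t => deriv s t * ∫ y, P ε (y + (ε * t) • v) ∂μ) ε⁻¹, inv_inv, abs_of_pos hε,
      smul_eq_mul, ← mul_assoc, inv_mul_cancel₀ hε.ne', one_mul]
  refine Tendsto.congr' (f₁ := fun ε => ‖g i‖⁻¹ * ∫ t : ℝ, deriv s t *
    ∫ y, P ε (y + (ε * t) • v) ∂μ) ?_ (Tendsto.const_mul _ ?_)
  · filter_upwards [self_mem_nhdsWithin] with ε hε
    exact (step1 ε hε).symm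
  -- Where the integrand does not vanish, the shifted point lies in the polytope, so `y` is within
  -- `‖v‖` of it. The resulting majorant depends neither on `ε` nor on `t`.
  have hbd : ∀ ε t : ℝ, 0 < ε → 0 ≤ ε * t → ε * t ≤ 1 → ∀ᵐ y ∂μ, ‖P ε (y + (ε * t) • v)‖ ≤
      (Metric.closedBall (0 : Space N) (R + ‖v‖)).indicator (fun _ => |Cf|) y := by
    intro ε t hε ht ht1
    filter_upwards [hμae] with y hy
    by_cases hne : ∏ k ∈ Finset.univ.erase i, s ((⟪g k, y + (ε * t) • v⟫ + c k) / ε) = 0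
    · simp only [hP, hne, mul_zero, norm_zero]
      exact indicator_nonneg (fun _ _ => abs_nonneg _) _
    · have hm := hprod_mem ε _ hε hne (by
        rw [inner_add_right, inner_smul_right, hgv]; linarith)
      have hyR : y ∈ Metric.closedBall (0 : Space N) (R + ‖v‖) := by
        have h1 := hR hm
        rw [mem_closedBall_zero_iff] at h1 ⊢
        have h2 : ‖y‖ ≤ ‖y + (ε * t) • v‖ + ‖(ε * t) • v‖ := by
          have := norm_sub_le (y + (ε * t) • v) ((ε * t) • v)
          simpa using this
        have h3 : ‖(ε * t) • v‖ ≤ ‖v‖ := by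
          rw [norm_smul, Real.norm_of_nonneg ht]
          exact mul_le_of_le_one_left (norm_nonneg _) ht1
        linarith
      rw [indicator_of_mem hyR, hP, norm_mul]
      calc _ ≤ |Cf| * 1 := mul_le_mul ((hCf _ hm).trans (le_abs_self _)) (hprod_le _ _)
            (abs_nonneg _) (abs_nonneg _)
        _ = _ := mul_one _
  have hbint : Integrable
      ((Metric.closedBall (0 : Space N) (R + ‖v‖)).indicator (fun _ => |Cf|)) μ :=
    (integrable_indicator_iff Metric.isClosed_closedBall.measurableSet).2
      (integrableOn_const (hyperplaneMeasure_lt_top (hg i) _ Metric.isBounded_closedBall).ne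
        (by simp))
  set M := ∫ y, (Metric.closedBall (0 : Space N) (R + ‖v‖)).indicator (fun _ => |Cf|) y ∂μ
  have hM : 0 ≤ M := integral_nonneg fun y => indicator_nonneg (fun _ _ => abs_nonneg _) _
  have hsep' : ∀ᵐ y ∂μ, ∀ k, k ≠ i → ⟪g k, y⟫ + c k ≠ 0 := by
    rw [ae_all_iff]
    intro k
    by_cases hk : k = i
    · simp [hk]
    · obtain ⟨x, hx, hx'⟩ := hsep i k (Ne.symm hk)
      filter_upwards [compl_mem_ae_iff.2
        (hyperplaneMeasure_inter_eq_zero (hg i) (c i) hx hx')] with y hy _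
      exact hy
  have hinner : ∀ t : ℝ, 0 < t → t < 1 →
      Tendsto (fun ε => ∫ y, P ε (y + (ε * t) • v) ∂μ) (𝓝[>] 0)
        (𝓝 (∫ y in polytope g c, f y ∂μ)) := by
    intro t ht0 ht1
    rw [← integral_indicator (isClosed_polytope g c).measurableSet]
    refine tendsto_integral_filter_of_dominated_convergence _ ?_ ?_ hbint ?_
    · refine Eventually.of_forall fun ε => ?_
      exact ((hPc ε).comp (by fun_prop)).aestronglyMeasurable
    · have h1 : ∀ᶠ ε : ℝ in 𝓝[>] 0, ε < 1 :=
        (tendsto_id.mono_right nhdsWithin_le_nhds).eventually_lt_const one_pos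
      filter_upwards [self_mem_nhdsWithin, h1] with ε hε hε1
      have hε0 : 0 < ε := hε
      exact hbd ε t hε (by positivity) (by nlinarith)
    · filter_upwards [hμae, hsep'] with y hy hyk
      have hε : Tendsto (fun ε : ℝ => ε) (𝓝[>] 0) (𝓝[>] 0) := tendsto_id
      have hlim : Tendsto (fun ε : ℝ => y + (ε * t) • v) (𝓝[>] 0) (𝓝 y) := by
        have : ContinuousAt (fun ε : ℝ => y + (ε * t) • v) 0 := by fun_prop
        have h2 := this.tendsto.mono_left (nhdsWithin_le_nhds (s := Ioi 0))
        simpa using h2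
      have hlimk : ∀ k, Tendsto (fun ε : ℝ => ⟪g k, y + (ε * t) • v⟫ + c k) (𝓝[>] 0)
          (𝓝 (⟪g k, y⟫ + c k)) := fun k =>
        (Continuous.tendsto (f := fun x => ⟪g k, x⟫ + c k) (by fun_prop) y).comp hlim
      have hflim : Tendsto (fun ε : ℝ => f (y + (ε * t) • v)) (𝓝[>] 0) (𝓝 (f y)) :=
        (hf.tendsto y).comp hlim
      by_cases hyK : y ∈ polytope g c
      · rw [indicator_of_mem hyK]
        refine hflim.congr' ?_
        have : ∀ᶠ ε : ℝ in 𝓝[>] 0, ∀ k, k ≠ i → s ((⟪g k, y + (ε * t) • v⟫ + c k) / ε) = 1 := by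
          rw [eventually_all]
          intro k
          by_cases hk : k = i
          · simp [hk]
          · filter_upwards [tendsto_smoothTransition_div
              (lt_of_le_of_ne (hyK k) (Ne.symm (hyk k hk))) hε (hlimk k)] with ε h _
            exact h
        filter_upwards [this] with ε h
        rw [hP]
        simp only
        rw [Finset.prod_eq_one fun k hk => h k (by simpa using hk), mul_one]
      · rw [indicator_of_notMem hyK]
        have : ∃ k, k ≠ i ∧ ⟪g k, y⟫ + c k < 0 := by
          by_contra hcon
          push Not at hcon
          apply hyK
          intro k
          by_cases hk : k = i
          · rw [hk, hy]
          · exact hcon k hk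
        obtain ⟨k, hki, hk⟩ := this
        refine tendsto_const_nhds.congr' ?_
        filter_upwards [tendsto_smoothTransition_div_neg hk hε (hlimk k)] with ε h
        rw [hP]
        simp only
        rw [Finset.prod_eq_zero (i := k) (by simp [hki]) h, mul_zero]
  -- The limit is written as an integral against the unit mass `deriv s`, in order to apply
  -- dominated convergence in `t`.
  have hone : (∫ y in polytope g c, f y ∂μ) =
      ∫ t : ℝ, deriv s t * ∫ y in polytope g c, f y ∂μ := by
    rw [integral_mul_const, integral_deriv_smoothTransition, one_mul]
  rw [hone]
  refine tendsto_integral_filter_of_dominated_convergence (fun t => |deriv s t| * M) ?_ ?_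
    (integrable_deriv_smoothTransition.abs.mul_const M) ?_
  · refine Eventually.of_forall fun ε => ?_
    refine continuous_deriv_smoothTransition.aestronglyMeasurable.mul ?_
    have hc2 : Continuous (fun z : ℝ × Space N => P ε (z.2 + (ε * z.1) • v)) :=
      (hPc ε).comp (by fun_prop)
    exact (hc2.stronglyMeasurable.integral_prod_right (ν := μ)).aestronglyMeasurable
  · have h1 : ∀ᶠ ε : ℝ in 𝓝[>] 0, ε < 1 :=
      (tendsto_id.mono_right nhdsWithin_le_nhds).eventually_lt_const one_pos
    filter_upwards [self_mem_nhdsWithin, h1] with ε hε hε1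
    refine ae_of_all _ fun t => ?_
    have hε0 : 0 < ε := hε
    rw [norm_mul]
    by_cases ht : 0 < t ∧ t < 1
    · refine mul_le_mul_of_nonneg_left ?_ (norm_nonneg _)
      exact norm_integral_le_of_norm_le hbint
        (hbd ε t hε (mul_nonneg hε0.le ht.1.le) (by nlinarith [ht.1, ht.2]))
    · have : deriv s t = 0 := by
        rw [not_and_or, not_lt, not_lt] at ht
        exact ht.elim deriv_smoothTransition_of_nonpos deriv_smoothTransition_of_one_le
      simp [this]
  · refine ae_of_all _ fun t => ?_
    by_cases ht : 0 < t ∧ t < 1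
    · exact (hinner t ht.1 ht.2).const_mul _
    · have : deriv s t = 0 := by
        rw [not_and_or, not_lt, not_lt] at ht
        exact ht.elim deriv_smoothTransition_of_nonpos deriv_smoothTransition_of_one_le
      simp [this]

/-- The divergence theorem on a polytope. -/
theorem integral_fderiv_polytope {f : Space N → ℝ} (hf : ContDiff ℝ 1 f) (u : Space N) :
    ∫ x in polytope g c, fderiv ℝ f x u =
      -∑ i, ⟪g i, u⟫ * (‖g i‖⁻¹ * ∫ y in polytope g c, f y ∂(hyperplaneMeasure (g i) (c i))) := by
  set s := Real.smoothTransition with hs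
  have hsc : Continuous s := Real.smoothTransition.continuous
  have hfd : Continuous (fun x => fderiv ℝ f x u) :=
    (hf.continuous_fderiv (by norm_num)).clm_apply continuous_const
  -- A smooth cutoff that vanishes outside the polytope and tends to its indicator almost
  -- everywhere. Integration by parts against `ρ ε` produces one slab integral for each facet; both
  -- sides are then passed to the limit.
  set ρ : ℝ → Space N → ℝ := fun ε x => ∏ i, s ((⟪g i, x⟫ + c i) / ε) with hρ
  have hρc : ∀ ε, Continuous (ρ ε) := fun ε =>
    continuous_finsetProd _ fun k _ => hsc.comp (by fun_prop)
  have hρmem : ∀ ε x, 0 < ε → ρ ε x ≠ 0 → x ∈ polytope g c := by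
    intro ε x hε hne k
    by_contra hlt
    apply hne
    refine Finset.prod_eq_zero (i := k) (by simp) ?_
    exact Real.smoothTransition.zero_of_nonpos
        (div_nonpos_of_nonpos_of_nonneg (not_le.1 hlt).le hε.le)
  have hsd : ∀ t, HasDerivAt s (deriv s t) t := fun t =>
    ((Real.smoothTransition.contDiff (n := 1)).differentiable (by norm_num) t).hasDerivAt
  have hρd : ∀ ε x, HasFDerivAt (ρ ε) (∑ i, (∏ k ∈ Finset.univ.erase i,
      s ((⟪g k, x⟫ + c k) / ε)) • ((deriv s ((⟪g i, x⟫ + c i) / ε)) •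
        (ε⁻¹ • innerSL ℝ (g i)))) x := by
    intro ε x
    refine HasFDerivAt.finsetProd fun i _ => ?_
    have h1 : HasFDerivAt (fun x : Space N => (⟪g i, x⟫ + c i) / ε) (ε⁻¹ • innerSL ℝ (g i)) x := by
      have := (((innerSL ℝ (g i)).hasFDerivAt (x := x)).add_const (c i)).const_mul ε⁻¹
      refine this.congr_of_eventuallyEq (Eventually.of_forall fun y => ?_)
      simp [div_eq_inv_mul]
    exact (hsd _).comp_hasFDerivAt x h1
  have hρ' : ∀ ε x, fderiv ℝ (ρ ε) x u * f x = ∑ i, ⟪g i, u⟫ * (ε⁻¹ *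
      (deriv s ((⟪g i, x⟫ + c i) / ε) * (f x * ∏ k ∈ Finset.univ.erase i,
        s ((⟪g k, x⟫ + c k) / ε)))) := by
    intro ε x
    rw [(hρd ε x).fderiv]
    simp only [_root_.sum_apply, _root_.smul_apply, smul_eq_mul,
      innerSL_apply_apply, Finset.sum_mul]
    exact Finset.sum_congr rfl fun i _ => by ring
  have hint : ∀ ε i, 0 < ε → Integrable (fun x : Space N => (ε⁻¹ *
      (deriv s ((⟪g i, x⟫ + c i) / ε) * (f x * ∏ k ∈ Finset.univ.erase i,
        s ((⟪g k, x⟫ + c k) / ε))))) := by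
    intro ε i hε
    apply Continuous.integrable_of_hasCompactSupport
    · refine continuous_const.mul (Continuous.mul
        (continuous_deriv_smoothTransition.comp (by fun_prop)) (hf.continuous.mul
        (continuous_finsetProd _ fun k _ => hsc.comp (by fun_prop))))
    · refine HasCompactSupport.of_support_subset_isCompact hK fun x hx => ?_
      intro k
      by_contra hlt
      apply hx
      have hle := div_nonpos_of_nonpos_of_nonneg (not_le.1 hlt).le hε.le
      by_cases hk : k = i
      · subst hk
        simp only
        rw [deriv_smoothTransition_of_nonpos hle, zero_mul, mul_zero]
      · simp only
        rw [Finset.prod_eq_zero (i := k) (by simp [hk])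
          (Real.smoothTransition.zero_of_nonpos hle)]
        simp
  have hparts : ∀ ε : ℝ, 0 < ε → ∫ x, ρ ε x * fderiv ℝ f x u = -∑ i, ⟪g i, u⟫ *
      ∫ x, ε⁻¹ * (deriv s ((⟪g i, x⟫ + c i) / ε) * (f x * ∏ k ∈ Finset.univ.erase i,
        s ((⟪g k, x⟫ + c k) / ε))) := by
    intro ε hε
    have hcs : ∀ F : Space N → ℝ, HasCompactSupport (fun x => ρ ε x * F x) := fun F =>
      HasCompactSupport.of_support_subset_isCompact hK fun x hx =>
        hρmem ε x hε fun h => hx (by simp [h])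
    rw [integral_mul_fderiv_eq_neg_fderiv_mul_of_integrable]
    · simp_rw [hρ']
      rw [integral_finsetSum _ fun i _ => (hint ε i hε).const_mul _]
      simp_rw [integral_const_mul]
    · simp_rw [hρ']
      exact integrable_finsetSum _ fun i _ => (hint ε i hε).const_mul _
    · exact ((hρc ε).mul hfd).integrable_of_hasCompactSupport (hcs _)
    · exact ((hρc ε).mul hf.continuous).integrable_of_hasCompactSupport (hcs _)
    · exact fun x _ => (hρd ε x).differentiableAt
    · exact fun x _ => hf.differentiable (by norm_num) x
  have hlimL : Tendsto (fun ε : ℝ => ∫ x, ρ ε x * fderiv ℝ f x u) (𝓝[>] 0)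
      (𝓝 (∫ x in polytope g c, fderiv ℝ f x u)) := by
    rw [← integral_indicator (isClosed_polytope g c).measurableSet]
    have hbint : Integrable ((polytope g c).indicator fun x => |fderiv ℝ f x u|) :=
      (integrable_indicator_iff (isClosed_polytope g c).measurableSet).2
        (hfd.abs.continuousOn.integrableOn_compact hK)
    refine tendsto_integral_filter_of_dominated_convergence _ ?_ ?_ hbint ?_
    · exact Eventually.of_forall fun ε => ((hρc ε).mul hfd).aestronglyMeasurable
    · filter_upwards [self_mem_nhdsWithin] with ε hε
      refine ae_of_all _ fun x => ?_
      by_cases hx : ρ ε x = 0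
      · simp only [hx, zero_mul, norm_zero]
        exact indicator_nonneg (fun _ _ => abs_nonneg _) _
      · rw [indicator_of_mem (hρmem ε x hε hx), norm_mul]
        refine mul_le_of_le_one_left (norm_nonneg _) ?_
        rw [Real.norm_eq_abs, hρ, Finset.abs_prod]
        refine Finset.prod_le_one (fun _ _ => abs_nonneg _) fun k _ => ?_
        rw [abs_of_nonneg (Real.smoothTransition.nonneg _)]
        exact Real.smoothTransition.le_one _
    · have hae : ∀ᵐ x : Space N, ∀ i, ⟪g i, x⟫ + c i ≠ 0 :=
        ae_all_iff.2 fun i => ae_inner_add_ne_zero (hg i) (c i)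
      filter_upwards [hae] with x hx
      have hε : Tendsto (fun ε : ℝ => ε) (𝓝[>] 0) (𝓝[>] 0) := tendsto_id
      by_cases hxK : x ∈ polytope g c
      · rw [indicator_of_mem hxK]
        have : ∀ᶠ ε : ℝ in 𝓝[>] 0, ∀ k, s ((⟪g k, x⟫ + c k) / ε) = 1 :=
          eventually_all.2 fun k => tendsto_smoothTransition_div
            (lt_of_le_of_ne (hxK k) (Ne.symm (hx k))) hε tendsto_const_nhds
        refine tendsto_const_nhds.congr' ?_
        filter_upwards [this] with ε h
        rw [hρ]
        simp only
        rw [Finset.prod_eq_one fun k _ => h k, one_mul]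
      · rw [indicator_of_notMem hxK]
        obtain ⟨k, hk⟩ : ∃ k, ⟪g k, x⟫ + c k < 0 := by
          by_contra hcon
          push Not at hcon
          exact hxK hcon
        refine tendsto_const_nhds.congr' ?_
        filter_upwards [tendsto_smoothTransition_div_neg hk hε tendsto_const_nhds] with ε h
        rw [hρ]
        simp only
        rw [Finset.prod_eq_zero (i := k) (by simp) h, zero_mul]
  have hlimR : Tendsto (fun ε : ℝ => ∫ x, ρ ε x * fderiv ℝ f x u) (𝓝[>] 0)
      (𝓝 (-∑ i, ⟪g i, u⟫ * (‖g i‖⁻¹ *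
        ∫ y in polytope g c, f y ∂(hyperplaneMeasure (g i) (c i))))) := by
    refine Tendsto.congr' (f₁ := fun ε : ℝ => -∑ i, ⟪g i, u⟫ *
      ∫ x, ε⁻¹ * (deriv s ((⟪g i, x⟫ + c i) / ε) * (f x * ∏ k ∈ Finset.univ.erase i,
        s ((⟪g k, x⟫ + c k) / ε)))) ?_ ?_
    · filter_upwards [self_mem_nhdsWithin] with ε hε
      exact (hparts ε hε).symm
    · exact (tendsto_finsetSum _ fun i _ =>
        (tendsto_slab hg hK hsep hf.continuous i).const_mul _).neg
  exact tendsto_nhds_unique hlimL hlimR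

end Polytope

/-! ### Barycentric coordinates, facets and normals of a simplex -/

/-- The vertices of a nondegenerate `N`-simplex. -/
structure IsSimplex {N : ℕ} (K : Finset (Space N)) : Prop where
  indep : AffineIndependent ℝ ((↑) : K → Space N)
  card : K.card = N + 1

namespace IsSimplex

variable {N : ℕ} {K : Finset (Space N)} (h : IsSimplex K)
include h

/-- The vertices of a simplex as an affine basis. -/
def basis : AffineBasis K ℝ (Space N) where
  toFun := (↑)
  ind' := h.indep
  tot' := by
    rw [h.indep.affineSpan_eq_top_iff_card_eq_finrank_add_one, finrank_euclideanSpace_fin,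
      Fintype.card_coe, h.card]

@[simp] lemma basis_apply (a : K) : h.basis a = a := rfl

lemma range_basis : range h.basis = (K : Set (Space N)) := Subtype.range_coe

/-- The gradient of a barycentric coordinate. -/
def grad (a : K) : Space N :=
  (InnerProductSpace.toDual ℝ (Space N)).symm (h.basis.coord a).linear.toContinuousLinearMap

/-- The value of a barycentric coordinate at the origin. -/
def off (a : K) : ℝ := h.basis.coord a 0

lemma inner_grad (a : K) (x : Space N) : ⟪h.grad a, x⟫ = (h.basis.coord a).linear x := by
  simp [grad]

lemma coord_eq (a : K) (x : Space N) : h.basis.coord a x = ⟪h.grad a, x⟫ + h.off a := by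
  rw [inner_grad, off, AffineMap.decomp' (h.basis.coord a)]
  simp

lemma coord_self (a : K) : h.basis.coord a (a : Space N) = 1 :=
  h.basis.coord_apply_eq a

lemma coord_ne {a b : K} (hab : a ≠ b) : h.basis.coord a (b : Space N) = 0 :=
  h.basis.coord_apply_ne hab

lemma sum_coord (x : Space N) : ∑ a, h.basis.coord a x = 1 := h.basis.sum_coord_apply_eq_one x

lemma sum_coord_smul (x : Space N) : ∑ a : K, h.basis.coord a x • (a : Space N) = x :=
  h.basis.linear_combination_coord_eq_self x

lemma exists_ne (hN : 0 < N) (a : Space N) : ∃ b : K, (b : Space N) ≠ a := by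
  obtain ⟨b, hb, hba⟩ := Finset.exists_mem_ne (s := K) (by rw [h.card]; omega) a
  exact ⟨⟨b, hb⟩, hba⟩

lemma nonempty : K.Nonempty := Finset.card_pos.1 (by rw [h.card]; omega)

lemma grad_ne_zero (hN : 0 < N) (a : K) : h.grad a ≠ 0 := by
  obtain ⟨b, hb⟩ := h.exists_ne hN a
  intro h0
  have h1 := h.coord_self a
  have h2 := h.coord_ne (a := a) (b := b) fun e => hb (by rw [e])
  rw [coord_eq, h0, inner_zero_left] at h1 h2
  linarith

lemma mem_hull {x : Space N} : x ∈ hull K ↔ ∀ a, 0 ≤ h.basis.coord a x := by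
  rw [hull, ← h.range_basis, h.basis.convexHull_eq_nonneg_coord]; rfl

lemma mem_interior {x : Space N} : x ∈ interior (hull K) ↔ ∀ a, 0 < h.basis.coord a x := by
  rw [hull, ← h.range_basis, h.basis.interior_convexHull]; rfl

lemma hull_eq : hull K = polytope h.grad h.off := by
  ext x
  rw [h.mem_hull]
  simp only [coord_eq]
  rfl

lemma sep (i k : K) (hik : i ≠ k) :
    ∃ x, ⟪h.grad i, x⟫ + h.off i = 0 ∧ ⟪h.grad k, x⟫ + h.off k ≠ 0 := by
  refine ⟨k, ?_, ?_⟩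
  · rw [← coord_eq, h.coord_ne hik]
  · rw [← coord_eq, h.coord_self]; exact one_ne_zero

lemma mem_hull_facet {a : K} {x : Space N} :
    x ∈ hull (facet K a) ↔ x ∈ hull K ∧ h.basis.coord a x = 0 := by
  classical
  have hfac : (facet K (a : Space N) : Set (Space N)) = (K : Set (Space N)) \ {(a : Space N)} := by
    simp [facet]
  constructor
  · intro hx
    refine ⟨convexHull_mono (by rw [hfac]; exact sdiff_subset) hx, ?_⟩
    have hconv : Convex ℝ {y | h.basis.coord a y = 0} :=
      (convex_singleton (0 : ℝ)).affine_preimage (h.basis.coord a)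
    refine convexHull_min (t := {y | h.basis.coord a y = 0}) ?_ hconv hx
    intro y hy
    rw [hfac] at hy
    exact h.coord_ne (b := ⟨y, hy.1⟩) fun e => hy.2 (by rw [e]; rfl)
  · rintro ⟨hx, hxa⟩
    rw [h.mem_hull] at hx
    have hsum := h.sum_coord_smul x
    have h1 := h.sum_coord x
    rw [← Finset.add_sum_erase _ _ (Finset.mem_univ a), hxa] at hsum h1
    rw [zero_smul, zero_add] at hsum
    rw [zero_add] at h1
    rw [← hsum]
    refine (convex_convexHull ℝ _).sum_mem (fun i _ => hx i) h1 fun i hi => ?_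
    apply subset_convexHull
    rw [hfac]
    exact ⟨i.2, fun e => (Finset.mem_erase.1 hi).1 (Subtype.ext e)⟩

lemma hull_facet (a : K) : hull (facet K a) = hull K ∩ {x | ⟪h.grad a, x⟫ + h.off a = 0} := by
  ext x
  rw [h.mem_hull_facet]
  simp [coord_eq]

lemma barycenter_mem_interior : barycenter K ∈ interior (hull K) := by
  rw [h.mem_interior]
  intro a
  have hK : (0 : ℝ) < K.card := by rw [h.card]; positivity
  have : barycenter K = Finset.univ.centroid ℝ h.basis := by
    rw [Finset.centroid_eq_centerMass _ (by
      have := h.nonempty; exact ⟨⟨_, this.choose_spec⟩, Finset.mem_univ _⟩)]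
    rw [Finset.centerMass, barycenter]
    simp only [Finset.centroidWeights_apply, Finset.sum_const, Finset.card_univ, Fintype.card_coe,
      nsmul_eq_mul, basis_apply]
    rw [mul_inv_cancel₀ hK.ne', inv_one, one_smul, ← Finset.smul_sum,
      Finset.sum_coe_sort K (fun x => x)]
  rw [this, h.basis.coord_apply_centroid (Finset.mem_univ a)]
  simp only [Finset.card_univ, Fintype.card_coe]
  positivity

lemma card_facet (a : K) : (facet K (a : Space N)).card = N := by
  classical
  rw [facet, Finset.card_erase_of_mem a.2, h.card]; rfl

/-- The barycenter of a facet serves as the sample point in its relative interior: all coordinates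
but one are positive there. -/
lemma coord_barycenter_facet (hN : 0 < N) (a b : K) :
    h.basis.coord b (barycenter (facet K (a : Space N))) = if b = a then 0 else (N : ℝ)⁻¹ := by
  classical
  have hN' : (N : ℝ) ≠ 0 := by positivity
  have key : h.basis.coord b (barycenter (facet K (a : Space N))) =
      (N : ℝ)⁻¹ * ∑ y ∈ facet K (a : Space N), h.basis.coord b y := by
    simp only [coord_eq, Finset.sum_add_distrib, Finset.sum_const, h.card_facet, barycenter,
      inner_smul_right, inner_sum, nsmul_eq_mul]
    field_simp
  rw [key]
  by_cases hb : b = a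
  · rw [if_pos hb, Finset.sum_eq_zero, mul_zero]
    intro y hy
    rw [facet, Finset.mem_erase] at hy
    exact h.coord_ne (b := ⟨y, hy.2⟩) fun e => hy.1 (by rw [← hb, e])
  · rw [if_neg hb, Finset.sum_eq_single (b : Space N), h.coord_self, mul_one]
    · intro y hy hyb
      rw [facet, Finset.mem_erase] at hy
      exact h.coord_ne (b := ⟨y, hy.2⟩) fun e => hyb (by rw [e])
    · intro hb'
      exact absurd (Finset.mem_erase.2 ⟨fun e => hb (Subtype.ext e), b.2⟩) hb'

/-- The coordinate of `a` vanishes on the facet, so its gradient is orthogonal to all facet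
directions; both spaces have dimension `N - 1`, which gives equality. -/
lemma vectorSpan_facet (hN : 0 < N) (a : K) :
    (vectorSpan ℝ (facet K (a : Space N) : Set (Space N)))ᗮ = ℝ ∙ h.grad a := by
  classical
  have hle : vectorSpan ℝ (facet K (a : Space N) : Set (Space N)) ≤ (ℝ ∙ h.grad a)ᗮ := by
    rw [vectorSpan_def, Submodule.span_le]
    rintro _ ⟨x, hx, y, hy, rfl⟩
    rw [SetLike.mem_coe, Submodule.mem_orthogonal_singleton_iff_inner_right]
    have hz : ∀ z ∈ (facet K (a : Space N) : Set (Space N)), h.basis.coord a z = 0 := by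
      intro z hz
      rw [Finset.mem_coe, facet, Finset.mem_erase] at hz
      exact h.coord_ne (b := ⟨z, hz.2⟩) fun e => hz.1 (by rw [e])
    have h1 := hz x hx
    have h2 := hz y hy
    rw [coord_eq] at h1 h2
    simp only [vsub_eq_sub, inner_sub_right]
    linarith
  have hfin : Module.finrank ℝ (vectorSpan ℝ (facet K (a : Space N) : Set (Space N))) = N - 1 := by
    have hind : AffineIndependent ℝ ((↑) : (facet K (a : Space N)) → Space N) :=
      h.indep.mono (s := (facet K (a : Space N) : Set (Space N))) (t := (K : Set (Space N)))
        (by intro x hx; rw [Finset.mem_coe, facet, Finset.mem_erase] at hx; exact hx.2)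
    have := hind.finrank_vectorSpan (n := N - 1) (by
      rw [Fintype.card_coe, h.card_facet]; omega)
    have hr : ∀ s : Set (Space N), range ((↑) : (facet K (a : Space N)) → Space N) = s →
        Module.finrank ℝ (vectorSpan ℝ s) = N - 1 := by
      rintro _ rfl
      exact this
    exact hr _ Subtype.range_coe
  have heq := Submodule.eq_of_le_of_finrank_eq hle (by
    rw [hfin, finrank_orthogonal_span (h.grad_ne_zero hN a)])
  rw [heq, Submodule.orthogonal_orthogonal]

/-- The sign is negative because the coordinate of `a` falls from one at `a` to zero on the facet.
-/
lemma normal_eq (hN : 0 < N) (a : K) : normal K a = -(‖h.grad a‖⁻¹ • h.grad a) := by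
  have hg := h.grad_ne_zero hN a
  have hg' : ‖h.grad a‖ ≠ 0 := by simpa using hg
  have hu : (vectorSpan ℝ (facet K (a : Space N) : Set (Space N)))ᗮ.starProjection
      (barycenter (facet K (a : Space N)) - a) = (-(1 / ‖h.grad a‖ ^ 2)) • h.grad a := by
    have hW : ∀ (W : Submodule ℝ (Space N)) [W.HasOrthogonalProjection], W = ℝ ∙ h.grad a →
        ∀ z, W.starProjection z = (ℝ ∙ h.grad a).starProjection z := by
      rintro _ _ rfl z
      rfl
    rw [hW _ (h.vectorSpan_facet hN a), Submodule.starProjection_singleton]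
    have h1 := h.coord_self a
    have h2 := h.coord_barycenter_facet hN a a
    rw [coord_eq] at h1 h2
    rw [if_pos rfl] at h2
    congr 1
    rw [inner_sub_right]
    have : ⟪h.grad a, barycenter (facet K (a : Space N))⟫ - ⟪h.grad a, (a : Space N)⟫ = -1 := by
      linarith
    rw [this]
    simp [neg_div]
  rw [normal, hu]
  rw [norm_smul, smul_smul, ← neg_smul]
  congr 1
  rw [Real.norm_eq_abs, abs_neg, abs_of_pos (by positivity)]
  field_simp

end IsSimplex

/-! ### Surface measure on facets, and the divergence theorem on a simplex -/

/-- The surface measure of the facet of `K` opposite to `a`. -/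
def facetMeasure {N : ℕ} (K : Finset (Space N)) (a : Space N) : Measure (Space N) :=
  (Measure.euclideanHausdorffMeasure (N - 1)).restrict (hull (facet K a))

lemma isCompact_hull {N : ℕ} (K : Finset (Space N)) : IsCompact (hull K) :=
  K.finite_toSet.isCompact_convexHull ℝ

lemma ae_mem_facetMeasure {N : ℕ} (K : Finset (Space N)) (a : Space N) :
    ∀ᵐ x ∂(facetMeasure K a), x ∈ hull (facet K a) :=
  ae_restrict_mem (isCompact_hull _).isClosed.measurableSet

namespace IsSimplex

variable {N : ℕ} {K : Finset (Space N)} (h : IsSimplex K)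
include h

lemma facetMeasure_eq (a : K) :
    facetMeasure K a = (hyperplaneMeasure (h.grad a) (h.off a)).restrict (hull K) := by
  rw [facetMeasure, hyperplaneMeasure,
    Measure.restrict_restrict (isCompact_hull K).isClosed.measurableSet, ← h.hull_facet]

lemma isFiniteMeasure_facetMeasure (hN : 0 < N) (a : K) : IsFiniteMeasure (facetMeasure K a) := by
  rw [h.facetMeasure_eq]
  refine ⟨?_⟩
  rw [Measure.restrict_apply_univ]
  exact hyperplaneMeasure_lt_top (h.grad_ne_zero hN a) _ (isCompact_hull K).isBounded

/-- The divergence theorem on a simplex. -/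
theorem integral_fderiv (hN : 0 < N) {f : Space N → ℝ} (hf : ContDiff ℝ 1 f) (u : Space N) :
    ∫ x in hull K, fderiv ℝ f x u = ∑ a ∈ K, ⟪normal K a, u⟫ * facetIntegral K a f := by
  have := integral_fderiv_polytope (g := h.grad) (c := h.off) (fun i => h.grad_ne_zero hN i)
    (h.hull_eq ▸ (isCompact_hull K)) h.sep hf u
  rw [h.hull_eq, this, ← Finset.sum_coe_sort K (fun a => ⟪normal K a, u⟫ * facetIntegral K a f),
    ← Finset.sum_neg_distrib]
  refine Finset.sum_congr rfl fun a _ => ?_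
  rw [h.normal_eq hN, facetIntegral]
  change _ = _ * ∫ x, f x ∂(facetMeasure K a)
  rw [h.facetMeasure_eq, h.hull_eq, inner_neg_left, inner_smul_left]
  simp only [conj_trivial]
  ring

/-- The support is open and meets the hyperplane of the facet, hence in positive measure; by `hs`
its trace on this hyperplane stays inside the facet. -/
lemma facetMeasure_inter_pos (hN : 0 < N) (a : K) {f : Space N → ℝ} (hf : Continuous f)
    (hf0 : ∀ x, 0 ≤ f x) (hpos : 0 < f (barycenter (facet K (a : Space N))))
    (hs : Function.support f ⊆ {x | ∀ b, b ≠ a → 0 < h.basis.coord b x}) :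
    0 < facetIntegral K a f := by
  have hfin := h.isFiniteMeasure_facetMeasure hN a
  change 0 < ∫ x, f x ∂(facetMeasure K a)
  rw [integral_pos_iff_support_of_nonneg hf0]
  · have hU : IsOpen (Function.support f) := hf.isOpen_support
    have := hyperplaneMeasure_pos (h.grad_ne_zero hN a) (h.off a) hU (x := barycenter _) hpos.ne'
      (by rw [← coord_eq, h.coord_barycenter_facet hN, if_pos rfl])
    refine this.trans_le ?_
    rw [facetMeasure, h.hull_facet, hyperplaneMeasure, Measure.restrict_apply hU.measurableSet,
      Measure.restrict_apply hU.measurableSet]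
    refine measure_mono ?_
    rintro x ⟨hx, hxa⟩
    refine ⟨hx, ?_, hxa⟩
    rw [h.mem_hull]
    intro b
    by_cases hb : b = a
    · rw [hb, coord_eq]; exact hxa.ge
    · exact (hs hx b hb).le
  · obtain ⟨C, hC⟩ := (isCompact_hull (facet K (a : Space N))).exists_bound_of_continuousOn
      hf.continuousOn
    refine Integrable.of_bound hf.aestronglyMeasurable C ?_
    filter_upwards [ae_mem_facetMeasure K a] with x hx
    exact hC x hx

/-- The height of a simplex is at least the diameter of an inscribed ball. -/
lemma norm_grad_le (hN : 0 < N) (a : K) {x : Space N} {r : ℝ} (hr : 0 ≤ r)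
    (hx : Metric.closedBall x r ⊆ hull K) : 2 * r ≤ ‖h.grad a‖⁻¹ := by
  have hg' : 0 < ‖h.grad a‖ := by simpa using h.grad_ne_zero hN a
  -- Between the points `x - e` and `x + e` of the ball the coordinate of `a`, which takes values in
  -- `[0, 1]`, changes by `2 r ‖grad a‖`.
  set e := (r * ‖h.grad a‖⁻¹) • h.grad a with he
  have hen : ‖e‖ = r := by
    rw [he, norm_smul, Real.norm_of_nonneg (by positivity)]; field_simp
  have h1 : x + e ∈ hull K := hx (by simp [hen])
  have h2 : x - e ∈ hull K := hx (by simp [Metric.mem_closedBall, dist_eq_norm, hen])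
  rw [h.mem_hull] at h1 h2
  have h3 : h.basis.coord a (x + e) ≤ 1 := by
    rw [← h.sum_coord (x + e)]
    exact Finset.single_le_sum (f := fun a => h.basis.coord a (x + e)) (fun i _ => h1 i)
      (Finset.mem_univ a)
  have h4 := h2 a
  rw [coord_eq] at h3 h4
  rw [inner_add_right] at h3
  rw [inner_sub_right] at h4
  have h5 : ⟪h.grad a, e⟫ = r * ‖h.grad a‖ := by
    rw [he, inner_smul_right, real_inner_self_eq_norm_sq]; field_simp
  rw [← one_div, le_div_iff₀ hg']
  linarith

end IsSimplex

/-! ### Positive definite forms in finite dimension -/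

section FiniteDimensional

variable {X : Type*} [AddCommGroup X] [Module ℝ X] [FiniteDimensional ℝ X]

/-- By compactness `b₁` has a positive minimum on the unit sphere; the rest is homogeneity. -/
lemma exists_le_mul_of_posDef_of_normed {Y : Type*} [NormedAddCommGroup Y] [NormedSpace ℝ Y]
    [FiniteDimensional ℝ Y] (b₁ b₂ : Y →ₗ[ℝ] Y →ₗ[ℝ] ℝ) (hpos : ∀ x, x ≠ 0 → 0 < b₁ x x) :
    ∃ C : ℝ, 0 ≤ C ∧ ∀ x, b₂ x x ≤ C * b₁ x x := by
  have hcont : ∀ b : Y →ₗ[ℝ] Y →ₗ[ℝ] ℝ, ∃ B : Y →L[ℝ] Y →L[ℝ] ℝ, ∀ x y, B x y = b x y := fun b =>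
    ⟨LinearMap.toContinuousLinearMap (LinearMap.toContinuousLinearMap.toLinearMap ∘ₗ b),
      fun _ _ => rfl⟩
  obtain ⟨B₁, hB₁⟩ := hcont b₁
  obtain ⟨B₂, hB₂⟩ := hcont b₂
  rcases subsingleton_or_nontrivial Y with hY | hY
  · exact ⟨0, le_rfl, fun x => by simp [Subsingleton.elim x 0]⟩
  obtain ⟨x₀, hx₀, hmin⟩ := (isCompact_sphere (0 : Y) 1).exists_isMinOn
    (NormedSpace.sphere_nonempty.2 zero_le_one) (f := fun x => B₁ x x)
    (Continuous.continuousOn (by fun_prop))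
  have hm : 0 < B₁ x₀ x₀ := by
    rw [hB₁]
    refine hpos _ fun h0 => ?_
    simp [h0] at hx₀
  refine ⟨‖B₂‖ / B₁ x₀ x₀, by positivity, fun x => ?_⟩
  by_cases hx : x = 0
  · simp [hx]
  have hxn : ‖x‖ ≠ 0 := by simpa using hx
  have h1 : B₁ x₀ x₀ ≤ B₁ (‖x‖⁻¹ • x) (‖x‖⁻¹ • x) :=
    hmin (by simp [norm_smul, inv_mul_cancel₀ hxn])
  simp only [map_smul, _root_.smul_apply, smul_eq_mul] at h1
  have h2 : B₁ x₀ x₀ * ‖x‖ ^ 2 ≤ B₁ x x := by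
    calc _ ≤ (‖x‖⁻¹ * (‖x‖⁻¹ * B₁ x x)) * ‖x‖ ^ 2 := by gcongr
      _ = _ := by field_simp
  rw [← hB₁, ← hB₂]
  calc B₂ x x ≤ ‖B₂‖ * ‖x‖ * ‖x‖ := (le_abs_self _).trans (B₂.le_opNorm₂ x x)
    _ = ‖B₂‖ / B₁ x₀ x₀ * (B₁ x₀ x₀ * ‖x‖ ^ 2) := by field_simp
    _ ≤ _ := by gcongr

/-- On a finite-dimensional space, a bilinear form is bounded by any positive definite one. -/
lemma exists_le_mul_of_posDef (b₁ b₂ : X →ₗ[ℝ] X →ₗ[ℝ] ℝ) (hpos : ∀ x, x ≠ 0 → 0 < b₁ x x) :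
    ∃ C : ℝ, 0 ≤ C ∧ ∀ x, b₂ x x ≤ C * b₁ x x := by
  let e := (Module.finBasis ℝ X).equivFun
  obtain ⟨C, hC, h⟩ := exists_le_mul_of_posDef_of_normed
    (b₁.compl₁₂ e.symm.toLinearMap e.symm.toLinearMap)
    (b₂.compl₁₂ e.symm.toLinearMap e.symm.toLinearMap)
    (fun x hx => hpos _ (by simpa using hx))
  exact ⟨C, hC, fun x => by simpa using h (e x)⟩

/-- A positive definite form on a finite-dimensional space represents all linear functionals. -/
lemma exists_represent (b : X →ₗ[ℝ] X →ₗ[ℝ] ℝ) (hpos : ∀ x, x ≠ 0 → 0 < b x x)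
    (f : X →ₗ[ℝ] ℝ) : ∃ u, ∀ v, b u v = f v := by
  have hinj : Function.Injective b := by
    rw [← LinearMap.ker_eq_bot, LinearMap.ker_eq_bot']
    intro x hx
    by_contra h
    have := hpos x h
    rw [hx] at this
    simp at this
  have hsurj := (LinearMap.injective_iff_surjective_of_finrank_eq_finrank
    (Subspace.dual_finrank_eq (K := ℝ) (V := X)).symm (f := b)).1 hinj
  obtain ⟨u, hu⟩ := hsurj f
  exact ⟨u, fun v => by rw [hu]⟩

end FiniteDimensional

/-! ### Polynomials as functions, and the inverse inequality on balls -/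

section Polynomial

variable {N : ℕ}

/-- The value of a polynomial at a point of space. -/
def ev (q : MvPolynomial (Fin N) ℝ) (x : Space N) : ℝ := MvPolynomial.eval (fun i => x i) q

@[simp] lemma ev_add (q r : MvPolynomial (Fin N) ℝ) (x : Space N) :
    ev (q + r) x = ev q x + ev r x := by simp [ev]

@[simp] lemma ev_smul (c : ℝ) (q : MvPolynomial (Fin N) ℝ) (x : Space N) :
    ev (c • q) x = c * ev q x := by simp [ev]

@[simp] lemma ev_zero (x : Space N) : ev 0 x = 0 := by simp [ev]

/-- The bridge from the formal `pderiv`, in which the discrete forms are written, to the analytic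
derivative of the divergence theorem. -/
lemma hasFDerivAt_ev (q : MvPolynomial (Fin N) ℝ) (x : Space N) :
    HasFDerivAt (ev q)
      (∑ j, ev (MvPolynomial.pderiv j q) x • (EuclideanSpace.proj j : Space N →L[ℝ] ℝ)) x := by
  induction q using MvPolynomial.induction_on with
  | C a =>
    have : ev (MvPolynomial.C a) = fun _ : Space N => a := by ext; simp [ev]
    rw [this]
    simpa using hasFDerivAt_const a x
  | add q r hq hr =>
    have : ev (q + r) = fun x : Space N => ev q x + ev r x := by ext; simp
    rw [this]
    refine (hq.add hr).congr_fderiv ?_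
    simp [add_smul, Finset.sum_add_distrib]
  | mul_X q i hq =>
    have : ev (q * MvPolynomial.X i) = fun x : Space N => ev q x * x i := by ext; simp [ev]
    rw [this]
    have hX : HasFDerivAt (fun x : Space N => x i) (EuclideanSpace.proj i : Space N →L[ℝ] ℝ) x :=
      (EuclideanSpace.proj i : Space N →L[ℝ] ℝ).hasFDerivAt
    refine (hq.mul hX).congr_fderiv ?_
    have : ∀ j, ev (MvPolynomial.pderiv j (q * MvPolynomial.X i)) x =
        ev q x * (if j = i then 1 else 0) + x i * ev (MvPolynomial.pderiv j q) x := by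
      intro j
      rw [Derivation.leibniz, MvPolynomial.pderiv_X]
      by_cases h : j = i
      · subst h; simp [ev]
      · simp [ev, Pi.single_apply, h, Ne.symm h]
    simp_rw [this, add_smul, Finset.sum_add_distrib, Finset.smul_sum, mul_smul]
    congr 1
    rw [Finset.sum_eq_single i]
    · simp
    · intro j _ hj; simp [hj]
    · simp

lemma continuous_ev (q : MvPolynomial (Fin N) ℝ) : Continuous (ev q) :=
  continuous_iff_continuousAt.2 fun x => (hasFDerivAt_ev q x).continuousAt

lemma fderiv_ev_single (q : MvPolynomial (Fin N) ℝ) (x : Space N) (j : Fin N) :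
    fderiv ℝ (ev q) x (EuclideanSpace.single j 1) = ev (MvPolynomial.pderiv j q) x := by
  rw [(hasFDerivAt_ev q x).fderiv]
  simp [Pi.single_apply]

lemma contDiff_ev (q : MvPolynomial (Fin N) ℝ) : ContDiff ℝ 1 (ev q) := by
  rw [contDiff_one_iff_fderiv]
  refine ⟨fun x => (hasFDerivAt_ev q x).differentiableAt, ?_⟩
  have : fderiv ℝ (ev q) = fun x => ∑ j, ev (MvPolynomial.pderiv j q) x •
      (EuclideanSpace.proj j : Space N →L[ℝ] ℝ) := by
    ext1 x; exact (hasFDerivAt_ev q x).fderiv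
  rw [this]
  exact continuous_finsetSum _ fun j _ => (continuous_ev _).smul continuous_const

/-- An open set contains a product of intervals, and a polynomial that vanishes on a product of
infinite sets is zero. This is what makes the `L²` form definite. -/
lemma eq_zero_of_ev_eq_zero {q : MvPolynomial (Fin N) ℝ} {U : Set (Space N)} (hU : IsOpen U)
    (hne : U.Nonempty) (h : ∀ x ∈ U, ev q x = 0) : q = 0 := by
  obtain ⟨x, hx⟩ := hne
  have hV : IsOpen ((WithLp.toLp 2 : (Fin N → ℝ) → Space N) ⁻¹' U) :=
    hU.preimage (PiLp.continuous_toLp 2 _)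
  obtain ⟨ε, hε, hball⟩ := Metric.isOpen_iff.1 hV (WithLp.ofLp x) hx
  refine MvPolynomial.funext_set (fun i => Metric.ball (WithLp.ofLp x i) ε) (fun i => ?_) ?_
  · rw [Real.ball_eq_Ioo]
    exact Ioo_infinite (by linarith)
  · intro y hy
    rw [ball_pi _ hε] at hball
    have := h _ (hball hy)
    simpa [ev] using this

lemma ev_sq_integral_pos {q : MvPolynomial (Fin N) ℝ} (hq : q ≠ 0) {s : Set (Space N)}
    (hs : IsCompact s) (hi : (interior s).Nonempty) : 0 < ∫ x in s, ev q x * ev q x := by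
  have hint : IntegrableOn (fun x => ev q x * ev q x) s :=
    ((continuous_ev q).mul (continuous_ev q)).continuousOn.integrableOn_compact hs
  refine lt_of_le_of_ne (integral_nonneg fun x => mul_self_nonneg _) fun h0 => hq ?_
  have h1 : IntegrableOn (fun x => ev q x * ev q x) (interior s) := hint.mono_set interior_subset
  have h2 : ∫ x in interior s, ev q x * ev q x = 0 := by
    refine le_antisymm ?_ (integral_nonneg fun x => mul_self_nonneg _)
    rw [h0]
    exact setIntegral_mono_set hint (ae_of_all _ fun x => mul_self_nonneg _)
      (LE.le.eventuallyLE interior_subset)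
  rw [setIntegral_eq_zero_iff_of_nonneg_ae (ae_of_all _ fun x => mul_self_nonneg _) h1] at h2
  refine eq_zero_of_ev_eq_zero isOpen_interior hi fun x hx => ?_
  have h3 := Measure.eqOn_open_of_ae_eq h2 isOpen_interior
    ((continuous_ev q).mul (continuous_ev q)).continuousOn continuousOn_const hx
  simpa using h3

/-- The polynomial `q` precomposed with `y ↦ x + ρ y`. -/
def affComp (x : Space N) (ρ : ℝ) (q : MvPolynomial (Fin N) ℝ) : MvPolynomial (Fin N) ℝ :=
  MvPolynomial.aeval (fun i => MvPolynomial.C (x i) + MvPolynomial.C ρ * MvPolynomial.X i) q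

lemma ev_affComp (x y : Space N) (ρ : ℝ) (q : MvPolynomial (Fin N) ℝ) :
    ev (affComp x ρ q) y = ev q (x + ρ • y) := by
  induction q using MvPolynomial.induction_on with
  | C a => simp [ev, affComp]
  | add q r hq hr =>
    have : affComp x ρ (q + r) = affComp x ρ q + affComp x ρ r := by simp [affComp]
    rw [this, ev_add, ev_add, hq, hr]
  | mul_X q i hq =>
    have : affComp x ρ (q * MvPolynomial.X i) = affComp x ρ q *
        (MvPolynomial.C (x i) + MvPolynomial.C ρ * MvPolynomial.X i) := by simp [affComp]
    rw [this]
    simp only [ev] at hq ⊢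
    simp [hq]

/-- Keeps rescaled polynomials in the finite-dimensional space for which the reference constant
holds. -/
lemma totalDegree_affComp (x : Space N) (ρ : ℝ) (q : MvPolynomial (Fin N) ℝ) :
    (affComp x ρ q).totalDegree ≤ q.totalDegree := by
  rw [affComp, MvPolynomial.aeval_def, MvPolynomial.eval₂_eq']
  refine MvPolynomial.totalDegree_finsetSum_le fun d hd => ?_
  refine (MvPolynomial.totalDegree_mul _ _).trans ?_
  rw [MvPolynomial.algebraMap_eq, MvPolynomial.totalDegree_C, zero_add]
  refine (MvPolynomial.totalDegree_finsetProd _ _).trans ?_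
  have h1 : ∀ i, ((MvPolynomial.C (x i) + MvPolynomial.C ρ * MvPolynomial.X i :
      MvPolynomial (Fin N) ℝ) ^ d i).totalDegree ≤ d i := by
    intro i
    refine (MvPolynomial.totalDegree_pow _ _).trans ?_
    have : (MvPolynomial.C (x i) + MvPolynomial.C ρ * MvPolynomial.X i :
        MvPolynomial (Fin N) ℝ).totalDegree ≤ 1 := by
      refine (MvPolynomial.totalDegree_add _ _).trans (max_le (by simp) ?_)
      refine (MvPolynomial.totalDegree_mul _ _).trans ?_
      simp
    nlinarith
  refine (Finset.sum_le_sum fun i _ => h1 i).trans ?_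
  have := MvPolynomial.le_totalDegree hd
  rwa [Finsupp.sum_fintype _ _ (fun _ => rfl)] at this

lemma ev_pderiv_affComp (x y : Space N) (ρ : ℝ) (q : MvPolynomial (Fin N) ℝ) (j : Fin N) :
    ev (MvPolynomial.pderiv j (affComp x ρ q)) y =
      ρ * ev (MvPolynomial.pderiv j q) (x + ρ • y) := by
  rw [← fderiv_ev_single, ← fderiv_ev_single]
  have h1 : ev (affComp x ρ q) = fun y => ev q (x + ρ • y) := by ext; exact ev_affComp _ _ _ _
  have h2 : HasFDerivAt (fun y : Space N => x + ρ • y) (ρ • ContinuousLinearMap.id ℝ (Space N)) y :=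
    ((hasFDerivAt_id y).const_smul ρ).const_add x
  have h3 := ((hasFDerivAt_ev q (x + ρ • y)).differentiableAt.hasFDerivAt).comp y h2
  have h4 : fderiv ℝ (fun y => ev q (x + ρ • y)) y = _ := h3.fderiv
  rw [h1, h4]
  simp

/-- The bilinear form `∫_s q r`. -/
def polyForm (s : Set (Space N)) (hs : IsCompact s) :
    MvPolynomial (Fin N) ℝ →ₗ[ℝ] MvPolynomial (Fin N) ℝ →ₗ[ℝ] ℝ :=
  LinearMap.mk₂ ℝ (fun q r => ∫ x in s, ev q x * ev r x)
    (fun q q' r => by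
      simp only [ev_add, add_mul]
      exact integral_add (((continuous_ev q).mul (continuous_ev r)).continuousOn.integrableOn_compact
        hs) (((continuous_ev q').mul (continuous_ev r)).continuousOn.integrableOn_compact hs))
    (fun c q r => by simp only [ev_smul, mul_assoc, integral_const_mul, smul_eq_mul])
    (fun q r r' => by
      simp only [ev_add, mul_add]
      exact integral_add (((continuous_ev q).mul (continuous_ev r)).continuousOn.integrableOn_compact
        hs) (((continuous_ev q).mul (continuous_ev r')).continuousOn.integrableOn_compact hs))
    (fun c q r => by simp only [ev_smul, mul_left_comm _ c, integral_const_mul, smul_eq_mul])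

/-- The inverse inequality for polynomials, from a ball to a larger concentric ball. -/
lemma exists_inverse_ball (N p : ℕ) (γ : ℝ) : ∃ C : ℝ, 0 ≤ C ∧
    ∀ (q : MvPolynomial (Fin N) ℝ), q.totalDegree ≤ p → ∀ (x : Space N) (ρ : ℝ), 0 < ρ →
      ∀ j, ρ ^ 2 * ∫ y in Metric.closedBall x (ρ * γ), ev (MvPolynomial.pderiv j q) y ^ 2 ≤
        C * ∫ y in Metric.closedBall x ρ, ev q y ^ 2 := by
  -- The reference configuration: `∫ q²` over the unit ball is definite on polynomials of degree at
  -- most `p`, so it dominates every other quadratic form there.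
  have hj : ∀ j : Fin N, ∃ C : ℝ, 0 ≤ C ∧ ∀ q : MvPolynomial.restrictTotalDegree (Fin N) ℝ p,
      ∫ y in Metric.closedBall 0 γ, ev (MvPolynomial.pderiv j (q : MvPolynomial (Fin N) ℝ)) y ^ 2
        ≤ C * ∫ y in Metric.closedBall 0 1, ev (q : MvPolynomial (Fin N) ℝ) y ^ 2 := by
    intro j
    let i := (MvPolynomial.restrictTotalDegree (Fin N) ℝ p).subtype
    let D := (MvPolynomial.pderiv (R := ℝ) j).toLinearMap ∘ₗ i
    obtain ⟨C, hC, h⟩ := exists_le_mul_of_posDef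
      ((polyForm (Metric.closedBall (0 : Space N) 1) (isCompact_closedBall _ _)).compl₁₂ i i)
      ((polyForm (Metric.closedBall (0 : Space N) γ) (isCompact_closedBall _ _)).compl₁₂ D D)
      (fun q hq => by
        refine ev_sq_integral_pos (fun h0 => hq (Subtype.ext h0)) (isCompact_closedBall _ _) ?_
        exact ⟨0, Metric.ball_subset_interior_closedBall (Metric.mem_ball_self one_pos)⟩)
    refine ⟨C, hC, fun q => ?_⟩
    have := h q
    simp only [LinearMap.compl₁₂_apply, polyForm, LinearMap.mk₂_apply, ← sq] at this
    exact this
  choose C hC0 hC using hj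
  refine ⟨∑ j, C j, Finset.sum_nonneg fun j _ => hC0 j, fun q hq x ρ hρ j => ?_⟩
  have hscale : ∀ (F : Space N → ℝ) (R : ℝ), ∫ y in Metric.closedBall x (ρ * R), F y =
      ρ ^ N * ∫ y in Metric.closedBall (0 : Space N) R, F (x + ρ • y) := by
    intro F R
    rw [← integral_indicator Metric.isClosed_closedBall.measurableSet,
      ← integral_indicator Metric.isClosed_closedBall.measurableSet,
      ← integral_add_left_eq_self _ x]
    have h1 := Measure.integral_comp_smul (volume : Measure (Space N))
      (fun y => (Metric.closedBall x (ρ * R)).indicator F (x + y)) ρ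
    rw [finrank_euclideanSpace_fin, abs_of_pos (by positivity), smul_eq_mul] at h1
    have h2 : ∀ y : Space N, (Metric.closedBall x (ρ * R)).indicator F (x + ρ • y) =
        (Metric.closedBall (0 : Space N) R).indicator (fun y => F (x + ρ • y)) y := by
      intro y
      simp only [indicator, Metric.mem_closedBall, dist_eq_norm, add_sub_cancel_left, sub_zero,
        norm_smul, Real.norm_of_nonneg hρ.le, mul_le_mul_iff_right₀ hρ]
    simp_rw [h2] at h1
    rw [h1]
    field_simp
  -- Applied to `y ↦ q (x + ρ y)`, whose derivative carries the factor `ρ`; this is the source of `ρ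
  -- ^ 2`.
  have h1 := hC j ⟨affComp x ρ q, (MvPolynomial.mem_restrictTotalDegree _ _ _).2
    ((totalDegree_affComp x ρ q).trans hq)⟩
  simp only [ev_affComp, ev_pderiv_affComp, mul_pow, integral_const_mul] at h1
  have h2 : C j ≤ ∑ j, C j := Finset.single_le_sum (fun i _ => hC0 i) (Finset.mem_univ j)
  have hs1 := hscale (fun y => ev q y ^ 2) 1
  rw [mul_one] at hs1
  rw [hscale, hs1]
  have h3 : 0 ≤ ∫ y in Metric.closedBall (0 : Space N) 1, ev q (x + ρ • y) ^ 2 :=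
    integral_nonneg fun _ => sq_nonneg _
  calc _ = ρ ^ N * (ρ ^ 2 * ∫ y in Metric.closedBall 0 γ,
        ev (MvPolynomial.pderiv j q) (x + ρ • y) ^ 2) := by ring
    _ ≤ ρ ^ N * (C j * ∫ y in Metric.closedBall (0 : Space N) 1, ev q (x + ρ • y) ^ 2) := by gcongr
    _ ≤ ρ ^ N * ((∑ j, C j) * ∫ y in Metric.closedBall (0 : Space N) 1, ev q (x + ρ • y) ^ 2) := by
        gcongr
    _ = _ := by ring

end Polynomial

/-! ### Inverse and trace inequalities on shape regular simplices -/

namespace IsSimplex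

variable {N : ℕ} {K : Finset (Space N)} (h : IsSimplex K)
include h

lemma diam_pos (hN : 0 < N) : 0 < Metric.diam (hull K) := by
  refine Metric.diam_pos ?_ (isCompact_hull K).isBounded
  obtain ⟨a, ha⟩ := h.nonempty
  obtain ⟨b, hb⟩ := h.exists_ne hN a
  exact ⟨a, subset_convexHull ℝ _ ha, b, subset_convexHull ℝ _ b.2, hb.symm⟩

omit h in
lemma vertex_mem_hull {a : Space N} (ha : a ∈ K) : a ∈ hull K := subset_convexHull ℝ _ ha

lemma integrable_facetMeasure (hN : 0 < N) (a : K) {f : Space N → ℝ} (hf : Continuous f) :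
    Integrable f (facetMeasure K a) := by
  have hfin := h.isFiniteMeasure_facetMeasure hN a
  obtain ⟨C, hC⟩ := (isCompact_hull (facet K (a : Space N))).exists_bound_of_continuousOn
    hf.continuousOn
  refine Integrable.of_bound hf.aestronglyMeasurable C ?_
  filter_upwards [ae_mem_facetMeasure K a] with x hx
  exact hC x hx

/-- The integral over a facet times the height of the simplex is an integral over the simplex. -/
lemma facetIntegral_eq (hN : 0 < N) (a : K) {f : Space N → ℝ} (hf : ContDiff ℝ 1 f) :
    ‖h.grad a‖⁻¹ * facetIntegral K a f = ∑ j, ∫ x in hull K,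
      (f x + (x j - (a : Space N) j) * fderiv ℝ f x (EuclideanSpace.single j 1)) := by
  -- The divergence theorem is applied to the field `(x - a) f`. Its normal component vanishes on
  -- the facets through `a` and equals the height `‖grad a‖⁻¹` times `f` on the facet opposite to
  -- `a`.
  have hX : ∀ j : Fin N, ContDiff ℝ 1 (fun x : Space N => (x j - (a : Space N) j) * f x) := by
    intro j
    refine ContDiff.mul (ContDiff.sub ?_ contDiff_const) hf
    exact (EuclideanSpace.proj j : Space N →L[ℝ] ℝ).contDiff
  have hd : ∀ (j : Fin N) (x : Space N),
      fderiv ℝ (fun x : Space N => (x j - (a : Space N) j) * f x) x (EuclideanSpace.single j 1) =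
      f x + (x j - (a : Space N) j) * fderiv ℝ f x (EuclideanSpace.single j 1) := by
    intro j x
    have h1 : HasFDerivAt (fun x : Space N => x j - (a : Space N) j)
        (EuclideanSpace.proj j : Space N →L[ℝ] ℝ) x :=
      ((EuclideanSpace.proj j : Space N →L[ℝ] ℝ).hasFDerivAt).sub_const _
    have h2 := h1.mul ((hf.differentiable (by norm_num) x).hasFDerivAt)
    have h3 : fderiv ℝ (fun x : Space N => (x j - (a : Space N) j) * f x) x = _ := h2.fderiv
    rw [h3]
    simp
    ring
  have hdiv := fun j => h.integral_fderiv hN (hX j) (EuclideanSpace.single j 1)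
  simp_rw [hd] at hdiv
  simp_rw [hdiv]
  rw [Finset.sum_comm, ← Finset.sum_coe_sort K]
  have hb : ∀ b : K, ∑ j, ⟪normal K b, EuclideanSpace.single j 1⟫ *
      facetIntegral K b (fun x => (x j - (a : Space N) j) * f x) =
      ∫ x, ⟪normal K b, x - (a : Space N)⟫ * f x ∂(facetMeasure K b) := by
    intro b
    change ∑ j, _ * ∫ x, (x j - (a : Space N) j) * f x ∂(facetMeasure K b) = _
    simp_rw [← integral_const_mul]
    rw [← integral_finsetSum _ fun j _ => (h.integrable_facetMeasure hN b
      (hX j).continuous).const_mul _]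
    refine integral_congr_ae (ae_of_all _ fun x => ?_)
    simp only [PiLp.inner_apply, EuclideanSpace.inner_single_right, PiLp.sub_apply, Finset.sum_mul]
    refine Finset.sum_congr rfl fun j _ => ?_
    simp
    ring
  simp_rw [hb]
  rw [Finset.sum_eq_single a]
  · change _ * ∫ x, f x ∂(facetMeasure K a) = _
    rw [← integral_const_mul]
    refine integral_congr_ae ?_
    filter_upwards [ae_mem_facetMeasure K a] with x hx
    have h1 := (h.mem_hull_facet.1 hx).2
    have h2 := h.coord_self a
    have hg : ‖h.grad a‖ ≠ 0 := by simpa using h.grad_ne_zero hN a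
    rw [coord_eq] at h1 h2
    rw [h.normal_eq hN, inner_neg_left, inner_smul_left, inner_sub_right]
    have : ⟪h.grad a, x⟫ - ⟪h.grad a, (a : Space N)⟫ = -1 := by linarith
    rw [this]
    simp
  · intro b _ hba
    rw [← integral_zero (α := Space N) (G := ℝ) (μ := facetMeasure K b)]
    refine integral_congr_ae ?_
    filter_upwards [ae_mem_facetMeasure K b] with x hx
    have h1 := (h.mem_hull_facet.1 hx).2
    have h2 := h.coord_ne hba
    rw [coord_eq] at h1 h2
    rw [h.normal_eq hN, inner_neg_left, inner_smul_left, inner_sub_right]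
    have : ⟪h.grad b, x⟫ - ⟪h.grad b, (a : Space N)⟫ = 0 := by linarith
    rw [this]
    simp
  · simp

end IsSimplex

lemma integrableOn_hull {N : ℕ} {K : Finset (Space N)} {f : Space N → ℝ} (hf : Continuous f) :
    IntegrableOn f (hull K) := hf.continuousOn.integrableOn_compact (isCompact_hull K)

/-- The inverse inequality on shape regular simplices. -/
lemma exists_inverse_simplex (N p : ℕ) {γ : ℝ} (hN : 0 < N) (hγ : 0 < γ) : ∃ C : ℝ, 0 ≤ C ∧
    ∀ K : Finset (Space N), IsSimplex K →
      (∃ x, Metric.closedBall x (Metric.diam (hull K) / γ) ⊆ hull K) →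
      ∀ q : MvPolynomial (Fin N) ℝ, q.totalDegree ≤ p → ∀ j,
        Metric.diam (hull K) ^ 2 * ∫ x in hull K, ev (MvPolynomial.pderiv j q) x ^ 2 ≤
          C * ∫ x in hull K, ev q x ^ 2 := by
  obtain ⟨C, hC, hinv⟩ := exists_inverse_ball N p γ
  -- `K` lies between the inscribed ball of radius `diam K / γ` and the concentric ball of radius
  -- `diam K`; `γ ^ 2` converts the square of the smaller radius into that of the larger.
  refine ⟨γ ^ 2 * C, by positivity, fun K hK ⟨x, hx⟩ q hq j => ?_⟩
  set d := Metric.diam (hull K) with hd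
  have hd0 : 0 < d := hK.diam_pos hN
  have hxK : x ∈ hull K := hx (Metric.mem_closedBall_self (by positivity))
  have h1 := hinv q hq x (d / γ) (by positivity) j
  rw [div_mul_cancel₀ _ hγ.ne'] at h1
  have hsub : hull K ⊆ Metric.closedBall x d := fun y hy =>
    Metric.dist_le_diam_of_mem (isCompact_hull K).isBounded hy hxK
  have h2 : ∫ y in hull K, ev (MvPolynomial.pderiv j q) y ^ 2 ≤
      ∫ y in Metric.closedBall x d, ev (MvPolynomial.pderiv j q) y ^ 2 :=
    setIntegral_mono_set (((continuous_ev _).pow 2).continuousOn.integrableOn_compact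
      (isCompact_closedBall _ _)) (ae_of_all _ fun _ => sq_nonneg _) (LE.le.eventuallyLE hsub)
  have h3 : ∫ y in Metric.closedBall x (d / γ), ev q y ^ 2 ≤ ∫ y in hull K, ev q y ^ 2 :=
    setIntegral_mono_set (integrableOn_hull ((continuous_ev _).pow 2))
      (ae_of_all _ fun _ => sq_nonneg _) (LE.le.eventuallyLE hx)
  calc _ = γ ^ 2 * ((d / γ) ^ 2 * ∫ y in hull K, ev (MvPolynomial.pderiv j q) y ^ 2) := by
        field_simp
    _ ≤ γ ^ 2 * ((d / γ) ^ 2 * ∫ y in Metric.closedBall x d,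
        ev (MvPolynomial.pderiv j q) y ^ 2) := by gcongr
    _ ≤ γ ^ 2 * (C * ∫ y in Metric.closedBall x (d / γ), ev q y ^ 2) := by gcongr
    _ ≤ γ ^ 2 * (C * ∫ y in hull K, ev q y ^ 2) := by gcongr
    _ = _ := by ring

/-- The discrete trace inequality on shape regular simplices. -/
lemma exists_trace_simplex (N p : ℕ) {γ : ℝ} (hN : 0 < N) (hγ : 0 < γ) : ∃ C : ℝ, 0 ≤ C ∧
    ∀ K : Finset (Space N), IsSimplex K →
      (∃ x, Metric.closedBall x (Metric.diam (hull K) / γ) ⊆ hull K) →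
      ∀ q : MvPolynomial (Fin N) ℝ, q.totalDegree ≤ p → ∀ a ∈ K,
        Metric.diam (hull K) * facetIntegral K a (fun x => ev q x ^ 2) ≤
          C * ∫ x in hull K, ev q x ^ 2 := by
  obtain ⟨C, hC, hinv⟩ := exists_inverse_simplex N p hN hγ
  -- The height is at least `2 diam K / γ`, which gives `γ`. Each of the `N` directions contributes
  -- at most `2 ∫ q² + (diam K)² ∫ (∂_j q)²`, by Young's inequality, and the inverse inequality
  -- bounds this by `(2 + C) ∫ q²`.
  refine ⟨γ * (N * (2 + C)), by positivity, fun K hK hreg q hq a ha => ?_⟩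
  have hinvK := hinv K hK hreg q hq
  obtain ⟨x, hx⟩ := hreg
  set d := Metric.diam (hull K) with hd
  have hd0 : 0 < d := hK.diam_pos hN
  set I := ∫ x in hull K, ev q x ^ 2 with hI
  have hI0 : 0 ≤ I := integral_nonneg fun _ => sq_nonneg _
  have hF0 : 0 ≤ facetIntegral K a (fun x => ev q x ^ 2) := integral_nonneg fun _ => sq_nonneg _
  have hheight := hK.norm_grad_le hN ⟨a, ha⟩ (by positivity) hx
  have heq := hK.facetIntegral_eq hN ⟨a, ha⟩ ((contDiff_ev q).pow 2)
  have hder : ∀ (j : Fin N) (x : Space N), fderiv ℝ (fun x => ev q x ^ 2) x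
      (EuclideanSpace.single j 1) = 2 * ev q x * ev (MvPolynomial.pderiv j q) x := by
    intro j x
    have h1 := (hasFDerivAt_ev q x).differentiableAt
    rw [fderiv_fun_pow (𝔸 := ℝ) _ h1]
    simp [← fderiv_ev_single]
  have hle : ∀ j : Fin N, ∫ x in hull K, (ev q x ^ 2 + (x j - a j) *
      fderiv ℝ (fun x => ev q x ^ 2) x (EuclideanSpace.single j 1)) ≤ (2 + C) * I := by
    intro j
    simp_rw [hder]
    have hc1 : Continuous fun x : Space N => ev q x ^ 2 + (x j - a j) *
        (2 * ev q x * ev (MvPolynomial.pderiv j q) x) := by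
      have := continuous_ev q
      have := continuous_ev (MvPolynomial.pderiv j q)
      fun_prop
    have hi1 : IntegrableOn (fun x => 2 * ev q x ^ 2) (hull K) :=
      integrableOn_hull (continuous_const.mul ((continuous_ev q).pow 2))
    have hi2 : IntegrableOn (fun x => d ^ 2 * ev (MvPolynomial.pderiv j q) x ^ 2) (hull K) :=
      integrableOn_hull (continuous_const.mul ((continuous_ev _).pow 2))
    calc _ ≤ ∫ x in hull K, (2 * ev q x ^ 2 + d ^ 2 * ev (MvPolynomial.pderiv j q) x ^ 2) := by
          refine setIntegral_mono_on (integrableOn_hull hc1) (hi1.add hi2)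
            (isCompact_hull K).isClosed.measurableSet fun x hx => ?_
          have h1 : |x j - a j| ≤ d := by
            have h2 := Metric.dist_le_diam_of_mem (isCompact_hull K).isBounded hx
              (IsSimplex.vertex_mem_hull ha)
            rw [dist_eq_norm] at h2
            exact (PiLp.norm_apply_le (x - a) j).trans h2
          have h3 : ((x j - a j) * ev (MvPolynomial.pderiv j q) x) ^ 2 ≤
              d ^ 2 * ev (MvPolynomial.pderiv j q) x ^ 2 := by
            rw [mul_pow]
            exact mul_le_mul_of_nonneg_right (sq_le_sq' (abs_le.1 h1).1 (abs_le.1 h1).2)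
              (sq_nonneg _)
          nlinarith [sq_nonneg (ev q x - (x j - a j) * ev (MvPolynomial.pderiv j q) x)]
      _ = 2 * I + d ^ 2 * ∫ x in hull K, ev (MvPolynomial.pderiv j q) x ^ 2 := by
          rw [integral_add hi1 hi2, integral_const_mul, integral_const_mul]
      _ ≤ 2 * I + C * I := by linarith [hinvK j]
      _ = _ := by ring
  have hsum := Finset.sum_le_sum fun (j : Fin N) (_ : j ∈ Finset.univ) => hle j
  simp only [Finset.sum_const, Finset.card_univ, Fintype.card_fin, nsmul_eq_mul] at hsum
  rw [← heq] at hsum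
  have h5 : 2 * (d / γ) * facetIntegral K a (fun x => ev q x ^ 2) ≤ N * ((2 + C) * I) :=
    (mul_le_mul_of_nonneg_right hheight hF0).trans hsum
  calc _ ≤ γ * (2 * (d / γ) * facetIntegral K a (fun x => ev q x ^ 2)) := by
        have : γ * (2 * (d / γ) * facetIntegral K a (fun x => ev q x ^ 2)) =
          2 * (d * facetIntegral K a (fun x => ev q x ^ 2)) := by field_simp
        rw [this]
        linarith [mul_nonneg hd0.le hF0]
    _ ≤ γ * (N * ((2 + C) * I)) := by gcongr
    _ = _ := by ring

/-! ### Neighbouring elements of a conforming mesh -/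

lemma facetIntegral_congr {N : ℕ} {K K' : Finset (Space N)} {a a' : Space N}
    (h : facet K' a' = facet K a) (f : Space N → ℝ) : facetIntegral K' a' f = facetIntegral K a f := by
  rw [facetIntegral, facetIntegral, h]

lemma IsSimplex.exists_facet_eq {N : ℕ} {K' F : Finset (Space N)} (h' : IsSimplex K')
    (hF : F.card = N) (hsub : F ⊆ K') : ∃ a' ∈ K', facet K' a' = F := by
  classical
  obtain ⟨a', ha', haF⟩ := Finset.exists_mem_notMem_of_card_lt_card (s := F) (t := K')
    (by rw [hF, h'.card]; omega)
  refine ⟨a', ha', (Finset.eq_of_subset_of_card_le (fun x hx => ?_) ?_).symm⟩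
  · rw [facet, Finset.mem_erase]
    exact ⟨fun e => haF (e ▸ hx), hsub hx⟩
  · rw [h'.card_facet ⟨a', ha'⟩, hF]

section Neighbours

variable {N : ℕ} {K K' : Finset (Space N)} (h : IsSimplex K) (h' : IsSimplex K')
  (a : K) (a' : K') (hF : facet K' (a' : Space N) = facet K (a : Space N)) (hN : 0 < N)
include h h' hF hN

/-- Both coordinates are affine, vanish at the barycenter of the common facet and have gradients
normal to it, so they are proportional; the factor is read off at `a'`. -/
lemma coord_eq_mul_coord (x : Space N) :
    h.basis.coord a x = h.basis.coord a (a' : Space N) * h'.basis.coord a' x := by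
  have h1 := h.vectorSpan_facet hN a
  rw [← hF, h'.vectorSpan_facet hN a'] at h1
  obtain ⟨s, hs⟩ := Submodule.mem_span_singleton.1 (h1.symm ▸ Submodule.mem_span_singleton_self
    (h.grad a) : h.grad a ∈ ℝ ∙ h'.grad a')
  have h2 := h.coord_barycenter_facet hN a a
  have h3 := h'.coord_barycenter_facet hN a' a'
  rw [if_pos rfl, IsSimplex.coord_eq] at h2 h3
  rw [hF] at h3
  have key : ∀ y, h.basis.coord a y = s * h'.basis.coord a' y := by
    intro y
    rw [IsSimplex.coord_eq, IsSimplex.coord_eq, ← hs, inner_smul_left]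
    rw [← hs, inner_smul_left] at h2
    simp only [conj_trivial] at h2 ⊢
    linear_combination h2 - s * h3
  rw [key, key, h'.coord_self, mul_one]

/-- The opposite vertices lie on different sides of a common facet: otherwise a short step from the
barycenter of the facet towards `a'` would stay in both simplices and leave the facet. -/
lemma coord_neg (hne : K ≠ K') (hint : hull K ∩ hull K' ⊆ hull (facet K (a : Space N))) :
    h.basis.coord a (a' : Space N) < 0 := by
  by_contra hge
  rw [not_lt] at hge
  set z := barycenter (facet K (a : Space N)) with hz
  have hlim : ∀ b : K, Tendsto (fun t : ℝ => h.basis.coord b (z + t • ((a' : Space N) - z)))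
      (𝓝[>] 0) (𝓝 (h.basis.coord b z)) := by
    intro b
    have hc : Continuous (fun t : ℝ => h.basis.coord b (z + t • ((a' : Space N) - z))) := by
      simp only [IsSimplex.coord_eq]
      fun_prop
    have := (hc.tendsto 0).mono_left (nhdsWithin_le_nhds (s := Ioi 0))
    simpa using this
  have hpos : ∀ᶠ t : ℝ in 𝓝[>] 0, ∀ b : K, b ≠ a →
      0 < h.basis.coord b (z + t • ((a' : Space N) - z)) := by
    rw [eventually_all]
    intro b
    by_cases hb : b = a
    · simp [hb]
    · have h1 := hlim b
      rw [hz, h.coord_barycenter_facet hN, if_neg hb, ← hz] at h1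
      filter_upwards [h1.eventually_const_lt (by positivity)] with t ht _
      exact ht
  have h1 : ∀ᶠ t : ℝ in 𝓝[>] 0, t < 1 :=
    (tendsto_id.mono_right nhdsWithin_le_nhds).eventually_lt_const one_pos
  obtain ⟨t, ht, ht1, ht0⟩ := (hpos.and (h1.and self_mem_nhdsWithin)).exists
  have ht0' : 0 < t := ht0
  have hconv : ∀ (J : Finset (Space N)) (hJ : IsSimplex J) (b : J),
      hJ.basis.coord b (z + t • ((a' : Space N) - z)) =
        (1 - t) * hJ.basis.coord b z + t * hJ.basis.coord b (a' : Space N) := by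
    intro J hJ b
    simp only [IsSimplex.coord_eq, inner_add_right, inner_smul_right, inner_sub_right]
    ring
  have hmK : z + t • ((a' : Space N) - z) ∈ hull K := by
    rw [h.mem_hull]
    intro b
    by_cases hb : b = a
    · rw [hb, hconv, hz, h.coord_barycenter_facet hN, if_pos rfl]
      nlinarith
    · exact (ht b hb).le
  have hz' : z = barycenter (facet K' (a' : Space N)) := by rw [hF]
  have hmK' : z + t • ((a' : Space N) - z) ∈ hull K' := by
    rw [h'.mem_hull]
    intro b
    rw [hconv, hz', h'.coord_barycenter_facet hN]
    have hb0 : 0 ≤ h'.basis.coord b (a' : Space N) :=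
      h'.mem_hull.1 (IsSimplex.vertex_mem_hull a'.2) b
    have : (0 : ℝ) ≤ if b = a' then 0 else (N : ℝ)⁻¹ := by split_ifs <;> positivity
    have h2 : 0 ≤ 1 - t := by linarith
    positivity
  have hmF := hint ⟨hmK, hmK'⟩
  rw [← hF] at hmF
  have h3 := (h'.mem_hull_facet.1 hmF).2
  rw [hconv, hz', h'.coord_barycenter_facet hN, if_pos rfl, h'.coord_self] at h3
  linarith

end Neighbours

section MeshGeometry

variable {N L : ℕ} {𝒯 : Mesh N} {Ω : Set (Space N)} {γ : ℝ}

lemma Mesh.mem_elements {K : Finset (Space N)} :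
    K ∈ 𝒯.elements ↔ K ∈ 𝒯.complex.faces ∧ K.card = N + 1 := by
  simp [Mesh.elements]

lemma Mesh.isSimplex {K : Finset (Space N)} (hK : K ∈ 𝒯.elements) : IsSimplex K :=
  ⟨𝒯.complex.indep (Mesh.mem_elements.1 hK).1, (Mesh.mem_elements.1 hK).2⟩

lemma Mesh.hull_inter_subset {K K' : Finset (Space N)} (hK : K ∈ 𝒯.elements)
    (hK' : K' ∈ 𝒯.elements) (hne : K ≠ K') {a : Space N} (ha : a ∈ K) (hsub : facet K a ⊆ K') :
    hull K ∩ hull K' ⊆ hull (facet K a) := by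
  classical
  refine (𝒯.complex.inter_subset_convexHull (Mesh.mem_elements.1 hK).1
    (Mesh.mem_elements.1 hK').1).trans (convexHull_mono ?_)
  rintro x ⟨hx, hx'⟩
  rw [Finset.mem_coe, facet, Finset.mem_erase]
  refine ⟨fun hxa => hne ?_, hx⟩
  refine Finset.eq_of_subset_of_card_le (fun y hy => ?_)
    (by rw [(Mesh.isSimplex hK).card, (Mesh.isSimplex hK').card])
  by_cases hy' : y = a
  · rw [hy', ← hxa]; exact hx'
  · exact hsub (Finset.mem_erase.2 ⟨hy', hy⟩)

/-- At most two elements share a facet. -/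
lemma Mesh.eq_of_facet_subset (hN : 0 < N) {K K' K'' : Finset (Space N)} (hK : K ∈ 𝒯.elements)
    (hK' : K' ∈ 𝒯.elements) (hK'' : K'' ∈ 𝒯.elements) {a : Space N} (ha : a ∈ K)
    (hsub' : facet K a ⊆ K') (hsub'' : facet K a ⊆ K'') (hne' : K' ≠ K) (hne'' : K'' ≠ K) :
    K' = K'' := by
  by_contra hne
  have h := Mesh.isSimplex hK
  have h' := Mesh.isSimplex hK'
  have h'' := Mesh.isSimplex hK''
  obtain ⟨a', ha', hF'⟩ := h'.exists_facet_eq (h.card_facet ⟨a, ha⟩) hsub'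
  obtain ⟨a'', ha'', hF''⟩ := h''.exists_facet_eq (h.card_facet ⟨a, ha⟩) hsub''
  have h1 := coord_neg h h' ⟨a, ha⟩ ⟨a', ha'⟩ hF' hN (Ne.symm hne')
    (Mesh.hull_inter_subset hK hK' (Ne.symm hne') ha hsub')
  have h2 := coord_neg h h'' ⟨a, ha⟩ ⟨a'', ha''⟩ hF'' hN (Ne.symm hne'')
    (Mesh.hull_inter_subset hK hK'' (Ne.symm hne'') ha hsub'')
  have h3 := coord_neg h' h'' ⟨a', ha'⟩ ⟨a'', ha''⟩ (hF''.trans hF'.symm) hN hne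
    (Mesh.hull_inter_subset hK' hK'' hne ha' (by rw [hF']; exact hsub''))
  -- Three elements at one facet cannot lie pairwise on different sides: the coordinate of `a` at
  -- `a''` is negative by `h2`, and here it is a product of two negative numbers.
  have h4 := coord_eq_mul_coord h h' ⟨a, ha⟩ ⟨a', ha'⟩ hF' hN a''
  simp only at h1 h2 h3 h4
  nlinarith

/-- A facet that is not on the boundary has a neighbouring element. -/
lemma Mesh.exists_neighbour {K : Finset (Space N)} {a : Space N}
    (hb : ¬ 𝒯.IsBoundaryFacet (facet K a)) :
    ∃ K' ∈ 𝒯.elements, K' ≠ K ∧ facet K a ⊆ K' := by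
  rw [Mesh.IsBoundaryFacet] at hb
  push Not at hb
  obtain ⟨K₁, hK₁, K₂, hK₂, hs₁, hs₂, hne⟩ := hb
  by_cases h : K₁ = K
  · exact ⟨K₂, hK₂, fun e => hne (h.trans e.symm), hs₂⟩
  · exact ⟨K₁, hK₁, h, hs₁⟩

lemma hull_subset_closure (hΩ : 𝒯.IsShapeRegularMeshOf Ω γ) {K : Finset (Space N)}
    (hK : K ∈ 𝒯.elements) : hull K ⊆ closure Ω := by
  rw [← hΩ.cover]
  exact subset_biUnion_of_mem (u := fun K => hull K) hK

end MeshGeometry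

/-! ### The coefficients on elements, and the flux matrices across facets -/

section Coefficients

variable {N L : ℕ} {H : HyperbolicSystem N L} {P : DGPatch N L} {γ Cd : ℝ}

/-- Elements are only known to lie in the closure of `Ω`; the absence of cracks puts their interiors
into `Ω`, where the hypotheses on the coefficients hold. -/
lemma interior_hull_subset (hH : H.IsAdmissible) (hP : P.IsAdmissible H γ Cd)
    {K : Finset (Space N)} (hK : K ∈ P.mesh.elements) : interior (hull K) ⊆ H.Ω := by
  rw [← hH.no_crack]
  exact interior_mono (hull_subset_closure hP.mesh_Ω hK)

lemma ae_mem_interior_hull {K : Finset (Space N)} :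
    ∀ᵐ x ∂(volume.restrict (hull K)), x ∈ interior (hull K) := by
  have h1 : volume (frontier (hull K)) = 0 :=
    (convex_convexHull ℝ (K : Set (Space N))).addHaar_frontier volume
  have h2 : ∀ᵐ x : Space N, x ∉ frontier (hull K) := compl_mem_ae_iff.2 h1
  filter_upwards [ae_restrict_mem (isCompact_hull K).isClosed.measurableSet,
    ae_restrict_of_ae h2] with x hx hx2
  by_contra hxi
  exact hx2 ⟨subset_closure hx, hxi⟩

lemma A_eq (hP : P.IsAdmissible H γ Cd) {K : Finset (Space N)} (hK : K ∈ P.mesh.elements)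
    (j : Fin N) {x : Space N} (hx : x ∈ interior (hull K)) : H.A j x = H.A j (barycenter K) := by
  obtain ⟨A₀, hA⟩ := hP.const_A K hK j
  rw [hA x hx, hA _ (Mesh.isSimplex hK).barycenter_mem_interior]

lemma G_eq (hP : P.IsAdmissible H γ Cd) {K : Finset (Space N)} (hK : K ∈ P.mesh.elements)
    {x : Space N} (hx : x ∈ interior (hull K)) : H.G x = H.G (barycenter K) := by
  obtain ⟨G₀, hG⟩ := hP.const_G K hK
  rw [hG x hx, hG _ (Mesh.isSimplex hK).barycenter_mem_interior]

lemma barycenter_mem (hH : H.IsAdmissible) (hP : P.IsAdmissible H γ Cd)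
    {K : Finset (Space N)} (hK : K ∈ P.mesh.elements) : barycenter K ∈ H.Ω :=
  interior_hull_subset hH hP hK (Mesh.isSimplex hK).barycenter_mem_interior

lemma bdryMatrix_isSymm (hH : H.IsAdmissible) (hP : P.IsAdmissible H γ Cd)
    {K : Finset (Space N)} (hK : K ∈ P.mesh.elements) (a : Space N) :
    (bdryMatrix H K a).IsSymm := by
  rw [Matrix.IsSymm, bdryMatrix, Matrix.transpose_sum]
  refine Finset.sum_congr rfl fun j _ => ?_
  rw [Matrix.transpose_smul, hH.symm_A j _ (barycenter_mem hH hP hK)]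

/-- The flux matrices of the two elements at an interior facet agree up to their sign, since the
row-wise divergence of the coefficients vanishes. -/
theorem bdryMatrix_eq_neg (hN : 0 < N) (hH : H.IsAdmissible) (hP : P.IsAdmissible H γ Cd)
    {K K' : Finset (Space N)} (hK : K ∈ P.mesh.elements) (hK' : K' ∈ P.mesh.elements)
    (hne : K ≠ K') {a a' : Space N} (ha : a ∈ K) (ha' : a' ∈ K') (hF : facet K' a' = facet K a) :
    bdryMatrix H K' a' = -bdryMatrix H K a := by
  have h := Mesh.isSimplex hK
  have h' := Mesh.isSimplex hK'
  have hsub : facet K a ⊆ K' := by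
    classical
    rw [← hF]; exact Finset.erase_subset _ _
  have hint := Mesh.hull_inter_subset hK hK' hne ha hsub
  have hneg := coord_neg h h' ⟨a, ha⟩ ⟨a', ha'⟩ hF hN hne hint
  set z := barycenter (facet K a) with hz
  -- An open neighbourhood of the facet barycenter that meets no other facet of the two simplices.
  -- By the proportionality of the coordinates at the common facet it is covered by `K` and `K'`,
  -- hence contained in `Ω`.
  set U : Set (Space N) := {x | (∀ b : K, b ≠ ⟨a, ha⟩ → 0 < h.basis.coord b x) ∧
    ∀ b : K', b ≠ ⟨a', ha'⟩ → 0 < h'.basis.coord b x} with hU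
  have hcc : ∀ (J : Finset (Space N)) (hJ : IsSimplex J) (b : J),
      Continuous fun x => hJ.basis.coord b x := by
    intro J hJ b
    simp only [IsSimplex.coord_eq]
    fun_prop
  have hUopen : IsOpen U := by
    rw [hU, ofPred_and]
    refine IsOpen.inter ?_ ?_
    · have : {x | ∀ b : K, b ≠ ⟨a, ha⟩ → 0 < h.basis.coord b x} =
          ⋂ b : K, ⋂ _ : b ≠ ⟨a, ha⟩, {x | 0 < h.basis.coord b x} := by ext; simp
      rw [this]
      exact isOpen_iInter_of_finite fun b => isOpen_iInter_of_finite fun _ =>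
        isOpen_lt continuous_const (hcc _ _ _)
    · have : {x | ∀ b : K', b ≠ ⟨a', ha'⟩ → 0 < h'.basis.coord b x} =
          ⋂ b : K', ⋂ _ : b ≠ ⟨a', ha'⟩, {x | 0 < h'.basis.coord b x} := by ext; simp
      rw [this]
      exact isOpen_iInter_of_finite fun b => isOpen_iInter_of_finite fun _ =>
        isOpen_lt continuous_const (hcc _ _ _)
  have hzU : z ∈ U := by
    refine ⟨fun b hb => ?_, fun b hb => ?_⟩
    · have := h.coord_barycenter_facet hN ⟨a, ha⟩ b
      rw [if_neg hb] at this
      rw [hz, this]; positivity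
    · have := h'.coord_barycenter_facet hN ⟨a', ha'⟩ b
      rw [if_neg hb] at this
      simp only at this
      rw [hz, ← hF, this]; positivity
  have hUsub : U ⊆ hull K ∪ hull K' := by
    intro x hx
    by_cases hxa : 0 ≤ h.basis.coord ⟨a, ha⟩ x
    · left
      rw [h.mem_hull]
      intro b
      by_cases hb : b = ⟨a, ha⟩
      · rw [hb]; exact hxa
      · exact (hx.1 b hb).le
    · right
      rw [h'.mem_hull]
      intro b
      by_cases hb : b = ⟨a', ha'⟩
      · rw [hb]
        have h1 := coord_eq_mul_coord h h' ⟨a, ha⟩ ⟨a', ha'⟩ hF hN x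
        simp only at h1 hneg
        by_contra hlt
        nlinarith
      · exact (hx.2 b hb).le
  have hUΩ : U ⊆ H.Ω := by
    rw [← hH.no_crack]
    exact interior_maximal (hUsub.trans (union_subset (hull_subset_closure hP.mesh_Ω hK)
      (hull_subset_closure hP.mesh_Ω hK'))) hUopen
  -- For a bump function inside `U`, the divergence theorem on either simplex retains only the
  -- common facet, so that `∫ ∂_j ψ` is the component `n_j` times one positive number `m`.
  obtain ⟨ψ, hψU, hψc, hψs, hψr, hψz⟩ := exists_contDiff_tsupport_subset (n := (⊤ : ℕ∞))
    (hUopen.mem_nhds hzU)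
  have hψ0 : ∀ x, 0 ≤ ψ x := fun x => (hψr ⟨x, rfl⟩).1
  have hψsupp : Function.support ψ ⊆ U := (subset_tsupport ψ).trans hψU
  have hψ1 : ContDiff ℝ 1 ψ := hψs.of_le (by exact_mod_cast le_top)
  set m := facetIntegral K a ψ with hm
  have hmpos : 0 < m := by
    refine h.facetMeasure_inter_pos hN ⟨a, ha⟩ hψs.continuous hψ0 ?_ ?_
    · change 0 < ψ z
      rw [hψz]; exact one_pos
    · exact fun x hx => (hψsupp hx).1
  -- the divergence theorem on one of the two simplices
  have hdiv : ∀ (J : Finset (Space N)) (hJ : IsSimplex J) (b : J),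
      (∀ x ∈ U, ∀ b', b' ≠ b → 0 < hJ.basis.coord b' x) → facetIntegral J b ψ = m → ∀ j,
      ∫ x in hull J, partialD j ψ x = normal J b j * m := by
    intro J hJ b hJU hJm j
    have h1 := hJ.integral_fderiv hN hψ1 (EuclideanSpace.single j 1)
    rw [← Finset.sum_coe_sort J, Finset.sum_eq_single b] at h1
    · rw [hJm] at h1
      simpa [partialD, EuclideanSpace.inner_single_right] using h1
    · intro b' _ hb'
      have : facetIntegral J b' ψ = 0 := by
        change ∫ x, ψ x ∂(facetMeasure J b') = 0
        rw [← integral_zero (α := Space N) (G := ℝ) (μ := facetMeasure J b')]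
        refine integral_congr_ae ?_
        filter_upwards [ae_mem_facetMeasure J b'] with x hx
        by_contra hx0
        have h2 := hJU x (hψsupp hx0) b' hb'
        exact h2.ne' (hJ.mem_hull_facet.1 hx).2
      rw [this, mul_zero]
    · simp
  have hdK := hdiv K h ⟨a, ha⟩ (fun x hx => hx.1) rfl
  have hdK' := hdiv K' h' ⟨a', ha'⟩ (fun x hx => hx.2) (facetIntegral_congr hF ψ)
  have hpc : ∀ j, Continuous (partialD j ψ) := fun j =>
    (hψ1.continuous_fderiv (by norm_num)).clm_apply continuous_const
  have hp0 : ∀ j, ∀ x ∉ U, partialD j ψ x = 0 := by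
    intro j x hx
    have : fderiv ℝ ψ x = 0 := by
      by_contra hne0
      exact hx (hψU (support_fderiv_subset ℝ hne0))
    rw [partialD, this]; rfl
  have hnull : volume (hull K ∩ hull K') = 0 := by
    have hae := ae_inner_add_ne_zero (h.grad_ne_zero hN ⟨a, ha⟩) (h.off ⟨a, ha⟩)
    rw [ae_iff] at hae
    refine measure_mono_null (fun x hx => ?_) hae
    rw [mem_ofPred_eq, not_not, ← h.coord_eq]
    exact (h.mem_hull_facet (a := ⟨a, ha⟩).1 (hint hx)).2
  ext l k
  -- The coefficients are constant on either side, so the distributional identity reduces to `m`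
  -- times the sum of the two flux matrices.
  have hdA := hH.div_A ψ hψs hψc (hψU.trans hUΩ) l k
  have hsplit : ∀ j, ∫ x in H.Ω, H.A j x l k * partialD j ψ x =
      (normal K a j * H.A j (barycenter K) l k + normal K' a' j * H.A j (barycenter K') l k) * m := by
    intro j
    have e1 : ∫ x in H.Ω, H.A j x l k * partialD j ψ x =
        ∫ x in hull K ∪ hull K', H.A j x l k * partialD j ψ x := by
      have hz0 : ∀ s : Set (Space N), MeasurableSet s → U ⊆ s →
          ∫ x in s, H.A j x l k * partialD j ψ x = ∫ x in U, H.A j x l k * partialD j ψ x :=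
        fun s hs hUs => setIntegral_eq_of_subset_of_forall_sdiff_eq_zero hs hUs
          fun x hx => by rw [hp0 j x hx.2, mul_zero]
      rw [hz0 _ hH.isOpen.measurableSet hUΩ, hz0 _ ((isCompact_hull K).isClosed.measurableSet.union
        (isCompact_hull K').isClosed.measurableSet) hUsub]
    have e2 : ∀ J ∈ P.mesh.elements, (fun x => H.A j x l k * partialD j ψ x)
        =ᵐ[volume.restrict (hull J)] fun x => H.A j (barycenter J) l k * partialD j ψ x := by
      intro J hJ
      filter_upwards [ae_mem_interior_hull] with x hx
      rw [A_eq hP hJ j hx]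
    have e3 : ∀ J ∈ P.mesh.elements,
        IntegrableOn (fun x => H.A j x l k * partialD j ψ x) (hull J) := fun J hJ =>
      (integrable_congr (e2 J hJ)).2 (integrableOn_hull (continuous_const.mul (hpc j)))
    rw [e1, setIntegral_union₀ hnull (isCompact_hull K').isClosed.measurableSet.nullMeasurableSet
      (e3 K hK) (e3 K' hK'), integral_congr_ae (e2 K hK), integral_congr_ae (e2 K' hK'),
      integral_const_mul, integral_const_mul, hdK, hdK']
    ring
  simp_rw [hsplit] at hdA
  rw [← Finset.sum_mul, mul_eq_zero, or_iff_left hmpos.ne', Finset.sum_add_distrib] at hdA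
  simp only [bdryMatrix, Matrix.sum_apply, Matrix.smul_apply, smul_eq_mul, Matrix.neg_apply]
  linarith

end Coefficients

/-! ### Bilinear forms of polynomial vectors with matrix weights -/

section WeightedForms

variable {N L : ℕ}

/-- A finite measure that is carried by a compact set. -/
structure CompactlyCarried (μ : Measure (Space N)) : Prop where
  finite : IsFiniteMeasure μ
  carried : ∃ s, IsCompact s ∧ ∀ᵐ x ∂μ, x ∈ s

/-- A measurable and essentially bounded function. -/
def IsWeight (μ : Measure (Space N)) (ω : Space N → ℝ) : Prop :=
  AEStronglyMeasurable ω μ ∧ ∃ C : ℝ, ∀ᵐ x ∂μ, |ω x| ≤ C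

lemma IsWeight.add {μ : Measure (Space N)} {ω η : Space N → ℝ} (h : IsWeight μ ω)
    (h' : IsWeight μ η) : IsWeight μ (fun x => ω x + η x) := by
  obtain ⟨hm, C, hC⟩ := h
  obtain ⟨hm', C', hC'⟩ := h'
  refine ⟨hm.add hm', C + C', ?_⟩
  filter_upwards [hC, hC'] with x h1 h2
  exact (abs_add_le _ _).trans (add_le_add h1 h2)

lemma IsWeight.mul {μ : Measure (Space N)} {ω η : Space N → ℝ} (h : IsWeight μ ω)
    (h' : IsWeight μ η) : IsWeight μ (fun x => ω x * η x) := by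
  obtain ⟨hm, C, hC⟩ := h
  obtain ⟨hm', C', hC'⟩ := h'
  refine ⟨hm.mul hm', C * C', ?_⟩
  filter_upwards [hC, hC'] with x h1 h2
  rw [abs_mul]
  exact mul_le_mul h1 h2 (abs_nonneg _) ((abs_nonneg _).trans h1)

lemma isWeight_const {μ : Measure (Space N)} (c : ℝ) : IsWeight μ (fun _ => c) :=
  ⟨aestronglyMeasurable_const, |c|, ae_of_all _ fun _ => le_rfl⟩

lemma IsWeight.congr {μ : Measure (Space N)} {ω η : Space N → ℝ} (h : IsWeight μ ω)
    (h' : ω =ᵐ[μ] η) : IsWeight μ η := by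
  obtain ⟨hm, C, hC⟩ := h
  refine ⟨hm.congr h', C, ?_⟩
  filter_upwards [hC, h'] with x h1 h2
  rwa [← h2]

lemma CompactlyCarried.isWeight {μ : Measure (Space N)} (hμ : CompactlyCarried μ)
    {f : Space N → ℝ} (hf : Continuous f) : IsWeight μ f := by
  obtain ⟨s, hs, hμs⟩ := hμ.carried
  obtain ⟨C, hC⟩ := hs.exists_bound_of_continuousOn hf.continuousOn
  refine ⟨hf.aestronglyMeasurable, C, ?_⟩
  filter_upwards [hμs] with x hx
  exact hC x hx

lemma CompactlyCarried.integrable {μ : Measure (Space N)} (hμ : CompactlyCarried μ)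
    {ω : Space N → ℝ} (hω : IsWeight μ ω) : Integrable ω μ := by
  have := hμ.finite
  obtain ⟨hm, C, hC⟩ := hω
  exact Integrable.of_bound hm C hC

/-- The form `∫ (W y) · z dμ` for vectors of polynomials. -/
def matForm (μ : Measure (Space N)) (W : Space N → Matrix (Fin L) (Fin L) ℝ)
    (y z : Fin L → MvPolynomial (Fin N) ℝ) : ℝ :=
  ∫ x, (W x *ᵥ fun k => ev (y k) x) ⬝ᵥ (fun l => ev (z l) x) ∂μ

/-- All entries of a matrix field are weights. -/
def IsMatWeight (μ : Measure (Space N)) (W : Space N → Matrix (Fin L) (Fin L) ℝ) : Prop :=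
  ∀ l k, IsWeight μ fun x => W x l k

lemma isMatWeight_const {μ : Measure (Space N)} (M : Matrix (Fin L) (Fin L) ℝ) :
    IsMatWeight μ fun _ => M := fun _ _ => isWeight_const _

lemma IsMatWeight.smul {μ : Measure (Space N)} {W : Space N → Matrix (Fin L) (Fin L) ℝ}
    {ω : Space N → ℝ} (h : IsMatWeight μ W) (hω : IsWeight μ ω) :
    IsMatWeight μ fun x => ω x • W x := fun l k => hω.mul (h l k)

lemma IsMatWeight.add {μ : Measure (Space N)} {W W' : Space N → Matrix (Fin L) (Fin L) ℝ}
    (h : IsMatWeight μ W) (h' : IsMatWeight μ W') : IsMatWeight μ fun x => W x + W' x :=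
  fun l k => (h l k).add (h' l k)

variable {μ : Measure (Space N)} (hμ : CompactlyCarried μ)
include hμ

lemma IsMatWeight.isWeight_form {W : Space N → Matrix (Fin L) (Fin L) ℝ} (hW : IsMatWeight μ W)
    (y z : Fin L → MvPolynomial (Fin N) ℝ) :
    IsWeight μ fun x => (W x *ᵥ fun k => ev (y k) x) ⬝ᵥ (fun l => ev (z l) x) := by
  have hsum : ∀ (s : Finset (Fin L)) (f : Fin L → Space N → ℝ), (∀ i, IsWeight μ (f i)) →
      IsWeight μ fun x => ∑ i ∈ s, f i x := by
    classical
    intro s f hf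
    induction s using Finset.induction_on with
    | empty => simpa using isWeight_const 0
    | insert i s hi ih => simpa [Finset.sum_insert hi] using (hf i).add ih
  simp only [dotProduct, Matrix.mulVec]
  refine hsum _ _ fun l => IsWeight.mul (hsum _ _ fun k => (hW l k).mul ?_) ?_
  · exact hμ.isWeight (continuous_ev _)
  · exact hμ.isWeight (continuous_ev _)

lemma IsMatWeight.integrable_form {W : Space N → Matrix (Fin L) (Fin L) ℝ} (hW : IsMatWeight μ W)
    (y z : Fin L → MvPolynomial (Fin N) ℝ) :
    Integrable (fun x => (W x *ᵥ fun k => ev (y k) x) ⬝ᵥ (fun l => ev (z l) x)) μ :=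
  hμ.integrable (hW.isWeight_form hμ y z)

/-- `matForm` as a bilinear map. -/
def matFormₗ {W : Space N → Matrix (Fin L) (Fin L) ℝ} (hW : IsMatWeight μ W) :
    (Fin L → MvPolynomial (Fin N) ℝ) →ₗ[ℝ] (Fin L → MvPolynomial (Fin N) ℝ) →ₗ[ℝ] ℝ :=
  LinearMap.mk₂ ℝ (matForm μ W)
    (fun y y' z => by
      rw [matForm, matForm, matForm,
        ← integral_add (hW.integrable_form hμ y z) (hW.integrable_form hμ y' z)]
      congr 1
      ext x
      rw [← add_dotProduct, ← Matrix.mulVec_add]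
      congr 2
      ext k
      simp)
    (fun c y z => by
      rw [matForm, matForm, smul_eq_mul, ← integral_const_mul]
      congr 1
      ext x
      rw [← smul_eq_mul c, ← smul_dotProduct, ← Matrix.mulVec_smul]
      congr 2
      ext k
      simp)
    (fun y z z' => by
      rw [matForm, matForm, matForm,
        ← integral_add (hW.integrable_form hμ y z) (hW.integrable_form hμ y z')]
      congr 1
      ext x
      rw [← dotProduct_add]
      congr 1
      ext k
      simp)
    (fun c y z => by
      rw [matForm, matForm, smul_eq_mul, ← integral_const_mul]
      congr 1
      ext x
      rw [← smul_eq_mul c, ← dotProduct_smul]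
      congr 1
      ext k
      simp)

lemma matForm_add {W W' : Space N → Matrix (Fin L) (Fin L) ℝ} (hW : IsMatWeight μ W)
    (hW' : IsMatWeight μ W') (y z : Fin L → MvPolynomial (Fin N) ℝ) :
    matForm μ (fun x => W x + W' x) y z = matForm μ W y z + matForm μ W' y z := by
  rw [matForm, matForm, matForm,
    ← integral_add (hW.integrable_form hμ y z) (hW'.integrable_form hμ y z)]
  congr 1
  ext x
  rw [Matrix.add_mulVec, add_dotProduct]

omit hμ in
lemma matForm_const_smul (c : ℝ) (W : Space N → Matrix (Fin L) (Fin L) ℝ)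
    (y z : Fin L → MvPolynomial (Fin N) ℝ) :
    matForm μ (fun x => c • W x) y z = c * matForm μ W y z := by
  rw [matForm, matForm, ← integral_const_mul]
  congr 1
  ext x
  rw [Matrix.smul_mulVec, smul_dotProduct, smul_eq_mul]

omit hμ in
lemma matForm_congr {W W' : Space N → Matrix (Fin L) (Fin L) ℝ} (h : ∀ᵐ x ∂μ, W x = W' x)
    (y z : Fin L → MvPolynomial (Fin N) ℝ) : matForm μ W y z = matForm μ W' y z := by
  refine integral_congr_ae ?_
  filter_upwards [h] with x hx
  rw [hx]

omit hμ in
lemma matForm_nonneg {W : Space N → Matrix (Fin L) (Fin L) ℝ}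
    (h : ∀ᵐ x ∂μ, ∀ y : Fin L → ℝ, 0 ≤ (W x *ᵥ y) ⬝ᵥ y) (y : Fin L → MvPolynomial (Fin N) ℝ) :
    0 ≤ matForm μ W y y := by
  refine integral_nonneg_of_ae ?_
  filter_upwards [h] with x hx
  exact hx _

omit hμ in
lemma matForm_comm {W : Space N → Matrix (Fin L) (Fin L) ℝ} (h : ∀ᵐ x ∂μ, (W x).IsSymm)
    (y z : Fin L → MvPolynomial (Fin N) ℝ) : matForm μ W y z = matForm μ W z y := by
  refine integral_congr_ae ?_
  filter_upwards [h] with x hx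
  rw [dotProduct_comm, Matrix.dotProduct_mulVec, ← Matrix.mulVec_transpose, hx]

/-- The weighted square norm of a vector of polynomials. -/
def sqNorm (μ : Measure (Space N)) (ω : Space N → ℝ) (y : Fin L → MvPolynomial (Fin N) ℝ) : ℝ :=
  ∑ k, ∫ x, ω x * ev (y k) x ^ 2 ∂μ

/-- Young's inequality for each of the `L²` entries; every square then occurs `L` times. The weight
`ω` is kept so that facet terms can be measured with `δ`. -/
lemma abs_matForm_le {W : Space N → Matrix (Fin L) (Fin L) ℝ} {ω : Space N → ℝ}
    (hω : IsWeight μ ω) {c : ℝ} (hle : ∀ᵐ x ∂μ, ∀ l k, |W x l k| ≤ c * ω x)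
    (y z : Fin L → MvPolynomial (Fin N) ℝ) :
    |matForm μ W y z| ≤ c * L / 2 * (sqNorm μ ω y + sqNorm μ ω z) := by
  have hi : ∀ (q : MvPolynomial (Fin N) ℝ), Integrable (fun x => ω x * ev q x ^ 2) μ := fun q =>
    hμ.integrable (hω.mul (hμ.isWeight ((continuous_ev q).pow 2)))
  have hrhs : c * L / 2 * (sqNorm μ ω y + sqNorm μ ω z) = ∫ x, c * L / 2 *
      (∑ k, ω x * ev (y k) x ^ 2 + ∑ k, ω x * ev (z k) x ^ 2) ∂μ := by
    rw [integral_const_mul, integral_add (integrable_finsetSum _ fun k _ => hi _)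
      (integrable_finsetSum _ fun k _ => hi _), integral_finsetSum _ fun k _ => hi _,
      integral_finsetSum _ fun k _ => hi _]
    rfl
  rw [hrhs, ← Real.norm_eq_abs, matForm]
  refine norm_integral_le_of_norm_le (((integrable_finsetSum _ fun k _ => hi _).add
    (integrable_finsetSum _ fun k _ => hi _)).const_mul _) ?_
  filter_upwards [hle] with x hx
  rw [Real.norm_eq_abs]
  simp only [dotProduct, Matrix.mulVec]
  calc |∑ l, (∑ k, W x l k * ev (y k) x) * ev (z l) x|
      ≤ ∑ l, ∑ k, c * ω x * ((ev (y k) x ^ 2 + ev (z l) x ^ 2) / 2) := by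
        refine (Finset.abs_sum_le_sum_abs _ _).trans (Finset.sum_le_sum fun l _ => ?_)
        rw [Finset.sum_mul]
        refine (Finset.abs_sum_le_sum_abs _ _).trans (Finset.sum_le_sum fun k _ => ?_)
        rw [mul_assoc, abs_mul]
        refine mul_le_mul (hx l k) ?_ (abs_nonneg _) ((abs_nonneg _).trans (hx l k))
        rw [abs_mul]
        have h1 := two_mul_le_add_sq |ev (y k) x| |ev (z l) x|
        rw [sq_abs, sq_abs] at h1
        linarith
    _ = c * L / 2 * (∑ k, ω x * ev (y k) x ^ 2 + ∑ k, ω x * ev (z k) x ^ 2) := by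
        simp only [← Finset.mul_sum, ← Finset.sum_div, Finset.sum_add_distrib, Finset.sum_const,
          Finset.card_univ, Fintype.card_fin, nsmul_eq_mul]
        ring

omit hμ in
lemma sqNorm_nonneg {ω : Space N → ℝ} (h : ∀ᵐ x ∂μ, 0 ≤ ω x)
    (y : Fin L → MvPolynomial (Fin N) ℝ) : 0 ≤ sqNorm μ ω y := by
  refine Finset.sum_nonneg fun k _ => integral_nonneg_of_ae ?_
  filter_upwards [h] with x hx
  exact mul_nonneg hx (sq_nonneg _)

end WeightedForms

lemma compactlyCarried_hull {N : ℕ} (K : Finset (Space N)) :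
    CompactlyCarried (volume.restrict (hull K)) :=
  ⟨⟨by rw [Measure.restrict_apply_univ]; exact (isCompact_hull K).measure_lt_top⟩,
    hull K, isCompact_hull K, ae_restrict_mem (isCompact_hull K).isClosed.measurableSet⟩

lemma IsSimplex.compactlyCarried_facet {N : ℕ} {K : Finset (Space N)} (h : IsSimplex K)
    (hN : 0 < N) {a : Space N} (ha : a ∈ K) : CompactlyCarried (facetMeasure K a) :=
  ⟨h.isFiniteMeasure_facetMeasure hN ⟨a, ha⟩, _, isCompact_hull _, ae_mem_facetMeasure K a⟩

/-! ### Wave speed and uniform positivity of the mass matrix -/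

section WaveSpeed

variable {N L : ℕ}

lemma abs_mulVec_dotProduct_le {M : Matrix (Fin L) (Fin L) ℝ} {c : ℝ} (h : ∀ l k, |M l k| ≤ c)
    (y : Fin L → ℝ) : |(M *ᵥ y) ⬝ᵥ y| ≤ c * L * (y ⬝ᵥ y) := by
  simp only [dotProduct, Matrix.mulVec]
  calc |∑ l, (∑ k, M l k * y k) * y l|
      ≤ ∑ l, ∑ k, c * ((y k ^ 2 + y l ^ 2) / 2) := by
        refine (Finset.abs_sum_le_sum_abs _ _).trans (Finset.sum_le_sum fun l _ => ?_)
        rw [Finset.sum_mul]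
        refine (Finset.abs_sum_le_sum_abs _ _).trans (Finset.sum_le_sum fun k _ => ?_)
        rw [mul_assoc, abs_mul]
        refine mul_le_mul (h l k) ?_ (abs_nonneg _) ((abs_nonneg _).trans (h l k))
        rw [abs_mul]
        have h1 := two_mul_le_add_sq |y k| |y l|
        rw [sq_abs, sq_abs] at h1
        linarith
    _ = c * L * ∑ i, y i * y i := by
        simp only [← Finset.mul_sum, ← Finset.sum_div, Finset.sum_add_distrib, Finset.sum_const,
          Finset.card_univ, Fintype.card_fin, nsmul_eq_mul, ← sq]
        ring

/-- The maximum of a generalized Rayleigh quotient is a generalized eigenvalue. -/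
lemma exists_generalized_eigenvalue (hL : 0 < L) {M G : Matrix (Fin L) (Fin L) ℝ}
    (hM : M.IsSymm) (hG : G.IsSymm) (hpos : ∀ y : Fin L → ℝ, y ≠ 0 → 0 < (G *ᵥ y) ⬝ᵥ y) :
    ∃ (μ : ℝ) (e : Fin L → ℝ), e ≠ 0 ∧ M *ᵥ e = μ • (G *ᵥ e) ∧
      ∀ y, (M *ᵥ y) ⬝ᵥ y ≤ μ * ((G *ᵥ y) ⬝ᵥ y) := by
  have : Nonempty (Fin L) := ⟨⟨0, hL⟩⟩
  have hc : ∀ A : Matrix (Fin L) (Fin L) ℝ, Continuous fun y : Fin L → ℝ => (A *ᵥ y) ⬝ᵥ y :=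
    fun A => (Continuous.matrix_mulVec continuous_const continuous_id).dotProduct continuous_id
  have hs0 : ∀ y ∈ Metric.sphere (0 : Fin L → ℝ) 1, y ≠ 0 := by
    rintro y hy rfl
    simp at hy
  obtain ⟨e, he, hmax⟩ := (isCompact_sphere (0 : Fin L → ℝ) 1).exists_isMaxOn
    (NormedSpace.sphere_nonempty.2 zero_le_one)
    (f := fun y => ((M *ᵥ y) ⬝ᵥ y) / ((G *ᵥ y) ⬝ᵥ y))
    ((hc M).continuousOn.div (hc G).continuousOn fun y hy => (hpos y (hs0 y hy)).ne')
  set μ := ((M *ᵥ e) ⬝ᵥ e) / ((G *ᵥ e) ⬝ᵥ e) with hμ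
  have hle : ∀ y, (M *ᵥ y) ⬝ᵥ y ≤ μ * ((G *ᵥ y) ⬝ᵥ y) := by
    intro y
    by_cases hy : y = 0
    · simp [hy]
    have hyn : ‖y‖ ≠ 0 := by simpa using hy
    have h1 := hmax (show ‖y‖⁻¹ • y ∈ Metric.sphere (0 : Fin L → ℝ) 1 by
      simp [norm_smul, inv_mul_cancel₀ hyn])
    rw [mem_ofPred_eq] at h1
    simp only [Matrix.mulVec_smul, smul_dotProduct, dotProduct_smul, smul_eq_mul] at h1
    rw [mul_div_mul_left _ _ (inv_ne_zero hyn), mul_div_mul_left _ _ (inv_ne_zero hyn)] at h1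
    exact (div_le_iff₀ (hpos y hy)).1 h1
  refine ⟨μ, e, hs0 e he, ?_, hle⟩
  -- A semidefinite matrix annihilates every vector at which its quadratic form vanishes. At the
  -- maximizer `e` this is the eigenvalue equation.
  have hpsd : (μ • G - M).PosSemidef := by
    rw [Matrix.posSemidef_iff_dotProduct_mulVec]
    refine ⟨?_, fun y => ?_⟩
    · rw [Matrix.IsHermitian, Matrix.conjTranspose_eq_transpose_of_trivial, Matrix.transpose_sub,
        Matrix.transpose_smul, hG, hM]
    · rw [star_trivial, Matrix.sub_mulVec, Matrix.smul_mulVec, dotProduct_sub, dotProduct_smul,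
        dotProduct_comm y, dotProduct_comm y, smul_eq_mul]
      linarith [hle y]
  have hz : star e ⬝ᵥ (μ • G - M) *ᵥ e = 0 := by
    rw [star_trivial, Matrix.sub_mulVec, Matrix.smul_mulVec, dotProduct_sub, dotProduct_smul,
      dotProduct_comm e, dotProduct_comm e, smul_eq_mul, hμ,
      div_mul_cancel₀ _ (hpos e (hs0 e he)).ne', sub_self]
  have h0 := (hpsd.dotProduct_mulVec_zero_iff e).1 hz
  rw [Matrix.sub_mulVec, Matrix.smul_mulVec, sub_eq_zero] at h0
  exact h0.symm

variable {H : HyperbolicSystem N L} (hH : H.IsAdmissible)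
include hH

/-- Pairing the eigenvalue equation with `e` bounds `|μ|`. Boundedness is essential, since `sSup` of
an unbounded set of reals is `0`. -/
lemma bddAbove_waveSpeed : BddAbove {s : ℝ | ∃ x ∈ H.Ω, ∃ ν : Space N, ‖ν‖ = 1 ∧ ∃ μ : ℝ,
    ∃ e : Fin L → ℝ, e ≠ 0 ∧ (∑ j, ν j • H.A j x) *ᵥ e = μ • (H.G x *ᵥ e) ∧ s = |μ|} := by
  obtain ⟨c, hc⟩ := hH.bounded_A
  obtain ⟨g, hg, hG⟩ := hH.posDef_G
  refine ⟨(N * c) * L / g, ?_⟩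
  rintro _ ⟨x, hx, ν, hν, μ, e, he, heq, rfl⟩
  have hee : 0 < e ⬝ᵥ e := by
    refine lt_of_le_of_ne (Finset.sum_nonneg fun i _ => mul_self_nonneg _) fun h => he ?_
    exact (dotProduct_self_eq_zero.1 h.symm)
  have h1 : |((∑ j, ν j • H.A j x) *ᵥ e) ⬝ᵥ e| ≤ (N * c) * L * (e ⬝ᵥ e) := by
    refine abs_mulVec_dotProduct_le (fun l k => ?_) e
    rw [Matrix.sum_apply]
    refine (Finset.abs_sum_le_sum_abs _ _).trans ?_
    refine (Finset.sum_le_sum (g := fun _ => c) fun j _ => ?_).trans (by simp)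
    rw [Matrix.smul_apply, smul_eq_mul, abs_mul]
    have h2 : |ν j| ≤ 1 := by rw [← hν]; exact PiLp.norm_apply_le ν j
    calc _ ≤ 1 * c := mul_le_mul h2 (hc j x hx l k) (abs_nonneg _) zero_le_one
      _ = c := one_mul c
  rw [heq, smul_dotProduct, smul_eq_mul, abs_mul] at h1
  have h3 := hG x hx e
  rw [abs_of_pos (lt_of_lt_of_le (by positivity) h3)] at h1
  rw [le_div_iff₀ hg]
  have h4 : |μ| * (g * (e ⬝ᵥ e)) ≤ N * c * L * (e ⬝ᵥ e) :=
    (mul_le_mul_of_nonneg_left h3 (abs_nonneg _)).trans h1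
  exact le_of_mul_le_mul_right (by linarith) hee

lemma waveSpeed_nonneg : 0 ≤ H.waveSpeed := by
  refine Real.sSup_nonneg ?_
  rintro _ ⟨_, _, _, _, _, _, _, _, rfl⟩
  exact abs_nonneg _

/-- The largest generalized eigenvalue in the direction `ν/‖ν‖` dominates the Rayleigh quotient, and
it is one of the numbers over which the wave speed is the supremum. -/
lemma sum_smul_A_dotProduct_le (hL : 0 < L) {x : Space N} (hx : x ∈ H.Ω) (ν : Space N)
    (y : Fin L → ℝ) :
    ((∑ j, ν j • H.A j x) *ᵥ y) ⬝ᵥ y ≤ H.waveSpeed * ‖ν‖ * ((H.G x *ᵥ y) ⬝ᵥ y) := by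
  obtain ⟨g, hg, hG⟩ := hH.posDef_G
  have hGpos : ∀ y : Fin L → ℝ, y ≠ 0 → 0 < (H.G x *ᵥ y) ⬝ᵥ y := by
    intro y hy
    have hyy : 0 < y ⬝ᵥ y := by
      refine lt_of_le_of_ne (Finset.sum_nonneg fun i _ => mul_self_nonneg _) fun h => hy ?_
      exact (dotProduct_self_eq_zero.1 h.symm)
    exact lt_of_lt_of_le (by positivity) (hG x hx y)
  have hsymm : ∀ ν : Space N, (∑ j, ν j • H.A j x).IsSymm := by
    intro ν
    rw [Matrix.IsSymm, Matrix.transpose_sum]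
    refine Finset.sum_congr rfl fun j _ => ?_
    rw [Matrix.transpose_smul, hH.symm_A j _ hx]
  by_cases hν : ν = 0
  · simp [hν]
  have hνn : ‖ν‖ ≠ 0 := by simpa using hν
  obtain ⟨μ, e, he, heq, hle⟩ := exists_generalized_eigenvalue hL (hsymm (‖ν‖⁻¹ • ν))
    (hH.symm_G x hx) hGpos
  have hμ : μ ≤ H.waveSpeed := (le_abs_self μ).trans (le_csSup (bddAbove_waveSpeed hH)
    ⟨x, hx, ‖ν‖⁻¹ • ν, by rw [norm_smul, norm_inv, norm_norm, inv_mul_cancel₀ hνn], μ, e, he,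
      heq, rfl⟩)
  have h1 : (∑ j, ν j • H.A j x) = ‖ν‖ • ∑ j, (‖ν‖⁻¹ • ν) j • H.A j x := by
    rw [Finset.smul_sum]
    refine Finset.sum_congr rfl fun j _ => ?_
    rw [PiLp.smul_apply, smul_eq_mul, smul_smul, mul_inv_cancel_left₀ hνn]
  rw [h1, Matrix.smul_mulVec, smul_dotProduct, smul_eq_mul]
  have hGy : 0 ≤ (H.G x *ᵥ y) ⬝ᵥ y := by
    by_cases hy : y = 0
    · simp [hy]
    · exact (hGpos y hy).le
  calc _ ≤ ‖ν‖ * (μ * ((H.G x *ᵥ y) ⬝ᵥ y)) :=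
        mul_le_mul_of_nonneg_left (hle y) (norm_nonneg _)
    _ ≤ ‖ν‖ * (H.waveSpeed * ((H.G x *ᵥ y) ⬝ᵥ y)) := by gcongr
    _ = _ := by ring

/-- Uniform positivity of the mass matrix density under the causality condition. -/
lemma exists_mass_coercive (hL : 0 < L) {cHat : ℝ} (hc : H.waveSpeed < cHat) :
    ∃ θ : ℝ, 0 < θ ∧ ∀ x ∈ H.Ω, ∀ β : Space N, ‖β‖ ≤ 1 / cHat → ∀ y : Fin L → ℝ,
      θ * (y ⬝ᵥ y) ≤ ((H.G x - ∑ j, β j • H.A j x) *ᵥ y) ⬝ᵥ y := by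
  obtain ⟨g, hg, hG⟩ := hH.posDef_G
  have hw := waveSpeed_nonneg hH
  have hcpos : 0 < cHat := hw.trans_lt hc
  have hfac : 0 < 1 - H.waveSpeed / cHat := by
    rw [sub_pos, div_lt_one hcpos]; exact hc
  -- The term with slope `β` consumes at most the fraction `c/ĉ` of the form of `G`.
  refine ⟨(1 - H.waveSpeed / cHat) * g, by positivity, fun x hx β hβ y => ?_⟩
  have hyy : 0 ≤ y ⬝ᵥ y := Finset.sum_nonneg fun i _ => mul_self_nonneg _
  have hGy := hG x hx y
  have hGy0 : 0 ≤ (H.G x *ᵥ y) ⬝ᵥ y := le_trans (by positivity) hGy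
  have h1 := sum_smul_A_dotProduct_le hH hL hx β y
  rw [Matrix.sub_mulVec, sub_dotProduct]
  have h2 : H.waveSpeed * ‖β‖ * ((H.G x *ᵥ y) ⬝ᵥ y) ≤
      H.waveSpeed / cHat * ((H.G x *ᵥ y) ⬝ᵥ y) := by
    rw [div_eq_mul_one_div]
    gcongr
  calc _ = (1 - H.waveSpeed / cHat) * (g * (y ⬝ᵥ y)) := by ring
    _ ≤ (1 - H.waveSpeed / cHat) * ((H.G x *ᵥ y) ⬝ᵥ y) := by gcongr
    _ ≤ _ := by linarith

end WaveSpeed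

/-! ### Slopes of piecewise affine functions -/

section PiecewiseAffine

variable {N : ℕ}

/-- The gradient of a piecewise affine function on an element. -/
def slope (f : Space N → ℝ) (K : Finset (Space N)) : Space N := gradient f (barycenter K)

variable {K : Finset (Space N)} (h : IsSimplex K) {f : Space N → ℝ}
  (hf : ∃ g : Space N →ᵃ[ℝ] ℝ, ∀ x ∈ hull K, f x = g x)
include h hf

lemma hasGradientAt_slope {x : Space N} (hx : x ∈ interior (hull K)) :
    HasGradientAt f (slope f K) x := by
  obtain ⟨g, hg⟩ := hf
  have key : ∀ y ∈ interior (hull K), HasGradientAt f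
      ((InnerProductSpace.toDual ℝ (Space N)).symm g.linear.toContinuousLinearMap) y := by
    intro y hy
    rw [hasGradientAt_iff_hasFDerivAt, LinearIsometryEquiv.apply_symm_apply]
    have h1 : HasFDerivAt (fun y => g.linear.toContinuousLinearMap y + g 0)
        g.linear.toContinuousLinearMap y :=
      (g.linear.toContinuousLinearMap.hasFDerivAt).add_const _
    refine h1.congr_of_eventuallyEq ?_
    filter_upwards [isOpen_interior.mem_nhds hy] with z hz
    rw [hg z (interior_subset hz)]
    exact congrFun (AffineMap.decomp g) z
  rw [slope, (key _ h.barycenter_mem_interior).gradient]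
  exact key x hx

lemma partialD_eq_slope {x : Space N} (hx : x ∈ interior (hull K)) (j : Fin N) :
    partialD j f x = slope f K j := by
  rw [partialD, (hasGradientAt_slope h hf hx).hasFDerivAt.fderiv]
  simp [EuclideanSpace.inner_single_right]

/-- Unlike the gradient, which is available in the interior only, this formula reaches the facets.
-/
lemma exists_eq_inner_slope : ∃ c : ℝ, ∀ x ∈ hull K, f x = ⟪slope f K, x⟫ + c := by
  obtain ⟨g, hg⟩ := hf
  refine ⟨g 0, fun x hx => ?_⟩
  have h1 : HasFDerivAt f g.linear.toContinuousLinearMap (barycenter K) := by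
    have h1 : HasFDerivAt (fun y => g.linear.toContinuousLinearMap y + g 0)
        g.linear.toContinuousLinearMap (barycenter K) :=
      (g.linear.toContinuousLinearMap.hasFDerivAt).add_const _
    refine h1.congr_of_eventuallyEq ?_
    filter_upwards [isOpen_interior.mem_nhds h.barycenter_mem_interior] with z hz
    rw [hg z (interior_subset hz)]
    exact congrFun (AffineMap.decomp g) z
  have h2 := (hasGradientAt_slope h ⟨g, hg⟩ h.barycenter_mem_interior).hasFDerivAt.unique h1
  have h3 : ⟪slope f K, x⟫ = g.linear x := by
    have := congrArg (fun F : Space N →L[ℝ] ℝ => F x) h2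
    simpa using this
  rw [h3, hg x hx]
  exact congrFun (AffineMap.decomp g) x

lemma slope_add {f' : Space N → ℝ} (hf' : ∃ g : Space N →ᵃ[ℝ] ℝ, ∀ x ∈ hull K, f' x = g x)
    (c : ℝ) : slope (fun x => f x + c * f' x) K = slope f K + c • slope f' K := by
  have hx := h.barycenter_mem_interior
  have h1 := (hasGradientAt_slope h hf hx).hasFDerivAt.add
    ((hasGradientAt_slope h hf' hx).hasFDerivAt.const_mul c)
  rw [slope]
  refine HasGradientAt.gradient ?_
  rw [hasGradientAt_iff_hasFDerivAt]
  refine h1.congr_fderiv ?_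
  simp

omit h in
lemma affine_add {f' : Space N → ℝ} (hf' : ∃ g : Space N →ᵃ[ℝ] ℝ, ∀ x ∈ hull K, f' x = g x)
    (c : ℝ) : ∃ g : Space N →ᵃ[ℝ] ℝ, ∀ x ∈ hull K, f x + c * f' x = g x := by
  obtain ⟨g, hg⟩ := hf
  obtain ⟨g', hg'⟩ := hf'
  exact ⟨g + c • g', fun x hx => by simp [hg x hx, hg' x hx]⟩

end PiecewiseAffine

/-! ### The height of a tent on the patch -/

section Patch

variable {N L : ℕ} {H : HyperbolicSystem N L} {P : DGPatch N L} {γ Cd cHat : ℝ} {T : Tent N}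

lemma mem_patch {K : Finset (Space N)} :
    K ∈ P.mesh.patch P.vertex ↔ K ∈ P.mesh.elements ∧ P.vertex ∈ K := by
  simp [Mesh.patch]

lemma patch_isSimplex (K : P.mesh.patch P.vertex) : IsSimplex (K : Finset (Space N)) :=
  Mesh.isSimplex (mem_patch.1 K.2).1

variable (hT : T.IsCausal P cHat) (K : P.mesh.patch P.vertex)
include hT

lemma affine_δ : ∃ g : Space N →ᵃ[ℝ] ℝ, ∀ x ∈ hull (K : Finset (Space N)), T.δ x = g x := by
  obtain ⟨g, hg⟩ := affine_add (hT.affine_top K K.2) (hT.affine_bot K K.2) (-1)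
  refine ⟨g, fun x hx => ?_⟩
  rw [← hg x hx, Tent.δ]
  ring

lemma slope_δ : slope T.δ K = slope T.top K - slope T.bot K := by
  have := slope_add (patch_isSimplex K) (hT.affine_top K K.2) (hT.affine_bot K K.2) (-1)
  have h1 : T.δ = fun x => T.top x + -1 * T.bot x := by ext x; rw [Tent.δ]; ring
  rw [h1, this]
  module

lemma norm_slope_bot_le : ‖slope T.bot K‖ ≤ 1 / cHat :=
  hT.causal_bot K K.2 _ (patch_isSimplex K).barycenter_mem_interior

lemma norm_slope_top_le : ‖slope T.top K‖ ≤ 1 / cHat :=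
  hT.causal_top K K.2 _ (patch_isSimplex K).barycenter_mem_interior

lemma norm_slope_δ_le : ‖slope T.δ K‖ ≤ 2 / cHat := by
  rw [slope_δ hT]
  refine (norm_sub_le _ _).trans ?_
  have h1 := norm_slope_bot_le hT K
  have h2 := norm_slope_top_le hT K
  calc _ ≤ 1 / cHat + 1 / cHat := add_le_add h2 h1
    _ = _ := by ring

lemma δ_vertex {a : Space N} (ha : a ∈ (K : Finset (Space N))) (hne : a ≠ P.vertex) :
    T.δ a = 0 := by
  rw [Tent.δ, hT.fixed K K.2 a ha hne, sub_self]

/-- An affine function that vanishes at all vertices but one is a multiple of the hat function of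
that vertex. The sign of `δ` and its zeros can be read off. -/
lemma δ_eq_coord {x : Space N} (hx : x ∈ hull (K : Finset (Space N))) :
    T.δ x = T.δ P.vertex *
      (patch_isSimplex K).basis.coord ⟨P.vertex, (mem_patch.1 K.2).2⟩ x := by
  set h := patch_isSimplex K
  obtain ⟨c, hc⟩ := exists_eq_inner_slope h (affine_δ hT K)
  have h1 := h.sum_coord_smul x
  have h2 := h.sum_coord x
  have h3 : T.δ x = ∑ a, h.basis.coord a x * T.δ (a : Space N) := by
    rw [hc x hx]
    nth_rewrite 1 [← h1]
    rw [inner_sum, ← mul_one c, ← h2, Finset.mul_sum, ← Finset.sum_add_distrib]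
    refine Finset.sum_congr rfl fun a _ => ?_
    rw [hc a (IsSimplex.vertex_mem_hull a.2), inner_smul_right]
    ring
  rw [h3, Finset.sum_eq_single ⟨P.vertex, (mem_patch.1 K.2).2⟩, mul_comm]
  · intro b _ hb
    rw [δ_vertex hT K b.2 (fun e => hb (Subtype.ext e)), mul_zero]
  · simp

lemma δ_nonneg {x : Space N} (hx : x ∈ hull (K : Finset (Space N))) : 0 ≤ T.δ x := by
  rw [δ_eq_coord hT K hx]
  have h1 : 0 < T.δ P.vertex := sub_pos.2 hT.raised
  exact mul_nonneg h1.le ((patch_isSimplex K).mem_hull.1 hx _)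

lemma δ_eq_zero {x : Space N} (hx : x ∈ hull (facet (K : Finset (Space N)) P.vertex)) :
    T.δ x = 0 := by
  have h1 := ((patch_isSimplex K).mem_hull_facet (a := ⟨P.vertex, (mem_patch.1 K.2).2⟩)).1 hx
  rw [δ_eq_coord hT K h1.1, h1.2, mul_zero]

/-- `δ` vanishes at a vertex other than the raised one, and its slope is at most `2/ĉ`. This factor
of the mesh size makes the form `a` bounded uniformly in the mesh. -/
lemma δ_le (hN : 0 < N) {x : Space N} (hx : x ∈ hull (K : Finset (Space N))) :
    T.δ x ≤ 2 / cHat * Metric.diam (hull (K : Finset (Space N))) := by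
  obtain ⟨c, hc⟩ := exists_eq_inner_slope (patch_isSimplex K) (affine_δ hT K)
  obtain ⟨b, hb⟩ := (patch_isSimplex K).exists_ne hN P.vertex
  have hbm := IsSimplex.vertex_mem_hull b.2
  have h1 := δ_vertex hT K b.2 hb
  have h2 : T.δ x = ⟪slope T.δ K, x - (b : Space N)⟫ := by
    rw [← sub_zero (T.δ x), ← h1, hc x hx, hc b hbm, inner_sub_right]
    ring
  rw [h2]
  refine (real_inner_le_norm _ _).trans ?_
  refine mul_le_mul (norm_slope_δ_le hT K) ?_ (norm_nonneg _)
    ((norm_nonneg _).trans (norm_slope_δ_le hT K))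
  rw [← dist_eq_norm]
  exact Metric.dist_le_diam_of_mem (isCompact_hull _).isBounded hx hbm

end Patch

/-! ### The facets of the patch and the pairing of their two sides -/

section Facets

variable {N L : ℕ} {P : DGPatch N L}

/-- The facets of the elements of the patch, seen from the elements. -/
abbrev PatchFacet (P : DGPatch N L) : Type :=
  Σ K : P.mesh.patch P.vertex, (K : Finset (Space N))

namespace PatchFacet

/-- The vertices of a facet. -/
def face (i : PatchFacet P) : Finset (Space N) := facet (i.1 : Finset (Space N)) i.2

/-- The facets in the interior of the patch. -/
def IsInner (i : PatchFacet P) : Prop :=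
  ¬ P.mesh.IsBoundaryFacet i.face ∧ (i.2 : Space N) ≠ P.vertex

/-- An inner facet contains the patch vertex, so the neighbour that the mesh provides belongs to the
patch. -/
lemma exists_opposite (i : PatchFacet P) (hi : i.IsInner) :
    ∃ i' : PatchFacet P, i'.1 ≠ i.1 ∧ i'.face = i.face := by
  classical
  obtain ⟨K', hK', hne, hsub⟩ := Mesh.exists_neighbour hi.1
  have hv : P.vertex ∈ i.face := by
    rw [face, facet, Finset.mem_erase]
    exact ⟨hi.2.symm, (mem_patch.1 i.1.2).2⟩
  obtain ⟨a', ha', hF⟩ := (Mesh.isSimplex hK').exists_facet_eq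
    ((patch_isSimplex i.1).card_facet i.2) hsub
  exact ⟨⟨⟨K', mem_patch.2 ⟨hK', hsub hv⟩⟩, ⟨a', ha'⟩⟩, fun e => hne (congrArg Subtype.val e), hF⟩

open Classical in
/-- The same facet, seen from the neighbouring element if there is one. -/
def opposite (i : PatchFacet P) : PatchFacet P :=
  if hi : i.IsInner then (i.exists_opposite hi).choose else i

lemma opposite_of_not_isInner {i : PatchFacet P} (hi : ¬ i.IsInner) : i.opposite = i := by
  rw [opposite, dif_neg hi]

lemma opposite_fst_ne {i : PatchFacet P} (hi : i.IsInner) : i.opposite.1 ≠ i.1 := by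
  rw [opposite, dif_pos hi]
  exact (i.exists_opposite hi).choose_spec.1

lemma face_opposite (i : PatchFacet P) : i.opposite.face = i.face := by
  by_cases hi : i.IsInner
  · rw [opposite, dif_pos hi]
    exact (i.exists_opposite hi).choose_spec.2
  · rw [opposite_of_not_isInner hi]

lemma eq_of_face_eq (i i' : PatchFacet P) (h1 : i.1 = i'.1) (hF : i.face = i'.face) : i = i' := by
  classical
  obtain ⟨K, a⟩ := i
  obtain ⟨K', a'⟩ := i'
  simp only at h1
  subst h1
  congr 1
  by_contra hne
  have h2 : (a' : Space N) ∈ face ⟨K, a⟩ := by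
    rw [face, facet, Finset.mem_erase]
    exact ⟨fun e => hne (Subtype.ext e.symm), a'.2⟩
  rw [hF, face, facet, Finset.mem_erase] at h2
  exact h2.1 rfl

lemma face_subset (i : PatchFacet P) : i.face ⊆ i.1 := by
  classical
  exact Finset.erase_subset _ _

lemma vertex_mem_face_iff (i : PatchFacet P) : P.vertex ∈ i.face ↔ (i.2 : Space N) ≠ P.vertex := by
  classical
  rw [face, facet, Finset.mem_erase]
  exact ⟨fun h => h.1.symm, fun h => ⟨h.symm, (mem_patch.1 i.1.2).2⟩⟩

lemma isInner_congr {i i' : PatchFacet P} (hF : i'.face = i.face) (hi : i.IsInner) :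
    i'.IsInner := by
  refine ⟨by rw [hF]; exact hi.1, ?_⟩
  rw [← vertex_mem_face_iff, hF, vertex_mem_face_iff]
  exact hi.2

/-- The element on the other side of a facet is unique. -/
lemma fst_eq_of_face_subset (hN : 0 < N) {i : PatchFacet P} (hi : i.IsInner)
    {K' : P.mesh.patch P.vertex} (hne : K' ≠ i.1) (hsub : i.face ⊆ K') : K' = i.opposite.1 := by
  refine Subtype.ext (Mesh.eq_of_facet_subset hN (mem_patch.1 i.1.2).1 (mem_patch.1 K'.2).1
    (mem_patch.1 i.opposite.1.2).1 i.2.2 hsub ?_ (fun e => hne (Subtype.ext e))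
    (fun e => opposite_fst_ne hi (Subtype.ext e)))
  change i.face ⊆ _
  rw [← face_opposite]
  exact face_subset _

/-- By uniqueness of the neighbour. Being an involution, `opposite` reindexes sums over facet sides,
and the two contributions of a facet can be combined. -/
lemma opposite_opposite (hN : 0 < N) (i : PatchFacet P) : i.opposite.opposite = i := by
  by_cases hi : i.IsInner
  · have hi' := isInner_congr (face_opposite i) hi
    refine eq_of_face_eq _ _ ?_ (by rw [face_opposite, face_opposite])
    refine (fst_eq_of_face_subset hN hi' (opposite_fst_ne hi).symm ?_).symm
    rw [face_opposite]
    exact face_subset _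
  · rw [opposite_of_not_isInner hi, opposite_of_not_isInner hi]

lemma sum_opposite (hN : 0 < N) (f : PatchFacet P → ℝ) : ∑ i : PatchFacet P, f i.opposite = ∑ i, f i :=
  Equiv.sum_comp (Function.Involutive.toPerm opposite (opposite_opposite hN)) f

lemma facetMeasure_opposite (i : PatchFacet P) :
    facetMeasure (i.opposite.1 : Finset (Space N)) i.opposite.2 =
      facetMeasure (i.1 : Finset (Space N)) i.2 := by
  have : facet (i.opposite.1 : Finset (Space N)) i.opposite.2 =
    facet (i.1 : Finset (Space N)) i.2 := face_opposite i
  rw [facetMeasure, facetMeasure, this]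

lemma valO_eq (hN : 0 < N) {p : ℕ} (w : V P p) {i : PatchFacet P} (hi : i.IsInner) (x : Space N) :
    valO w i.1 i.2 x = val w i.opposite.1 x := by
  classical
  rw [valO, Finset.sum_eq_single i.opposite.1]
  · rw [if_pos]
    refine ⟨opposite_fst_ne hi, ?_⟩
    change i.face ⊆ _
    rw [← face_opposite]
    exact face_subset _
  · intro K' _ hK'
    rw [if_neg]
    rintro ⟨h1, h2⟩
    exact hK' (fst_eq_of_face_subset hN hi h1 h2)
  · simp

end PatchFacet

end Facets

/-! ### The discrete forms as sums of weighted polynomial forms -/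

section Forms

variable {N L p : ℕ} {H : HyperbolicSystem N L} {P : DGPatch N L} {γ Cd cHat : ℝ} {T : Tent N}

/-- The polynomials of a discrete function on an element. -/
def polyAt (K : P.mesh.patch P.vertex) : V P p →ₗ[ℝ] (Fin L → MvPolynomial (Fin N) ℝ) where
  toFun w l := (w K l : MvPolynomial (Fin N) ℝ)
  map_add' _ _ := rfl
  map_smul' _ _ := rfl

/-- The partial derivatives of the polynomials of a discrete function on an element. -/
def derivAt (j : Fin N) (K : P.mesh.patch P.vertex) :
    V P p →ₗ[ℝ] (Fin L → MvPolynomial (Fin N) ℝ) where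
  toFun w l := MvPolynomial.pderiv j (w K l : MvPolynomial (Fin N) ℝ)
  map_add' w w' := by ext1 l; simp
  map_smul' c w := by ext1 l; simp

lemma val_eq (w : V P p) (K : P.mesh.patch P.vertex) (x : Space N) :
    val w K x = fun l => ev (polyAt K w l) x := rfl

lemma valD_eq (j : Fin N) (w : V P p) (K : P.mesh.patch P.vertex) (x : Space N) :
    valD j w K x = fun l => ev (derivAt j K w l) x := rfl

/-- The square of the `L²` norm on an element. -/
def elemSq (K : P.mesh.patch P.vertex) (w : V P p) : ℝ :=
  sqNorm (volume.restrict (hull (K : Finset (Space N)))) (fun _ => 1) (polyAt K w)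

lemma elemSq_nonneg (K : P.mesh.patch P.vertex) (w : V P p) : 0 ≤ elemSq K w :=
  sqNorm_nonneg (ae_of_all _ fun _ => zero_le_one) _

lemma setIntegral_val_self (K : P.mesh.patch P.vertex) (w : V P p) :
    ∫ x in hull (K : Finset (Space N)), val w K x ⬝ᵥ val w K x = elemSq K w := by
  rw [elemSq, sqNorm]
  simp only [val_eq, dotProduct, one_mul, sq]
  rw [integral_finsetSum]
  exact fun l _ => integrableOn_hull ((continuous_ev _).mul (continuous_ev _))

lemma ip_self (w : V P p) : ip w w = ∑ K, elemSq K w :=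
  Finset.sum_congr rfl fun K _ => setIntegral_val_self K w

/-- The matrix of `M_0` on an element. -/
def massMatrix (H : HyperbolicSystem N L) (T : Tent N) (K : Finset (Space N)) :
    Matrix (Fin L) (Fin L) ℝ :=
  H.G (barycenter K) - ∑ j, slope T.bot K j • H.A j (barycenter K)

/-- The matrix of `M_1` on an element. -/
def tentMatrix (H : HyperbolicSystem N L) (T : Tent N) (K : Finset (Space N)) :
    Matrix (Fin L) (Fin L) ℝ :=
  ∑ j, slope T.δ K j • H.A j (barycenter K)

lemma elem_mem (K : P.mesh.patch P.vertex) : (K : Finset (Space N)) ∈ P.mesh.elements :=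
  (mem_patch.1 K.2).1

lemma ip_eq (w v : V P p) : ip w v = ∑ K : P.mesh.patch P.vertex,
    matForm (volume.restrict (hull (K : Finset (Space N)))) (fun _ => 1) (polyAt K w)
      (polyAt K v) := by
  refine Finset.sum_congr rfl fun K _ => ?_
  simp only [matForm, Matrix.one_mulVec, val_eq]

/-- Gradient and coefficients are constant in the interior of the element, and the frontier of a
convex set is null. -/
lemma setIntegral_sum_slope (hP : P.IsAdmissible H γ Cd) (K : P.mesh.patch P.vertex)
    {f : Space N → ℝ} (hf : ∃ g : Space N →ᵃ[ℝ] ℝ, ∀ x ∈ hull (K : Finset (Space N)), f x = g x)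
    (w v : V P p) :
    ∑ j, ∫ x in hull (K : Finset (Space N)),
      partialD j f x * ((H.A j x *ᵥ val w K x) ⬝ᵥ val v K x) =
    matForm (volume.restrict (hull (K : Finset (Space N))))
      (fun _ => ∑ j, slope f K j • H.A j (barycenter K)) (polyAt K w) (polyAt K v) := by
  have h1 : ∀ j, ∫ x in hull (K : Finset (Space N)),
      partialD j f x * ((H.A j x *ᵥ val w K x) ⬝ᵥ val v K x) =
      ∫ x in hull (K : Finset (Space N)), ((slope f K j • H.A j (barycenter K)) *ᵥ
        fun k => ev (polyAt K w k) x) ⬝ᵥ fun l => ev (polyAt K v l) x := by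
    intro j
    refine integral_congr_ae ?_
    filter_upwards [ae_mem_interior_hull] with x hx
    rw [partialD_eq_slope (patch_isSimplex K) hf hx, A_eq hP (elem_mem K) j hx, Matrix.smul_mulVec,
      smul_dotProduct, val_eq, val_eq, smul_eq_mul]
  simp_rw [h1]
  rw [matForm, ← integral_finsetSum _ fun j _ => (isMatWeight_const _).integrable_form
    (compactlyCarried_hull _) _ _]
  refine integral_congr_ae (ae_of_all _ fun x => ?_)
  simp only [Matrix.sum_mulVec, sum_dotProduct]

lemma formM0_eq (hP : P.IsAdmissible H γ Cd) (hT : T.IsCausal P cHat) (w v : V P p) :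
    formM0 H T w v = ∑ K : P.mesh.patch P.vertex,
      matForm (volume.restrict (hull (K : Finset (Space N)))) (fun _ => massMatrix H T K)
        (polyAt K w) (polyAt K v) := by
  refine Finset.sum_congr rfl fun K _ => ?_
  rw [setIntegral_sum_slope hP K (hT.affine_bot K K.2)]
  have h1 : ∫ x in hull (K : Finset (Space N)), (H.G x *ᵥ val w K x) ⬝ᵥ val v K x =
      matForm (volume.restrict (hull (K : Finset (Space N)))) (fun _ => H.G (barycenter K))
        (polyAt K w) (polyAt K v) := by
    refine integral_congr_ae ?_
    filter_upwards [ae_mem_interior_hull] with x hx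
    rw [G_eq hP (elem_mem K) hx, val_eq, val_eq]
  rw [h1, matForm, matForm, ← integral_sub
    ((isMatWeight_const _).integrable_form (compactlyCarried_hull _) _ _)
    ((isMatWeight_const _).integrable_form (compactlyCarried_hull _) _ _), matForm]
  refine integral_congr_ae (ae_of_all _ fun x => ?_)
  simp only [massMatrix, Matrix.sub_mulVec, sub_dotProduct]

lemma formM1_eq (hP : P.IsAdmissible H γ Cd) (hT : T.IsCausal P cHat) (w v : V P p) :
    formM1 H T w v = ∑ K : P.mesh.patch P.vertex,
      matForm (volume.restrict (hull (K : Finset (Space N)))) (fun _ => tentMatrix H T K)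
        (polyAt K w) (polyAt K v) :=
  Finset.sum_congr rfl fun K _ => setIntegral_sum_slope hP K (affine_δ hT K) w v

/-- The measure on a facet of the patch. -/
def PatchFacet.measure (i : PatchFacet P) : Measure (Space N) :=
  facetMeasure (i.1 : Finset (Space N)) i.2

open Classical in
/-- The matrix of the numerical flux, without `δ`, that acts on the own value. -/
def selfMatrix (H : HyperbolicSystem N L) (i : PatchFacet P) (x : Space N) :
    Matrix (Fin L) (Fin L) ℝ :=
  if P.mesh.IsBoundaryFacet i.face then (1 / 2 : ℝ) • (bdryMatrix H i.1 i.2 + P.B x)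
  else (1 / 2 : ℝ) • bdryMatrix H i.1 i.2 + P.S x

open Classical in
/-- The matrix of the numerical flux, without `δ`, that acts on the neighbouring value. -/
def otherMatrix (H : HyperbolicSystem N L) (i : PatchFacet P) (x : Space N) :
    Matrix (Fin L) (Fin L) ℝ :=
  if P.mesh.IsBoundaryFacet i.face then 0
  else (1 / 2 : ℝ) • bdryMatrix H i.1 i.2 + (-1 : ℝ) • P.S x

/-- The facet term of the form `a`. -/
def fluxTerm (H : HyperbolicSystem N L) (T : Tent N) (i : PatchFacet P) (w v : V P p) : ℝ :=
  facetIntegral (i.1 : Finset (Space N)) i.2 fun x =>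
    T.δ x * (flux H w i.1 i.2 x ⬝ᵥ val v i.1 x)

lemma formA_eq_sub (hP : P.IsAdmissible H γ Cd) (w v : V P p) :
    formA H T w v = (∑ K : P.mesh.patch P.vertex, ∑ j,
      matForm (volume.restrict (hull (K : Finset (Space N))))
        (fun x => T.δ x • H.A j (barycenter K)) (polyAt K w) (derivAt j K v)) -
      ∑ i : PatchFacet P, fluxTerm H T i w v := by
  rw [formA, Finset.sum_sub_distrib]
  congr 1
  · refine Finset.sum_congr rfl fun K _ => Finset.sum_congr rfl fun j _ => ?_
    refine integral_congr_ae ?_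
    filter_upwards [ae_mem_interior_hull] with x hx
    rw [A_eq hP (elem_mem K) j hx, val_eq, valD_eq, Matrix.smul_mulVec, smul_dotProduct,
      smul_eq_mul]
  · rw [Fintype.sum_sigma]
    refine Finset.sum_congr rfl fun K _ => ?_
    rw [← Finset.sum_coe_sort (K : Finset (Space N))]
    rfl

lemma PatchFacet.ae_mem_face (i : PatchFacet P) : ∀ᵐ x ∂i.measure, x ∈ hull i.face :=
  ae_mem_facetMeasure _ _

lemma PatchFacet.ae_mem_hull (i : PatchFacet P) :
    ∀ᵐ x ∂i.measure, x ∈ hull (i.1 : Finset (Space N)) := by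
  filter_upwards [i.ae_mem_face] with x hx
  exact convexHull_mono (by exact_mod_cast i.face_subset) hx

lemma PatchFacet.carried (hN : 0 < N) (i : PatchFacet P) : CompactlyCarried i.measure :=
  (patch_isSimplex i.1).compactlyCarried_facet hN i.2.2

lemma PatchFacet.measure_opposite (i : PatchFacet P) : i.opposite.measure = i.measure :=
  i.facetMeasure_opposite

lemma isWeight_δ (hT : T.IsCausal P cHat) (K : P.mesh.patch P.vertex) {μ : Measure (Space N)}
    (hμ : CompactlyCarried μ) (hK : ∀ᵐ x ∂μ, x ∈ hull (K : Finset (Space N))) :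
    IsWeight μ T.δ := by
  obtain ⟨c, hc⟩ := exists_eq_inner_slope (patch_isSimplex K) (affine_δ hT K)
  have h1 : IsWeight μ (fun x => ⟪slope T.δ K, x⟫ + c) := hμ.isWeight (by fun_prop)
  refine h1.congr ?_
  filter_upwards [hK] with x hx
  exact (hc x hx).symm

lemma abs_entry_le {M : Matrix (Fin L) (Fin L) ℝ} {c : ℝ}
    (h : ∀ y, eucl (M *ᵥ y) ≤ c * eucl y) (l k : Fin L) : |M l k| ≤ |c| := by
  have h1 := h (Pi.single k 1)
  have h2 : eucl (Pi.single k 1 : Fin L → ℝ) = 1 := by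
    rw [eucl, single_dotProduct]; simp
  rw [h2, mul_one, Matrix.mulVec_single_one] at h1
  refine le_trans ?_ (h1.trans (le_abs_self c))
  rw [eucl, ← Real.sqrt_sq_eq_abs]
  refine Real.sqrt_le_sqrt ?_
  rw [sq, dotProduct]
  exact Finset.single_le_sum (f := fun i => M.col k i * M.col k i)
    (fun i _ => mul_self_nonneg _) (Finset.mem_univ l)

lemma abs_bdryMatrix_le (hN : 0 < N) (hH : H.IsAdmissible) (hP : P.IsAdmissible H γ Cd) {cA : ℝ}
    (hcA : ∀ j, ∀ x ∈ H.Ω, ∀ l k, |H.A j x l k| ≤ cA) (i : PatchFacet P) (l k : Fin L) :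
    |bdryMatrix H i.1 i.2 l k| ≤ N * cA := by
  rw [bdryMatrix, Matrix.sum_apply]
  refine (Finset.abs_sum_le_sum_abs _ _).trans ?_
  refine (Finset.sum_le_sum (g := fun _ => cA) fun j _ => ?_).trans (by simp)
  rw [Matrix.smul_apply, smul_eq_mul, abs_mul]
  have hn : ‖normal (i.1 : Finset (Space N)) i.2‖ = 1 := by
    have h := patch_isSimplex i.1
    have hg : ‖h.grad i.2‖ ≠ 0 := by simpa using h.grad_ne_zero hN i.2
    rw [h.normal_eq hN, norm_neg, norm_smul, norm_inv, norm_norm, inv_mul_cancel₀ hg]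
  have h2 : |normal (i.1 : Finset (Space N)) i.2 j| ≤ 1 := by
    rw [← hn]; exact PiLp.norm_apply_le (normal (i.1 : Finset (Space N)) i.2) j
  calc _ ≤ 1 * cA := mul_le_mul h2 (hcA j _ (barycenter_mem hH hP (elem_mem i.1)) l k)
        (abs_nonneg _) zero_le_one
    _ = cA := one_mul _

lemma ae_abs_B_le (hP : P.IsAdmissible H γ Cd) (i : PatchFacet P)
    (hi : P.mesh.IsBoundaryFacet i.face) : ∀ᵐ x ∂i.measure, ∀ l k, |P.B x l k| ≤ |Cd| := by
  filter_upwards [hP.B_bound i.1 (elem_mem i.1) i.2 i.2.2 hi] with x hx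
  exact abs_entry_le hx

lemma ae_abs_S_le (hP : P.IsAdmissible H γ Cd) (i : PatchFacet P)
    (hi : ¬ P.mesh.IsBoundaryFacet i.face) : ∀ᵐ x ∂i.measure, ∀ l k, |P.S x l k| ≤ |Cd| := by
  filter_upwards [hP.S_bound i.1 (elem_mem i.1) i.2 i.2.2 hi] with x hx
  exact abs_entry_le hx

lemma isMatWeight_B (hP : P.IsAdmissible H γ Cd) (i : PatchFacet P)
    (hi : P.mesh.IsBoundaryFacet i.face) : IsMatWeight i.measure P.B := fun l k =>
  ⟨(hP.measurable_B l k).aestronglyMeasurable, |Cd|, by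
    filter_upwards [ae_abs_B_le hP i hi] with x hx; exact hx l k⟩

lemma isMatWeight_S (hP : P.IsAdmissible H γ Cd) (i : PatchFacet P)
    (hi : ¬ P.mesh.IsBoundaryFacet i.face) : IsMatWeight i.measure P.S := fun l k =>
  ⟨(hP.measurable_S l k).aestronglyMeasurable, |Cd|, by
    filter_upwards [ae_abs_S_le hP i hi] with x hx; exact hx l k⟩

lemma isMatWeight_self (hP : P.IsAdmissible H γ Cd) (i : PatchFacet P) :
    IsMatWeight i.measure (selfMatrix H i) := by
  by_cases hi : P.mesh.IsBoundaryFacet i.face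
  · have : selfMatrix H i = fun x => (1 / 2 : ℝ) • (bdryMatrix H i.1 i.2 + P.B x) := by
      ext1 x; rw [selfMatrix, if_pos hi]
    rw [this]
    exact ((isMatWeight_const _).add (isMatWeight_B hP i hi)).smul (isWeight_const _)
  · have : selfMatrix H i = fun x => (1 / 2 : ℝ) • bdryMatrix H i.1 i.2 + P.S x := by
      ext1 x; rw [selfMatrix, if_neg hi]
    rw [this]
    exact (isMatWeight_const _).add (isMatWeight_S hP i hi)

lemma isMatWeight_other (hP : P.IsAdmissible H γ Cd) (i : PatchFacet P) :
    IsMatWeight i.measure (otherMatrix H i) := by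
  by_cases hi : P.mesh.IsBoundaryFacet i.face
  · have : otherMatrix H i = fun x => 0 := by
      ext1 x; rw [otherMatrix, if_pos hi]
    rw [this]
    exact isMatWeight_const _
  · have : otherMatrix H i = fun x => (1 / 2 : ℝ) • bdryMatrix H i.1 i.2 + (-1 : ℝ) • P.S x := by
      ext1 x; rw [otherMatrix, if_neg hi]
    rw [this]
    exact (isMatWeight_const _).add ((isMatWeight_S hP i hi).smul (isWeight_const _))

lemma ae_δ_eq_zero (hT : T.IsCausal P cHat) {i : PatchFacet P} (hi : (i.2 : Space N) = P.vertex) :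
    ∀ᵐ x ∂i.measure, T.δ x = 0 := by
  filter_upwards [i.ae_mem_face] with x hx
  rw [PatchFacet.face, hi] at hx
  exact δ_eq_zero hT i.1 hx

lemma isMatWeight_δ_smul (hN : 0 < N) (hT : T.IsCausal P cHat) (i : PatchFacet P)
    {W : Space N → Matrix (Fin L) (Fin L) ℝ} (hW : IsMatWeight i.measure W) :
    IsMatWeight i.measure fun x => T.δ x • W x :=
  hW.smul (isWeight_δ hT i.1 (i.carried hN) i.ae_mem_hull)

/-- On a facet opposite to the patch vertex the neighbour may lie outside the patch, so that `valO`
and `opposite` need not agree; there both sides vanish with `δ`. -/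
lemma fluxTerm_eq (hN : 0 < N) (hP : P.IsAdmissible H γ Cd) (hT : T.IsCausal P cHat)
    (i : PatchFacet P) (w v : V P p) :
    fluxTerm H T i w v =
      matForm i.measure (fun x => T.δ x • selfMatrix H i x) (polyAt i.1 w) (polyAt i.1 v) +
      matForm i.measure (fun x => T.δ x • otherMatrix H i x) (polyAt i.opposite.1 w)
        (polyAt i.1 v) := by
  rw [matForm, matForm, ← integral_add
    ((isMatWeight_δ_smul hN hT i (isMatWeight_self hP i)).integrable_form (i.carried hN) _ _)
    ((isMatWeight_δ_smul hN hT i (isMatWeight_other hP i)).integrable_form (i.carried hN) _ _)]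
  change ∫ x, _ ∂i.measure = _
  by_cases hv : (i.2 : Space N) = P.vertex
  · refine integral_congr_ae ?_
    filter_upwards [ae_δ_eq_zero hT hv] with x hx
    simp [hx]
  refine integral_congr_ae (ae_of_all _ fun x => ?_)
  simp only [Matrix.smul_mulVec, smul_dotProduct, smul_eq_mul, ← mul_add, ← add_dotProduct]
  rw [← val_eq, ← val_eq, ← val_eq]
  congr 2
  by_cases hb : P.mesh.IsBoundaryFacet i.face
  · rw [flux, if_pos (show P.mesh.IsBoundaryFacet (facet (i.1 : Finset (Space N)) i.2) from hb),
      selfMatrix, otherMatrix, if_pos hb, if_pos hb, Matrix.smul_mulVec,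
      Matrix.zero_mulVec, add_zero]
  · rw [flux, if_neg (show ¬ P.mesh.IsBoundaryFacet (facet (i.1 : Finset (Space N)) i.2) from hb),
      selfMatrix, otherMatrix, if_neg hb, if_neg hb,
      PatchFacet.valO_eq hN w ⟨hb, hv⟩]
    simp only [Matrix.add_mulVec, Matrix.smul_mulVec, Matrix.mulVec_smul, Matrix.mulVec_add,
      Matrix.mulVec_sub]
    module

/-- `represent` selects its value by `Classical.epsilon`. Linearity in the second argument ensures
that a representing element exists, and linearity in the first is needed to expand the energy. -/
lemma exists_bilin_formA (hN : 0 < N) (hP : P.IsAdmissible H γ Cd) (hT : T.IsCausal P cHat) :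
    ∃ b : V P p →ₗ[ℝ] V P p →ₗ[ℝ] ℝ, ∀ w v, formA H T w v = b w v := by
  have hδ : ∀ (K : P.mesh.patch P.vertex) j, IsMatWeight
      (volume.restrict (hull (K : Finset (Space N)))) fun x => T.δ x • H.A j (barycenter K) :=
    fun K j => (isMatWeight_const _).smul (isWeight_δ hT K (compactlyCarried_hull _)
      (ae_restrict_mem (isCompact_hull _).isClosed.measurableSet))
  refine ⟨(∑ K : P.mesh.patch P.vertex, ∑ j,
      (matFormₗ (compactlyCarried_hull _) (hδ K j)).compl₁₂ (polyAt K) (derivAt j K)) -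
    ∑ i : PatchFacet P, ((matFormₗ (i.carried hN)
        (isMatWeight_δ_smul hN hT i (isMatWeight_self hP i))).compl₁₂ (polyAt i.1) (polyAt i.1) +
      (matFormₗ (i.carried hN) (isMatWeight_δ_smul hN hT i (isMatWeight_other hP i))).compl₁₂
        (polyAt i.opposite.1) (polyAt i.1)), fun w v => ?_⟩
  rw [formA_eq_sub hP]
  simp only [fluxTerm_eq hN hP hT, LinearMap.sub_apply, LinearMap.sum_apply, LinearMap.add_apply,
    LinearMap.compl₁₂_apply, matFormₗ, LinearMap.mk₂_apply]

lemma exists_bilin_formM0 (hP : P.IsAdmissible H γ Cd) (hT : T.IsCausal P cHat) :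
    ∃ b : V P p →ₗ[ℝ] V P p →ₗ[ℝ] ℝ, ∀ w v, formM0 H T w v = b w v := by
  refine ⟨∑ K : P.mesh.patch P.vertex, (matFormₗ (compactlyCarried_hull (K : Finset (Space N)))
    (isMatWeight_const (massMatrix H T K))).compl₁₂ (polyAt K) (polyAt K), fun w v => ?_⟩
  rw [formM0_eq hP hT]
  simp only [LinearMap.sum_apply, LinearMap.compl₁₂_apply, matFormₗ, LinearMap.mk₂_apply]

lemma exists_bilin_formM1 (hP : P.IsAdmissible H γ Cd) (hT : T.IsCausal P cHat) :
    ∃ b : V P p →ₗ[ℝ] V P p →ₗ[ℝ] ℝ, ∀ w v, formM1 H T w v = b w v := by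
  refine ⟨∑ K : P.mesh.patch P.vertex, (matFormₗ (compactlyCarried_hull (K : Finset (Space N)))
    (isMatWeight_const (tentMatrix H T K))).compl₁₂ (polyAt K) (polyAt K), fun w v => ?_⟩
  rw [formM1_eq hP hT]
  simp only [LinearMap.sum_apply, LinearMap.compl₁₂_apply, matFormₗ, LinearMap.mk₂_apply]

lemma exists_bilin_ip :
    ∃ b : V P p →ₗ[ℝ] V P p →ₗ[ℝ] ℝ, ∀ w v, ip w v = b w v := by
  refine ⟨∑ K : P.mesh.patch P.vertex, (matFormₗ (compactlyCarried_hull (K : Finset (Space N)))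
    (isMatWeight_const 1)).compl₁₂ (polyAt K) (polyAt K), fun w v => ?_⟩
  rw [ip_eq]
  simp only [LinearMap.sum_apply, LinearMap.compl₁₂_apply, matFormₗ, LinearMap.mk₂_apply]

lemma ip_comm (w v : V P p) : ip w v = ip v w := by
  simp only [ip]
  simp_rw [dotProduct_comm]

lemma ip_pos {w : V P p} (hw : w ≠ 0) : 0 < ip w w := by
  rw [ip_self]
  obtain ⟨K, hK⟩ := Function.ne_iff.1 hw
  obtain ⟨l, hl⟩ := Function.ne_iff.1 hK
  refine Finset.sum_pos' (fun K _ => elemSq_nonneg K w) ⟨K, Finset.mem_univ _, ?_⟩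
  refine Finset.sum_pos' (fun k _ => integral_nonneg fun x => by positivity)
    ⟨l, Finset.mem_univ _, ?_⟩
  simp only [one_mul, sq]
  refine ev_sq_integral_pos (fun h0 => hl (Subtype.ext h0)) (isCompact_hull _) ?_
  exact ⟨_, (patch_isSimplex K).barycenter_mem_interior⟩

lemma formM0_comm (hH : H.IsAdmissible) (hP : P.IsAdmissible H γ Cd) (hT : T.IsCausal P cHat)
    (w v : V P p) : formM0 H T w v = formM0 H T v w := by
  rw [formM0_eq hP hT, formM0_eq hP hT]
  refine Finset.sum_congr rfl fun K _ => matForm_comm (ae_of_all _ fun x => ?_) _ _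
  have hx := barycenter_mem hH hP (elem_mem K)
  rw [Matrix.IsSymm, massMatrix, Matrix.transpose_sub, hH.symm_G _ hx, Matrix.transpose_sum]
  congr 1
  refine Finset.sum_congr rfl fun j _ => ?_
  rw [Matrix.transpose_smul, hH.symm_A j _ hx]

lemma formM1_comm (hH : H.IsAdmissible) (hP : P.IsAdmissible H γ Cd) (hT : T.IsCausal P cHat)
    (w v : V P p) : formM1 H T w v = formM1 H T v w := by
  rw [formM1_eq hP hT, formM1_eq hP hT]
  refine Finset.sum_congr rfl fun K _ => matForm_comm (ae_of_all _ fun x => ?_) _ _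
  have hx := barycenter_mem hH hP (elem_mem K)
  rw [Matrix.IsSymm, tentMatrix, Matrix.transpose_sum]
  refine Finset.sum_congr rfl fun j _ => ?_
  rw [Matrix.transpose_smul, hH.symm_A j _ hx]

end Forms

/-! ### Mesh-independent bounds of the forms -/

section Bounds

variable {N L p : ℕ} {H : HyperbolicSystem N L}

lemma sqNorm_smul {μ : Measure (Space N)} {ω : Space N → ℝ} (c : ℝ)
    (y : Fin L → MvPolynomial (Fin N) ℝ) : sqNorm μ ω (c • y) = c ^ 2 * sqNorm μ ω y := by
  rw [sqNorm, sqNorm, Finset.mul_sum]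
  refine Finset.sum_congr rfl fun k _ => ?_
  rw [← integral_const_mul]
  congr 1
  ext x
  simp only [Pi.smul_apply, ev_smul]
  ring

lemma elem_regular {P : DGPatch N L} {γ Cd : ℝ} (hP : P.IsAdmissible H γ Cd)
    (K : P.mesh.patch P.vertex) : ∃ x, Metric.closedBall x
      (Metric.diam (hull (K : Finset (Space N))) / γ) ⊆ hull (K : Finset (Space N)) :=
  hP.mesh_Ω.regular K (elem_mem K)

lemma totalDegree_polyAt {P : DGPatch N L} (K : P.mesh.patch P.vertex) (w : V P p) (l : Fin L) :
    (polyAt K w l).totalDegree ≤ p :=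
  (MvPolynomial.mem_restrictTotalDegree _ _ _).1 (w K l).2

/-- The uniform boundedness of `M_1`. -/
lemma exists_abs_formM1_le (p : ℕ) (hH : H.IsAdmissible) (γ Cd cHat : ℝ) : ∃ C : ℝ, 0 ≤ C ∧
    ∀ (P : DGPatch N L) (T : Tent N), P.IsAdmissible H γ Cd → T.IsCausal P cHat →
      ∀ w v : V P p, |formM1 H T w v| ≤ C * (ip w w + ip v v) := by
  obtain ⟨c, hc⟩ := hH.bounded_A
  refine ⟨N * (2 * |1 / cHat| * |c|) * L / 2, by positivity, fun P T hP hT w v => ?_⟩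
  rw [formM1_eq hP hT, ip_self, ip_self, ← Finset.sum_add_distrib, Finset.mul_sum]
  refine (Finset.abs_sum_le_sum_abs _ _).trans (Finset.sum_le_sum fun K _ => ?_)
  refine abs_matForm_le (compactlyCarried_hull _) (isWeight_const 1) (ae_of_all _ fun x l k => ?_)
    _ _
  rw [mul_one, tentMatrix, Matrix.sum_apply]
  refine (Finset.abs_sum_le_sum_abs _ _).trans ?_
  refine (Finset.sum_le_sum (g := fun _ => 2 * |1 / cHat| * |c|) fun j _ => ?_).trans (by simp)
  rw [Matrix.smul_apply, smul_eq_mul, abs_mul]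
  refine mul_le_mul ?_ ((hc j _ (barycenter_mem hH hP (elem_mem K)) l k).trans (le_abs_self c))
    (abs_nonneg _) (by positivity)
  refine (PiLp.norm_apply_le (slope T.δ K) j).trans ((norm_slope_δ_le hT K).trans ?_)
  calc 2 / cHat = 2 * (1 / cHat) := by ring
    _ ≤ _ := by gcongr; exact le_abs_self _

/-- The uniform positivity of `M(t)`. -/
lemma exists_coercive (p : ℕ) (hL : 0 < L) (hH : H.IsAdmissible) (γ Cd : ℝ) {cHat : ℝ}
    (hc : H.waveSpeed < cHat) : ∃ θ : ℝ, 0 < θ ∧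
    ∀ (P : DGPatch N L) (T : Tent N), P.IsAdmissible H γ Cd → T.IsCausal P cHat →
      ∀ t : ℝ, 0 ≤ t → t ≤ 1 → ∀ w : V P p,
        θ * ip w w ≤ formM0 H T w w - t * formM1 H T w w := by
  obtain ⟨θ, hθ, hcoer⟩ := exists_mass_coercive hH hL hc
  refine ⟨θ, hθ, fun P T hP hT t ht0 ht1 w => ?_⟩
  rw [formM0_eq hP hT, formM1_eq hP hT, Finset.mul_sum, ← Finset.sum_sub_distrib, ip_eq,
    Finset.mul_sum]
  refine Finset.sum_le_sum fun K _ => ?_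
  have hμ := compactlyCarried_hull (K : Finset (Space N))
  rw [← matForm_const_smul, ← matForm_const_smul, matForm, matForm, matForm, ← integral_sub
    ((isMatWeight_const _).integrable_form hμ _ _) ((isMatWeight_const _).integrable_form hμ _ _)]
  refine integral_mono ((isMatWeight_const _).integrable_form hμ _ _)
    (((isMatWeight_const _).integrable_form hμ _ _).sub
      ((isMatWeight_const _).integrable_form hμ _ _)) fun x => ?_
  set y : Fin L → ℝ := fun k => ev (polyAt K w k) x
  -- The slope at pseudotime `t` is a convex combination of the slopes of bottom and top, so the
  -- intermediate fronts are causal too.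
  have hβ : ‖slope T.bot K + t • slope T.δ K‖ ≤ 1 / cHat := by
    have h1 : slope T.bot K + t • slope T.δ K = (1 - t) • slope T.bot K + t • slope T.top K := by
      rw [slope_δ hT]; module
    rw [h1]
    refine (norm_add_le _ _).trans ?_
    rw [norm_smul, norm_smul, Real.norm_of_nonneg ht0, Real.norm_of_nonneg (by linarith)]
    have h2 := norm_slope_bot_le hT K
    have h3 := norm_slope_top_le hT K
    nlinarith [mul_le_mul_of_nonneg_left h2 (by linarith : 0 ≤ 1 - t),
      mul_le_mul_of_nonneg_left h3 ht0]
  have h4 := hcoer _ (barycenter_mem hH hP (elem_mem K)) _ hβ y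
  have h5 : H.G (barycenter K) -
      ∑ j, (slope T.bot K + t • slope T.δ K) j • H.A j (barycenter (K : Finset (Space N))) =
      massMatrix H T K - t • tentMatrix H T K := by
    rw [massMatrix, tentMatrix, Finset.smul_sum, sub_sub, ← Finset.sum_add_distrib]
    congr 1
    refine Finset.sum_congr rfl fun j _ => ?_
    rw [PiLp.add_apply, PiLp.smul_apply, add_smul, smul_eq_mul, mul_smul]
  rw [h5, Matrix.sub_mulVec, sub_dotProduct] at h4
  rwa [Matrix.smul_mulVec, smul_dotProduct, Matrix.one_mulVec]

/-- The square norm on a facet, weighted with `δ`. -/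
def faceSq {P : DGPatch N L} (T : Tent N) (i : PatchFacet P) (w : V P p) : ℝ :=
  sqNorm i.measure T.δ (polyAt i.1 w)

/-- The trace inequality loses a factor `1/diam K`, which the weight `δ` restores. -/
lemma exists_faceSq_le (L p : ℕ) (hN : 0 < N) {γ cHat : ℝ} (hγ : 0 < γ) (hc : 0 < cHat) :
    ∃ C : ℝ, 0 ≤ C ∧ ∀ (H : HyperbolicSystem N L) (Cd : ℝ) (P : DGPatch N L) (T : Tent N),
      P.IsAdmissible H γ Cd → T.IsCausal P cHat → ∀ (i : PatchFacet P) (w : V P p),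
        faceSq T i w ≤ C * elemSq i.1 w := by
  obtain ⟨C, hC, htr⟩ := exists_trace_simplex N p hN hγ
  refine ⟨2 / cHat * C, by positivity, fun H Cd P T hP hT i w => ?_⟩
  rw [faceSq, elemSq, sqNorm, sqNorm, Finset.mul_sum]
  refine Finset.sum_le_sum fun k _ => ?_
  have h1 := htr i.1 (patch_isSimplex i.1) (elem_regular hP i.1) _ (totalDegree_polyAt i.1 w k) _
    i.2.2
  have hμ := i.carried hN
  simp only [one_mul]
  calc ∫ x, T.δ x * ev (polyAt i.1 w k) x ^ 2 ∂i.measure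
      ≤ ∫ x, (2 / cHat * Metric.diam (hull (i.1 : Finset (Space N)))) *
          ev (polyAt i.1 w k) x ^ 2 ∂i.measure := by
        have hw := hμ.isWeight ((continuous_ev (polyAt i.1 w k)).pow 2)
        refine integral_mono_ae (hμ.integrable ((isWeight_δ hT i.1 hμ i.ae_mem_hull).mul hw))
          (hμ.integrable ((isWeight_const _).mul hw)) ?_
        filter_upwards [i.ae_mem_hull] with x hx
        exact mul_le_mul_of_nonneg_right (δ_le hT i.1 hN hx) (sq_nonneg _)
    _ = 2 / cHat * (Metric.diam (hull (i.1 : Finset (Space N))) *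
          facetIntegral i.1 i.2 fun x => ev (polyAt i.1 w k) x ^ 2) := by
        rw [integral_const_mul, mul_assoc]; rfl
    _ ≤ 2 / cHat * (C * ∫ x in hull (i.1 : Finset (Space N)), ev (polyAt i.1 w k) x ^ 2) := by
        gcongr
    _ = _ := by ring

lemma sum_faceSq_le {P : DGPatch N L} {T : Tent N} {C : ℝ} {w : V P p}
    (h : ∀ i : PatchFacet P, faceSq T i w ≤ C * elemSq i.1 w) :
    ∑ i : PatchFacet P, faceSq T i w ≤ (N + 1) * C * ip w w := by
  refine (Finset.sum_le_sum fun i _ => h i).trans ?_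
  rw [Fintype.sum_sigma, ip_self, Finset.mul_sum]
  refine Finset.sum_le_sum fun K _ => ?_
  simp only [Finset.sum_const, Finset.card_univ, Fintype.card_coe, (patch_isSimplex K).card,
    nsmul_eq_mul]
  push_cast
  linarith

lemma sqNorm_neighbour {P : DGPatch N L} (T : Tent N) (i : PatchFacet P) (w : V P p) :
    sqNorm i.measure T.δ (polyAt i.opposite.1 w) = faceSq T i.opposite w := by
  rw [faceSq, PatchFacet.measure_opposite]

lemma abs_fluxTerm_le (hN : 0 < N) (hH : H.IsAdmissible) {γ Cd cHat : ℝ} {P : DGPatch N L}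
    {T : Tent N} (hP : P.IsAdmissible H γ Cd) (hT : T.IsCausal P cHat) {cA : ℝ}
    (hcA : ∀ j, ∀ x ∈ H.Ω, ∀ l k, |H.A j x l k| ≤ cA) (i : PatchFacet P) (w v : V P p) :
    |fluxTerm H T i w v| ≤ (N * cA + |Cd|) * L / 2 *
      (faceSq T i w + faceSq T i.opposite w + 2 * faceSq T i v) := by
  have hδw := isWeight_δ hT i.1 (i.carried hN) i.ae_mem_hull
  have hD := abs_bdryMatrix_le hN hH hP hcA i
  have hD0 : ∀ l k : Fin L, 0 ≤ N * cA := fun l k => (abs_nonneg _).trans (hD l k)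
  have hhalf : ∀ l k, |(1 / 2 : ℝ) * bdryMatrix H i.1 i.2 l k| ≤ N * cA := by
    intro l k
    rw [abs_mul, abs_of_pos (by norm_num : (0 : ℝ) < 1 / 2)]
    linarith [hD l k, hD0 l k]
  have hself : ∀ᵐ x ∂i.measure, ∀ l k,
      |(T.δ x • selfMatrix H i x) l k| ≤ (N * cA + |Cd|) * T.δ x := by
    by_cases hi : P.mesh.IsBoundaryFacet i.face
    · filter_upwards [ae_abs_B_le hP i hi, i.ae_mem_hull] with x hx hxK l k
      rw [selfMatrix, if_pos hi, Matrix.smul_apply, smul_eq_mul, abs_mul,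
        abs_of_nonneg (δ_nonneg hT i.1 hxK), mul_comm]
      refine mul_le_mul_of_nonneg_right ?_ (δ_nonneg hT i.1 hxK)
      rw [Matrix.smul_apply, Matrix.add_apply, smul_eq_mul, mul_add]
      refine (abs_add_le _ _).trans (add_le_add (hhalf l k) ?_)
      rw [abs_mul, abs_of_pos (by norm_num : (0 : ℝ) < 1 / 2)]
      linarith [hx l k, abs_nonneg (P.B x l k)]
    · filter_upwards [ae_abs_S_le hP i hi, i.ae_mem_hull] with x hx hxK l k
      rw [selfMatrix, if_neg hi, Matrix.smul_apply, smul_eq_mul, abs_mul,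
        abs_of_nonneg (δ_nonneg hT i.1 hxK), mul_comm]
      refine mul_le_mul_of_nonneg_right ?_ (δ_nonneg hT i.1 hxK)
      rw [Matrix.add_apply, Matrix.smul_apply, smul_eq_mul]
      exact (abs_add_le _ _).trans (add_le_add (hhalf l k) (hx l k))
  have hother : ∀ᵐ x ∂i.measure, ∀ l k,
      |(T.δ x • otherMatrix H i x) l k| ≤ (N * cA + |Cd|) * T.δ x := by
    by_cases hi : P.mesh.IsBoundaryFacet i.face
    · filter_upwards [i.ae_mem_hull] with x hxK l k
      rw [otherMatrix, if_pos hi, smul_zero, Matrix.zero_apply, abs_zero]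
      exact mul_nonneg (add_nonneg (hD0 l k) (abs_nonneg _)) (δ_nonneg hT i.1 hxK)
    · filter_upwards [ae_abs_S_le hP i hi, i.ae_mem_hull] with x hx hxK l k
      rw [otherMatrix, if_neg hi, Matrix.smul_apply, smul_eq_mul, abs_mul,
        abs_of_nonneg (δ_nonneg hT i.1 hxK), mul_comm]
      refine mul_le_mul_of_nonneg_right ?_ (δ_nonneg hT i.1 hxK)
      rw [Matrix.add_apply, Matrix.smul_apply, Matrix.smul_apply, smul_eq_mul, smul_eq_mul,
        neg_one_mul]
      refine (abs_add_le _ _).trans (add_le_add (hhalf l k) ?_)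
      rw [abs_neg]
      exact hx l k
  rw [fluxTerm_eq hN hP hT]
  have h1 := abs_matForm_le (i.carried hN) hδw hself (polyAt i.1 w) (polyAt i.1 v)
  have h2 := abs_matForm_le (i.carried hN) hδw hother (polyAt i.opposite.1 w) (polyAt i.1 v)
  rw [sqNorm_neighbour] at h2
  refine (abs_add_le _ _).trans ((add_le_add h1 h2).trans (le_of_eq ?_))
  simp only [faceSq]
  ring

/-- The uniform boundedness of the form `a`. -/
lemma exists_abs_formA_le (p : ℕ) (hN : 0 < N) (hH : H.IsAdmissible) {γ cHat : ℝ} (Cd : ℝ)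
    (hγ : 0 < γ) (hc : 0 < cHat) : ∃ C : ℝ, 0 ≤ C ∧
    ∀ (P : DGPatch N L) (T : Tent N), P.IsAdmissible H γ Cd → T.IsCausal P cHat →
      ∀ w v : V P p, |formA H T w v| ≤ C * (ip w w + ip v v) := by
  obtain ⟨c, hc0, hcA⟩ : ∃ c : ℝ, 0 ≤ c ∧ ∀ j, ∀ x ∈ H.Ω, ∀ l k, |H.A j x l k| ≤ c := by
    obtain ⟨c, hc⟩ := hH.bounded_A
    exact ⟨|c|, abs_nonneg _, fun j x hx l k => (hc j x hx l k).trans (le_abs_self c)⟩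
  obtain ⟨C₁, hC₁, hinv⟩ := exists_inverse_simplex N p hN hγ
  obtain ⟨C₂, hC₂, hface⟩ := exists_faceSq_le L p hN hγ hc
  set κ := N * (2 / cHat * c * L / 2) * (1 + C₁) with hκ
  set κ' := (N * c + |Cd|) * L / 2 * (2 * ((N + 1) * C₂)) with hκ'
  refine ⟨κ + κ', by positivity, fun P T hP hT w v => ?_⟩
  have hw0 : 0 ≤ ip w w := by rw [ip_self]; exact Finset.sum_nonneg fun K _ => elemSq_nonneg K w
  have hv0 : 0 ≤ ip v v := by rw [ip_self]; exact Finset.sum_nonneg fun K _ => elemSq_nonneg K v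
  have hvol : ∀ (K : P.mesh.patch P.vertex) (j : Fin N),
      |matForm (volume.restrict (hull (K : Finset (Space N))))
        (fun x => T.δ x • H.A j (barycenter K)) (polyAt K w) (derivAt j K v)| ≤
      2 / cHat * c * L / 2 * ((1 + C₁) * (elemSq K w + elemSq K v)) := by
    intro K j
    set d := Metric.diam (hull (K : Finset (Space N))) with hd
    have hd0 : 0 < d := (patch_isSimplex K).diam_pos hN
    have hμ := compactlyCarried_hull (K : Finset (Space N))
    have hmem : ∀ᵐ x ∂(volume.restrict (hull (K : Finset (Space N)))),
        x ∈ hull (K : Finset (Space N)) :=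
      ae_restrict_mem (isCompact_hull _).isClosed.measurableSet
    have hW : IsMatWeight (volume.restrict (hull (K : Finset (Space N))))
        fun x => T.δ x • H.A j (barycenter K) :=
      (isMatWeight_const _).smul (isWeight_δ hT K hμ hmem)
    -- A factor `d = diam K` is moved from the weight to the derivative: `δ/d` is bounded, and `d
    -- ∂_j v` is controlled by the inverse inequality.
    have h1 : matForm (volume.restrict (hull (K : Finset (Space N))))
        (fun x => T.δ x • H.A j (barycenter K)) (polyAt K w) (derivAt j K v) =
        matForm (volume.restrict (hull (K : Finset (Space N))))
        (fun x => d⁻¹ • (T.δ x • H.A j (barycenter K))) (polyAt K w) (d • derivAt j K v) := by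
      have h2 := (matFormₗ hμ hW (polyAt K w)).map_smul d (derivAt j K v)
      simp only [matFormₗ, LinearMap.mk₂_apply, smul_eq_mul] at h2
      rw [matForm_const_smul, h2, inv_mul_cancel_left₀ hd0.ne']
    have h3 : ∀ᵐ x ∂(volume.restrict (hull (K : Finset (Space N)))), ∀ l k,
        |(d⁻¹ • (T.δ x • H.A j (barycenter (K : Finset (Space N))))) l k| ≤ 2 / cHat * c * 1 := by
      filter_upwards [hmem] with x hx l k
      have h4 := δ_le hT K hN hx
      have h5 := δ_nonneg hT K hx
      rw [Matrix.smul_apply, Matrix.smul_apply, smul_eq_mul, smul_eq_mul, abs_mul, abs_mul,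
        abs_of_pos (inv_pos.2 hd0), abs_of_nonneg h5, mul_one, ← mul_assoc]
      refine mul_le_mul ?_ (hcA j _ (barycenter_mem hH hP (elem_mem K)) l k) (abs_nonneg _)
        (by positivity)
      rw [inv_mul_le_iff₀ hd0]
      linarith
    rw [h1]
    refine (abs_matForm_le hμ (isWeight_const 1) h3 _ _).trans ?_
    refine mul_le_mul_of_nonneg_left ?_ (by positivity)
    have h6 : sqNorm (volume.restrict (hull (K : Finset (Space N)))) (fun _ => 1)
        (d • derivAt j K v) ≤ C₁ * elemSq K v := by
      rw [sqNorm_smul, elemSq, sqNorm, sqNorm, Finset.mul_sum, Finset.mul_sum]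
      refine Finset.sum_le_sum fun k _ => ?_
      simp only [one_mul]
      exact hinv K (patch_isSimplex K) (elem_regular hP K) _ (totalDegree_polyAt K v k) j
    have h7 := elemSq_nonneg K w
    have h8 := elemSq_nonneg K v
    change elemSq K w + _ ≤ _
    nlinarith
  rw [formA_eq_sub hP]
  have h9 : |∑ K : P.mesh.patch P.vertex, ∑ j,
      matForm (volume.restrict (hull (K : Finset (Space N))))
        (fun x => T.δ x • H.A j (barycenter K)) (polyAt K w) (derivAt j K v)| ≤
      κ * (ip w w + ip v v) := by
    rw [ip_self, ip_self, ← Finset.sum_add_distrib, Finset.mul_sum]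
    refine (Finset.abs_sum_le_sum_abs _ _).trans (Finset.sum_le_sum fun K _ => ?_)
    refine (Finset.abs_sum_le_sum_abs _ _).trans
      ((Finset.sum_le_sum fun j _ => hvol K j).trans (le_of_eq ?_))
    simp only [Finset.sum_const, Finset.card_univ, Fintype.card_fin, nsmul_eq_mul, hκ]
    ring
  have h10 : |∑ i : PatchFacet P, fluxTerm H T i w v| ≤ κ' * (ip w w + ip v v) := by
    refine (Finset.abs_sum_le_sum_abs _ _).trans
      ((Finset.sum_le_sum fun i _ => abs_fluxTerm_le hN hH hP hT hcA i w v).trans ?_)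
    rw [← Finset.mul_sum, Finset.sum_add_distrib, Finset.sum_add_distrib, ← Finset.mul_sum,
      PatchFacet.sum_opposite hN fun i => faceSq T i w]
    have h11 := sum_faceSq_le fun i => hface H Cd P T hP hT i w
    have h12 := sum_faceSq_le fun i => hface H Cd P T hP hT i v
    rw [hκ', mul_assoc ((N * c + |Cd|) * L / 2)]
    refine mul_le_mul_of_nonneg_left ?_ (by positivity)
    linarith
  refine (abs_sub _ _).trans ?_
  linarith

end Bounds

/-! ### Dissipativity of the discontinuous Galerkin form -/

section Dissipation

variable {N L p : ℕ} {H : HyperbolicSystem N L} {P : DGPatch N L} {γ Cd cHat : ℝ} {T : Tent N}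

/-- The polynomial `x ↦ ⟪s, x⟫ + c`. -/
def affPoly (s : Space N) (c : ℝ) : MvPolynomial (Fin N) ℝ :=
  ∑ i, MvPolynomial.C (s i) * MvPolynomial.X i + MvPolynomial.C c

lemma ev_affPoly (s : Space N) (c : ℝ) (x : Space N) : ev (affPoly s c) x = ⟪s, x⟫ + c := by
  simp [ev, affPoly, PiLp.inner_apply, mul_comm]

lemma pderiv_affPoly (s : Space N) (c : ℝ) (j : Fin N) :
    MvPolynomial.pderiv j (affPoly s c) = MvPolynomial.C (s j) := by
  simp [affPoly, MvPolynomial.pderiv_X, Pi.single_apply, Derivation.leibniz]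

/-- The polynomial `(M y) · y`. -/
def quadPoly (M : Matrix (Fin L) (Fin L) ℝ) (y : Fin L → MvPolynomial (Fin N) ℝ) :
    MvPolynomial (Fin N) ℝ :=
  ∑ l, (∑ k, MvPolynomial.C (M l k) * y k) * y l

lemma ev_quadPoly (M : Matrix (Fin L) (Fin L) ℝ) (y : Fin L → MvPolynomial (Fin N) ℝ)
    (x : Space N) :
    ev (quadPoly M y) x = (M *ᵥ fun k => ev (y k) x) ⬝ᵥ fun l => ev (y l) x := by
  simp [ev, quadPoly, dotProduct, Matrix.mulVec]

lemma ev_pderiv_quadPoly {M : Matrix (Fin L) (Fin L) ℝ} (hM : M.IsSymm)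
    (y : Fin L → MvPolynomial (Fin N) ℝ) (j : Fin N) (x : Space N) :
    ev (MvPolynomial.pderiv j (quadPoly M y)) x =
      2 * ((M *ᵥ fun k => ev (y k) x) ⬝ᵥ fun l => ev (MvPolynomial.pderiv j (y l)) x) := by
  have h1 : ev (MvPolynomial.pderiv j (quadPoly M y)) x =
      (M *ᵥ fun k => ev (y k) x) ⬝ᵥ (fun l => ev (MvPolynomial.pderiv j (y l)) x) +
      (M *ᵥ fun k => ev (MvPolynomial.pderiv j (y k)) x) ⬝ᵥ fun l => ev (y l) x := by
    simp [ev, quadPoly, dotProduct, Matrix.mulVec, Derivation.leibniz, Finset.sum_add_distrib]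
    exact Finset.sum_congr rfl fun l _ => mul_comm _ _
  rw [h1, two_mul]
  congr 1
  rw [dotProduct_comm, Matrix.dotProduct_mulVec, ← Matrix.mulVec_transpose, hM]

/-- The divergence theorem for the polynomials `(⟪s, x⟫ + c) (A_j y) · y`, summed over `j`; the
factor `2` uses the symmetry of `A_j`. With the affine formula for `δ`, the left side is the volume
part of `2 A_h + M_1`. -/
lemma IsSimplex.sum_matForm_eq {K : Finset (Space N)} (h : IsSimplex K) (hN : 0 < N)
    {A : Fin N → Matrix (Fin L) (Fin L) ℝ} (hA : ∀ j, (A j).IsSymm) (s : Space N) (c : ℝ)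
    (y : Fin L → MvPolynomial (Fin N) ℝ) :
    2 * (∑ j, matForm (volume.restrict (hull K)) (fun x => (⟪s, x⟫ + c) • A j) y
        fun l => MvPolynomial.pderiv j (y l)) +
      matForm (volume.restrict (hull K)) (fun _ => ∑ j, s j • A j) y y =
    ∑ a ∈ K, matForm (facetMeasure K a)
      (fun x => (⟪s, x⟫ + c) • ∑ j, normal K a j • A j) y y := by
  have hcont : Continuous fun x : Space N => ⟪s, x⟫ + c := by fun_prop
  have hμ := compactlyCarried_hull K
  have hvol : ∀ j, ∫ x in hull K,
      fderiv ℝ (ev (affPoly s c * quadPoly (A j) y)) x (EuclideanSpace.single j 1) =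
      2 * matForm (volume.restrict (hull K)) (fun x => (⟪s, x⟫ + c) • A j) y
        (fun l => MvPolynomial.pderiv j (y l)) +
      matForm (volume.restrict (hull K)) (fun _ => s j • A j) y y := by
    intro j
    rw [matForm, matForm, ← integral_const_mul, ← integral_add
      ((((isMatWeight_const _).smul (hμ.isWeight hcont)).integrable_form hμ _ _).const_mul _)
      ((isMatWeight_const _).integrable_form hμ _ _)]
    refine integral_congr_ae (ae_of_all _ fun x => ?_)
    have h1 : ∀ q r : MvPolynomial (Fin N) ℝ, ev (q * r) x = ev q x * ev r x := by simp [ev]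
    simp only [fderiv_ev_single, Derivation.leibniz, smul_eq_mul, ev_add, h1,
      ev_pderiv_quadPoly (hA j), pderiv_affPoly, ev_affPoly, ev_quadPoly, Matrix.smul_mulVec,
      smul_dotProduct]
    have h2 : ev (MvPolynomial.C (s j)) x = s j := by simp [ev]
    rw [h2]
    ring
  have hdiv := fun j => h.integral_fderiv hN (contDiff_ev (affPoly s c * quadPoly (A j) y))
    (EuclideanSpace.single j 1)
  have hsum : matForm (volume.restrict (hull K)) (fun _ => ∑ j, s j • A j) y y =
      ∑ j, matForm (volume.restrict (hull K)) (fun _ => s j • A j) y y := by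
    simp only [matForm]
    rw [← integral_finsetSum _ fun j _ => (isMatWeight_const _).integrable_form hμ _ _]
    simp only [Matrix.sum_mulVec, sum_dotProduct]
  rw [hsum, Finset.mul_sum, ← Finset.sum_add_distrib]
  simp_rw [← hvol, hdiv]
  rw [Finset.sum_comm]
  refine Finset.sum_congr rfl fun a ha => ?_
  have hμa := h.compactlyCarried_facet hN ha
  have h3 : ∀ j, ⟪normal K a, EuclideanSpace.single j 1⟫ *
      facetIntegral K a (ev (affPoly s c * quadPoly (A j) y)) =
      ∫ x, ((((⟪s, x⟫ + c) • normal K a j • A j) *ᵥ fun k => ev (y k) x) ⬝ᵥ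
        fun l => ev (y l) x) ∂(facetMeasure K a) := by
    intro j
    change _ * ∫ x, _ ∂(facetMeasure K a) = _
    rw [← integral_const_mul]
    refine integral_congr_ae (ae_of_all _ fun x => ?_)
    have h1 : ∀ q r : MvPolynomial (Fin N) ℝ, ev (q * r) x = ev q x * ev r x := by simp [ev]
    simp only [h1, ev_affPoly, ev_quadPoly, Matrix.smul_mulVec, smul_dotProduct, smul_eq_mul,
      EuclideanSpace.inner_single_right]
    simp
    ring
  simp_rw [h3]
  rw [matForm, ← integral_finsetSum _ fun j _ => ((isMatWeight_const _).smul
    (hμa.isWeight hcont)).integrable_form hμa _ _]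
  simp only [Finset.smul_sum, Matrix.sum_mulVec, sum_dotProduct]

/-- The contribution of a facet to the dissipation. -/
def dissTerm (H : HyperbolicSystem N L) (T : Tent N) (i : PatchFacet P) (w : V P p) : ℝ :=
  2 * fluxTerm H T i w w -
    matForm i.measure (fun x => T.δ x • bdryMatrix H i.1 i.2) (polyAt i.1 w) (polyAt i.1 w)

lemma A_symm (hH : H.IsAdmissible) (hP : P.IsAdmissible H γ Cd) (K : P.mesh.patch P.vertex)
    (j : Fin N) : (H.A j (barycenter (K : Finset (Space N)))).IsSymm :=
  hH.symm_A j _ (barycenter_mem hH hP (elem_mem K))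

lemma diss_eq_sum (hN : 0 < N) (hH : H.IsAdmissible) (hP : P.IsAdmissible H γ Cd)
    (hT : T.IsCausal P cHat) (w : V P p) :
    -(2 * formA H T w w + formM1 H T w w) = ∑ i : PatchFacet P, dissTerm H T i w := by
  have h1 : ∀ K : P.mesh.patch P.vertex,
      2 * (∑ j, matForm (volume.restrict (hull (K : Finset (Space N))))
        (fun x => T.δ x • H.A j (barycenter K)) (polyAt K w) (derivAt j K w)) +
      matForm (volume.restrict (hull (K : Finset (Space N)))) (fun _ => tentMatrix H T K)
        (polyAt K w) (polyAt K w) =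
      ∑ a : (K : Finset (Space N)), matForm (facetMeasure (K : Finset (Space N)) a)
        (fun x => T.δ x • bdryMatrix H K a) (polyAt K w) (polyAt K w) := by
    intro K
    obtain ⟨c, hc⟩ := exists_eq_inner_slope (patch_isSimplex K) (affine_δ hT K)
    have h2 := (patch_isSimplex K).sum_matForm_eq hN (A_symm hH hP K) (slope T.δ K) c
      (polyAt K w)
    rw [Finset.sum_coe_sort (K : Finset (Space N)) fun a =>
      matForm (facetMeasure (K : Finset (Space N)) a)
        (fun x => T.δ x • bdryMatrix H K a) (polyAt K w) (polyAt K w)]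
    refine Eq.trans ?_ (h2.trans ?_)
    · congr 2
      refine Finset.sum_congr rfl fun j _ => ?_
      refine matForm_congr ?_ _ _
      filter_upwards [ae_restrict_mem (isCompact_hull _).isClosed.measurableSet] with x hx
      rw [hc x hx]
    · refine Finset.sum_congr rfl fun a ha => ?_
      refine matForm_congr ?_ _ _
      filter_upwards [PatchFacet.ae_mem_hull (⟨K, ⟨a, ha⟩⟩ : PatchFacet P)] with x hx
      rw [hc x hx, bdryMatrix]
  rw [formA_eq_sub hP, formM1_eq hP hT]
  simp only [dissTerm]
  rw [Finset.sum_sub_distrib, ← Finset.mul_sum, Fintype.sum_sigma fun i : PatchFacet P =>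
    matForm i.measure (fun x => T.δ x • bdryMatrix H i.1 i.2) (polyAt i.1 w) (polyAt i.1 w)]
  have h3 := Finset.sum_congr (s₁ := Finset.univ) rfl fun K _ => h1 K
  rw [Finset.sum_add_distrib, ← Finset.mul_sum] at h3
  simp only [PatchFacet.measure]
  linarith

lemma matForm_sub_sub {μ : Measure (Space N)} (hμ : CompactlyCarried μ)
    {W : Space N → Matrix (Fin L) (Fin L) ℝ} (hW : IsMatWeight μ W)
    (y z : Fin L → MvPolynomial (Fin N) ℝ) :
    matForm μ W (y - z) (y - z) =
      matForm μ W y y - matForm μ W y z - matForm μ W z y + matForm μ W z z := by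
  have h1 : ∀ y z, matForm μ W y z = matFormₗ hμ hW y z := fun _ _ => rfl
  simp only [h1, map_sub, LinearMap.sub_apply]
  ring

/-- Twice the flux is `D + B`, the divergence theorem removes `D`, and `B` remains. -/
lemma dissTerm_boundary_nonneg (hN : 0 < N) (hP : P.IsAdmissible H γ Cd) (hT : T.IsCausal P cHat)
    (i : PatchFacet P) (hi : P.mesh.IsBoundaryFacet i.face) (w : V P p) :
    0 ≤ dissTerm H T i w := by
  have hμ := i.carried hN
  have hB := isMatWeight_δ_smul hN hT i (isMatWeight_B hP i hi)
  have hD := isMatWeight_δ_smul hN hT i (isMatWeight_const (bdryMatrix H i.1 i.2))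
  have h1 : fluxTerm H T i w w = 1 / 2 * (matForm i.measure
      (fun x => T.δ x • bdryMatrix H i.1 i.2) (polyAt i.1 w) (polyAt i.1 w) +
      matForm i.measure (fun x => T.δ x • P.B x) (polyAt i.1 w) (polyAt i.1 w)) := by
    rw [fluxTerm_eq hN hP hT, ← matForm_add hμ hD hB, ← matForm_const_smul]
    have h2 : matForm i.measure (fun x => T.δ x • otherMatrix H i x) (polyAt i.opposite.1 w)
        (polyAt i.1 w) = 0 := by
      simp [otherMatrix, if_pos hi, matForm]
    rw [h2, add_zero]
    refine matForm_congr (ae_of_all _ fun x => ?_) _ _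
    rw [selfMatrix, if_pos hi]
    module
  have h3 : 0 ≤ matForm i.measure (fun x => T.δ x • P.B x) (polyAt i.1 w) (polyAt i.1 w) := by
    refine matForm_nonneg ?_ _
    filter_upwards [hP.B_nonneg i.1 (elem_mem i.1) i.2 i.2.2 hi, i.ae_mem_hull] with x hx hxK y
    rw [Matrix.smul_mulVec, smul_dotProduct, smul_eq_mul]
    exact mul_nonneg (δ_nonneg hT i.1 hxK) (hx y)
  rw [dissTerm, h1]
  linarith

lemma dissTerm_vertex (hN : 0 < N) (hP : P.IsAdmissible H γ Cd) (hT : T.IsCausal P cHat)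
    (i : PatchFacet P) (hi : (i.2 : Space N) = P.vertex) (w : V P p) : dissTerm H T i w = 0 := by
  have h1 : ∀ (W : Space N → Matrix (Fin L) (Fin L) ℝ) y z,
      matForm i.measure (fun x => T.δ x • W x) y z = 0 := by
    intro W y z
    have : matForm i.measure (fun x => T.δ x • W x) y z = matForm i.measure (fun _ => 0) y z := by
      refine matForm_congr ?_ _ _
      filter_upwards [ae_δ_eq_zero hT hi] with x hx
      rw [hx, zero_smul]
    rw [this]
    simp [matForm]
  rw [dissTerm, fluxTerm_eq hN hP hT, h1, h1, h1 fun _ => bdryMatrix H i.1 i.2]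
  ring

/-- `D` is symmetric and changes sign with the side, so its contributions cancel in the sum over
both sides. What remains is twice the `δ`-weighted form of `S` at the jump. -/
lemma dissTerm_inner_nonneg (hN : 0 < N) (hH : H.IsAdmissible) (hP : P.IsAdmissible H γ Cd)
    (hT : T.IsCausal P cHat) (i : PatchFacet P) (hi : i.IsInner) (w : V P p) :
    0 ≤ dissTerm H T i w + dissTerm H T i.opposite w := by
  have hμ := i.carried hN
  have hS := isMatWeight_δ_smul hN hT i (isMatWeight_S hP i hi.1)
  have hD := isMatWeight_δ_smul hN hT i (isMatWeight_const (bdryMatrix H i.1 i.2))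
  have hself : ∀ (j : PatchFacet P) (hj : ¬ P.mesh.IsBoundaryFacet j.face) (y z),
      matForm j.measure (fun x => T.δ x • selfMatrix H j x) y z = 1 / 2 * matForm j.measure
        (fun x => T.δ x • bdryMatrix H j.1 j.2) y z +
        matForm j.measure (fun x => T.δ x • P.S x) y z := by
    intro j hj y z
    have hμ' := j.carried hN
    have hS' := isMatWeight_δ_smul hN hT j (isMatWeight_S hP j hj)
    have hD' := isMatWeight_δ_smul hN hT j (isMatWeight_const (bdryMatrix H j.1 j.2))
    rw [← matForm_const_smul, ← matForm_add hμ' (hD'.smul (isWeight_const _)) hS']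
    refine matForm_congr (ae_of_all _ fun x => ?_) _ _
    rw [selfMatrix, if_neg hj]
    module
  have hother : ∀ (j : PatchFacet P) (hj : ¬ P.mesh.IsBoundaryFacet j.face) (y z),
      matForm j.measure (fun x => T.δ x • otherMatrix H j x) y z = 1 / 2 * matForm j.measure
        (fun x => T.δ x • bdryMatrix H j.1 j.2) y z +
        -1 * matForm j.measure (fun x => T.δ x • P.S x) y z := by
    intro j hj y z
    have hμ' := j.carried hN
    have hS' := isMatWeight_δ_smul hN hT j (isMatWeight_S hP j hj)
    have hD' := isMatWeight_δ_smul hN hT j (isMatWeight_const (bdryMatrix H j.1 j.2))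
    rw [← matForm_const_smul, ← matForm_const_smul,
      ← matForm_add hμ' (hD'.smul (isWeight_const _)) (hS'.smul (isWeight_const _))]
    refine matForm_congr (ae_of_all _ fun x => ?_) _ _
    rw [otherMatrix, if_neg hj]
    module
  have hface := PatchFacet.face_opposite i
  have hb' : ¬ P.mesh.IsBoundaryFacet i.opposite.face := by rw [hface]; exact hi.1
  have hDneg : bdryMatrix H i.opposite.1 i.opposite.2 = -bdryMatrix H i.1 i.2 :=
    bdryMatrix_eq_neg hN hH hP (elem_mem i.1) (elem_mem i.opposite.1)
      (fun h => PatchFacet.opposite_fst_ne hi (Subtype.ext h.symm)) i.2.2 i.opposite.2.2 hface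
  have hDform : ∀ y z, matForm i.measure
      (fun x => T.δ x • bdryMatrix H i.opposite.1 i.opposite.2) y z =
      -1 * matForm i.measure (fun x => T.δ x • bdryMatrix H i.1 i.2) y z := by
    intro y z
    rw [← matForm_const_smul, hDneg]
    refine matForm_congr (ae_of_all _ fun x => ?_) _ _
    module
  have hDsymm : ∀ y z, matForm i.measure (fun x => T.δ x • bdryMatrix H i.1 i.2) y z =
      matForm i.measure (fun x => T.δ x • bdryMatrix H i.1 i.2) z y :=
    matForm_comm (ae_of_all _ fun x => by
      have h := bdryMatrix_isSymm hH hP (elem_mem i.1) i.2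
      rw [Matrix.IsSymm, Matrix.transpose_smul, h])
  have hpos : 0 ≤ matForm i.measure (fun x => T.δ x • P.S x) (polyAt i.1 w - polyAt i.opposite.1 w)
      (polyAt i.1 w - polyAt i.opposite.1 w) := by
    refine matForm_nonneg ?_ _
    filter_upwards [hP.S_nonneg i.1 (elem_mem i.1) i.2 i.2.2 hi.1, i.ae_mem_hull] with x hx hxK y
    rw [Matrix.smul_mulVec, smul_dotProduct, smul_eq_mul]
    exact mul_nonneg (δ_nonneg hT i.1 hxK) (hx y)
  rw [matForm_sub_sub hμ hS] at hpos
  rw [dissTerm, dissTerm, fluxTerm_eq hN hP hT, fluxTerm_eq hN hP hT, PatchFacet.opposite_opposite hN,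
    hself i hi.1, hself _ hb', hother i hi.1, hother _ hb', PatchFacet.measure_opposite, hDform,
    hDform, hDsymm (polyAt i.opposite.1 w) (polyAt i.1 w)]
  linarith

/-- The form `a` is dissipative. -/
lemma diss_nonneg (hN : 0 < N) (hH : H.IsAdmissible) (hP : P.IsAdmissible H γ Cd)
    (hT : T.IsCausal P cHat) (w : V P p) : 0 ≤ -(2 * formA H T w w + formM1 H T w w) := by
  rw [diss_eq_sum hN hH hP hT]
  have h1 : ∀ i : PatchFacet P, 0 ≤ dissTerm H T i w + dissTerm H T i.opposite w := by
    intro i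
    by_cases hi : i.IsInner
    · exact dissTerm_inner_nonneg hN hH hP hT i hi w
    rw [PatchFacet.opposite_of_not_isInner hi]
    have h2 : 0 ≤ dissTerm H T i w := by
      by_cases hb : P.mesh.IsBoundaryFacet i.face
      · exact dissTerm_boundary_nonneg hN hP hT i hb w
      · by_cases hv : (i.2 : Space N) = P.vertex
        · exact (dissTerm_vertex hN hP hT i hv w).ge
        · exact absurd ⟨hb, hv⟩ hi
    linarith
  have h3 := Finset.sum_nonneg fun i (_ : i ∈ Finset.univ) => h1 i
  rw [Finset.sum_add_distrib, PatchFacet.sum_opposite hN fun i => dissTerm H T i w] at h3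
  linarith

end Dissipation

/-! ### Operators, pieces of a tent and the energy estimate -/

section Operators

variable {N L p : ℕ} {H : HyperbolicSystem N L} {P : DGPatch N L} {γ Cd cHat : ℝ} {T : Tent N}

lemma ip_ext {u u' : V P p} (h : ∀ v, ip u v = ip u' v) : u = u' := by
  obtain ⟨b, hb⟩ := exists_bilin_ip (P := P) (p := p)
  by_contra hne
  have h1 := ip_pos (sub_ne_zero.2 hne)
  have h2 := h (u - u')
  rw [hb, hb] at h2
  rw [hb, LinearMap.map_sub₂, h2, sub_self] at h1
  exact lt_irrefl _ h1

lemma exists_ip_eq (f : V P p →ₗ[ℝ] ℝ) : ∃ u, ∀ v, ip u v = f v := by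
  obtain ⟨b, hb⟩ := exists_bilin_ip (P := P) (p := p)
  obtain ⟨u, hu⟩ := exists_represent b (fun x hx => by rw [← hb]; exact ip_pos hx) f
  exact ⟨u, fun v => by rw [hb, hu]⟩

lemma ip_add_left (u u' v : V P p) : ip (u + u') v = ip u v + ip u' v := by
  obtain ⟨b, hb⟩ := exists_bilin_ip (P := P) (p := p)
  simp [hb]

lemma ip_sub_left (u u' v : V P p) : ip (u - u') v = ip u v - ip u' v := by
  obtain ⟨b, hb⟩ := exists_bilin_ip (P := P) (p := p)
  rw [hb, hb, hb, LinearMap.map_sub₂]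

lemma ip_smul_left (c : ℝ) (u v : V P p) : ip (c • u) v = c * ip u v := by
  obtain ⟨b, hb⟩ := exists_bilin_ip (P := P) (p := p)
  simp [hb]

lemma ip_smul_self (c : ℝ) (u : V P p) : ip (c • u) (c • u) = c ^ 2 * ip u u := by
  rw [ip_smul_left, ip_comm, ip_smul_left]
  ring

lemma ip_self_nonneg (u : V P p) : 0 ≤ ip u u := by
  rw [ip_self]; exact Finset.sum_nonneg fun K _ => elemSq_nonneg K u

lemma ip_represent {f : V P p → V P p → ℝ} {b : V P p →ₗ[ℝ] V P p →ₗ[ℝ] ℝ}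
    (hf : ∀ w v, f w v = b w v) (w v : V P p) : ip (represent f w) v = f w v :=
  Classical.epsilon_spec (p := fun u => ∀ v, ip u v = f w v)
    (by simpa only [hf] using exists_ip_eq (b w)) v

/-- The forms of a tent are bilinear. -/
structure HasBilinForms (H : HyperbolicSystem N L) (P : DGPatch N L) (p : ℕ) (T : Tent N) :
    Prop where
  A : ∃ b : V P p →ₗ[ℝ] V P p →ₗ[ℝ] ℝ, ∀ w v, formA H T w v = b w v
  M0 : ∃ b : V P p →ₗ[ℝ] V P p →ₗ[ℝ] ℝ, ∀ w v, formM0 H T w v = b w v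
  M1 : ∃ b : V P p →ₗ[ℝ] V P p →ₗ[ℝ] ℝ, ∀ w v, formM1 H T w v = b w v

namespace HasBilinForms

variable (hT : HasBilinForms H P p T)
include hT

lemma ip_opA (w v : V P p) : ip (opA H T w) v = formA H T w v := by
  obtain ⟨b, hb⟩ := hT.A
  exact ip_represent hb w v

lemma ip_opM0 (w v : V P p) : ip (opM0 H T w) v = formM0 H T w v := by
  obtain ⟨b, hb⟩ := hT.M0
  exact ip_represent hb w v

lemma ip_opM1 (w v : V P p) : ip (opM1 H T w) v = formM1 H T w v := by
  obtain ⟨b, hb⟩ := hT.M1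
  exact ip_represent hb w v

lemma ip_opM (τ : ℝ) (w v : V P p) :
    ip (opM H T τ w) v = formM0 H T w v - τ * formM1 H T w v := by
  rw [opM, ip_sub_left, ip_smul_left, hT.ip_opM0, hT.ip_opM1]

/-- `invFun` is a right inverse on the range. Positivity of the form of `M(τ)` lets it represent
`(z, ·)`, so the range is everything. -/
lemma opM_invM {τ : ℝ} (hpos : ∀ w : V P p, w ≠ 0 → 0 < formM0 H T w w - τ * formM1 H T w w)
    (z : V P p) : opM H T τ (invM H T τ z) = z := by
  obtain ⟨b₀, hb₀⟩ := hT.M0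
  obtain ⟨b₁, hb₁⟩ := hT.M1
  obtain ⟨i, hi⟩ := exists_bilin_ip (P := P) (p := p)
  obtain ⟨u, hu⟩ := exists_represent (b₀ - τ • b₁)
    (fun w hw => by simpa [hb₀, hb₁] using hpos w hw) (i z)
  refine Function.invFun_eq ⟨u, ip_ext fun v => ?_⟩
  rw [hT.ip_opM, hi, ← hu v, hb₀, hb₁]
  simp

omit hT in
lemma opM_zero : opM H T 0 = opM0 (P := P) (p := p) H T := by
  ext1 w; simp [opM]

lemma opM0_invM0 (hpos : ∀ w : V P p, w ≠ 0 → 0 < formM0 H T w w) (z : V P p) :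
    opM0 H T (invM0 H T z) = z := by
  have h := hT.opM_invM (τ := 0) (by simpa using hpos) z
  rw [invM, opM_zero] at h
  exact h

lemma formM0_opX_one (hpos : ∀ w : V P p, w ≠ 0 → 0 < formM0 H T w w) (w v : V P p) :
    formM0 H T (opX H T 1 w) v = formA H T w v + formM1 H T w v := by
  rw [← hT.ip_opM0, opX, hT.opM0_invM0 hpos, ip_add_left, ip_smul_left, hT.ip_opA, hT.ip_opM1, opX]
  simp

lemma ip_opM0_opX_two (hpos : ∀ w : V P p, w ≠ 0 → 0 < formM0 H T w w) (w v : V P p) :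
    ip (opM0 H T (opX H T 2 w)) v =
      formA H T (opX H T 1 w) v + 2 * formM1 H T (opX H T 1 w) v := by
  rw [opX, hT.opM0_invM0 hpos, ip_add_left, ip_smul_left, hT.ip_opA, hT.ip_opM1]
  norm_num

/-- The last term of the two-stage flow. -/
lemma formM_last (hpos : ∀ w : V P p, w ≠ 0 → 0 < formM0 H T w w) {τ : ℝ}
    (hposτ : ∀ w : V P p, w ≠ 0 → 0 < formM0 H T w w - τ * formM1 H T w w) (w v : V P p) :
    formM0 H T (invM H T τ (opM0 H T (opX H T 2 w))) v -
      τ * formM1 H T (invM H T τ (opM0 H T (opX H T 2 w))) v =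
      formA H T (opX H T 1 w) v + 2 * formM1 H T (opX H T 1 w) v := by
  rw [← hT.ip_opM, hT.opM_invM hposτ, hT.ip_opM0_opX_two hpos]

end HasBilinForms

lemma satFlow_two (τ : ℝ) (w : V P p) : satFlow H T 2 τ w =
    w + τ • opX H T 1 w + (τ ^ 2 / 2) • invM H T τ (opM0 H T (opX H T 2 w)) := by
  simp [satFlow, Finset.sum_range_succ, opX]

/-- A piece of a tent: its forms are those of `T` at pseudotime `t`, rescaled by `c`. -/
structure IsPiece (H : HyperbolicSystem N L) (P : DGPatch N L) (p : ℕ) (T T' : Tent N)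
    (t c : ℝ) : Prop where
  A : ∀ w v : V P p, formA H T' w v = c * formA H T w v
  M0 : ∀ w v : V P p, formM0 H T' w v = formM0 H T w v - t * formM1 H T w v
  M1 : ∀ w v : V P p, formM1 H T' w v = c * formM1 H T w v

lemma IsPiece.hasBilinForms {T' : Tent N} {t c : ℝ} (h : IsPiece H P p T T' t c)
    (hT : HasBilinForms H P p T) : HasBilinForms H P p T' := by
  obtain ⟨⟨a, ha⟩, ⟨b₀, hb₀⟩, ⟨b₁, hb₁⟩⟩ := hT
  exact ⟨⟨c • a, fun w v => by simp [h.A, ha]⟩, ⟨b₀ - t • b₁, fun w v => by simp [h.M0, hb₀, hb₁]⟩,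
    ⟨c • b₁, fun w v => by simp [h.M1, hb₁]⟩⟩

lemma isPiece_of_δ_eq (hP : P.IsAdmissible H γ Cd) (hT : T.IsCausal P cHat) {T' : Tent N} {t c : ℝ}
    (hbot : ∀ x, T'.bot x = T.bot x + t * T.δ x) (hδ : ∀ x, T'.δ x = c * T.δ x) :
    IsPiece H P p T T' t c := by
  have hbot' : T'.bot = fun x => T.bot x + t * T.δ x := funext hbot
  have hδ' : T'.δ = fun x => c * T.δ x := funext hδ
  have hpδ : ∀ (K : P.mesh.patch P.vertex) j, ∀ x ∈ interior (hull (K : Finset (Space N))),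
      partialD j T'.δ x = c * partialD j T.δ x := by
    intro K j x hx
    have h1 := (hasGradientAt_slope (patch_isSimplex K) (affine_δ hT K) hx).hasFDerivAt
    rw [partialD, partialD, hδ', (h1.const_mul c).fderiv, h1.fderiv]
    rfl
  have hpbot : ∀ (K : P.mesh.patch P.vertex) j, ∀ x ∈ interior (hull (K : Finset (Space N))),
      partialD j T'.bot x = partialD j T.bot x + t * partialD j T.δ x := by
    intro K j x hx
    have h1 := (hasGradientAt_slope (patch_isSimplex K) (affine_δ hT K) hx).hasFDerivAt
    have h2 := (hasGradientAt_slope (patch_isSimplex K) (hT.affine_bot K K.2) hx).hasFDerivAt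
    have h3 : HasFDerivAt (fun x => T.bot x + t * T.δ x) _ x := h2.add (h1.const_mul t)
    rw [partialD, partialD, partialD, hbot', h3.fderiv, h1.fderiv, h2.fderiv]
    rfl
  have hint : ∀ (K : P.mesh.patch P.vertex) j {f : Space N → ℝ},
      (∃ g : Space N →ᵃ[ℝ] ℝ, ∀ x ∈ hull (K : Finset (Space N)), f x = g x) → ∀ w v : V P p,
      IntegrableOn (fun x => partialD j f x * ((H.A j x *ᵥ val w K x) ⬝ᵥ val v K x))
        (hull (K : Finset (Space N))) := by
    intro K j f hf w v
    refine ((isMatWeight_const (slope f K j • H.A j (barycenter (K : Finset (Space N))))).integrable_form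
      (compactlyCarried_hull (K : Finset (Space N))) (polyAt K w) (polyAt K v)).congr ?_
    filter_upwards [ae_mem_interior_hull] with x hx
    rw [partialD_eq_slope (patch_isSimplex K) hf hx, A_eq hP (elem_mem K) j hx, Matrix.smul_mulVec,
      smul_dotProduct, val_eq, val_eq, smul_eq_mul]
  refine ⟨fun w v => ?_, fun w v => ?_, fun w v => ?_⟩
  · rw [formA, formA, Finset.mul_sum]
    refine Finset.sum_congr rfl fun K _ => ?_
    rw [mul_sub, Finset.mul_sum, Finset.mul_sum]
    congr 1
    · refine Finset.sum_congr rfl fun j _ => ?_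
      rw [← integral_const_mul]
      simp only [hδ, mul_assoc]
    · refine Finset.sum_congr rfl fun a _ => ?_
      rw [facetIntegral, facetIntegral, ← integral_const_mul]
      simp only [hδ, mul_assoc]
  · rw [formM0, formM0, formM1, Finset.mul_sum, ← Finset.sum_sub_distrib]
    refine Finset.sum_congr rfl fun K _ => ?_
    rw [sub_sub, Finset.mul_sum, ← Finset.sum_add_distrib]
    congr 1
    refine Finset.sum_congr rfl fun j _ => ?_
    rw [← integral_const_mul, ← integral_add (hint K j (hT.affine_bot K K.2) w v)
      ((hint K j (affine_δ hT K) w v).const_mul t)]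
    refine integral_congr_ae ?_
    filter_upwards [ae_mem_interior_hull] with x hx
    rw [hpbot K j x hx]
    ring
  · rw [formM1, formM1, Finset.mul_sum]
    refine Finset.sum_congr rfl fun K _ => ?_
    rw [Finset.mul_sum]
    refine Finset.sum_congr rfl fun j _ => ?_
    rw [← integral_const_mul]
    refine integral_congr_ae ?_
    filter_upwards [ae_mem_interior_hull] with x hx
    rw [hpδ K j x hx]
    ring

lemma isPiece_restart (hP : P.IsAdmissible H γ Cd) (hT : T.IsCausal P cHat) (t : ℝ) :
    IsPiece H P p T (T.restart t) t 1 :=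
  isPiece_of_δ_eq hP hT (fun _ => rfl) fun x => by simp [Tent.δ, Tent.restart]

lemma isPiece_subtent (hP : P.IsAdmissible H γ Cd) (hT : T.IsCausal P cHat) {r : ℕ} (n : ℕ) :
    IsPiece H P p T (T.subtent r (n + 1)) (n / r) (1 / r) :=
  isPiece_of_δ_eq hP hT (fun x => by simp [Tent.subtent]) fun x => by
    simp only [Tent.subtent, Tent.δ]
    push_cast
    ring

lemma restart_zero : T.restart 0 = T := by simp [Tent.restart]

lemma hasBilinForms (hN : 0 < N) (hP : P.IsAdmissible H γ Cd) (hT : T.IsCausal P cHat) :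
    HasBilinForms H P p T :=
  ⟨exists_bilin_formA hN hP hT, exists_bilin_formM0 hP hT, exists_bilin_formM1 hP hT⟩

lemma formM_pos (hL : 0 < L) (hH : H.IsAdmissible) (hc : H.waveSpeed < cHat)
    (hP : P.IsAdmissible H γ Cd) (hT : T.IsCausal P cHat) {t : ℝ} (h0 : 0 ≤ t) (h1 : t ≤ 1)
    {w : V P p} (hw : w ≠ 0) : 0 < formM0 H T w w - t * formM1 H T w w := by
  obtain ⟨θ, hθ, h⟩ := exists_coercive p hL hH γ Cd hc
  exact (mul_pos hθ (ip_pos hw)).trans_le (h P T hP hT t h0 h1 w)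

lemma eq_of_formM_eq (hN : 0 < N) (hL : 0 < L) (hH : H.IsAdmissible) (hc : H.waveSpeed < cHat)
    (hP : P.IsAdmissible H γ Cd) (hT : T.IsCausal P cHat) {t : ℝ} (h0 : 0 ≤ t) (h1 : t ≤ 1)
    {u u' : V P p} (h : ∀ v, formM0 H T u v - t * formM1 H T u v =
      formM0 H T u' v - t * formM1 H T u' v) : u = u' := by
  obtain ⟨-, ⟨b₀, hb₀⟩, ⟨b₁, hb₁⟩⟩ := hasBilinForms (p := p) hN hP hT
  by_contra hne
  have h2 := formM_pos hL hH hc hP hT h0 h1 (sub_ne_zero.2 hne)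
  have h3 := h (u - u')
  simp only [hb₀, hb₁] at h2 h3
  rw [LinearMap.map_sub₂, LinearMap.map_sub₂] at h2
  linarith

/-- The flow of a subtent is a step of the flow of the tent, started at a later pseudotime. -/
lemma satFlow_subtent (hN : 0 < N) (hL : 0 < L) (hH : H.IsAdmissible) (hc : H.waveSpeed < cHat)
    (hP : P.IsAdmissible H γ Cd) (hT : T.IsCausal P cHat) {r n : ℕ} (hn : n < r) (w : V P p) :
    satFlow H (T.subtent r (n + 1)) 2 1 w = satFlow H (T.restart (n / r)) 2 (1 / r) w := by
  have hr : (0 : ℝ) < r := by exact_mod_cast (Nat.zero_le n).trans_lt hn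
  have ht0 : (0 : ℝ) ≤ n / r := by positivity
  have ht1 : (n : ℝ) / r + 1 / r ≤ 1 := by
    rw [← add_div, div_le_one hr]; exact_mod_cast hn
  have hr1 : (0 : ℝ) < 1 / r := by positivity
  have hbil := hasBilinForms (p := p) hN hP hT
  have hs := isPiece_subtent (p := p) (r := r) hP hT n
  have ht := isPiece_restart (p := p) hP hT (n / r : ℝ)
  set S := T.subtent r (n + 1)
  set R := T.restart (n / r : ℝ)
  have hpos : ∀ w : V P p, w ≠ 0 → 0 < formM0 H T w w - n / r * formM1 H T w w := fun w hw =>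
    formM_pos hL hH hc hP hT ht0 (by linarith) hw
  have hpos1 : ∀ w : V P p, w ≠ 0 → 0 < formM0 H T w w - (n / r + 1 / r) * formM1 H T w w :=
    fun w hw => formM_pos hL hH hc hP hT (by linarith) ht1 hw
  have hposS : ∀ w : V P p, w ≠ 0 → 0 < formM0 H S w w := fun w hw => by
    rw [hs.M0]; exact hpos w hw
  have hposR : ∀ w : V P p, w ≠ 0 → 0 < formM0 H R w w := fun w hw => by
    rw [ht.M0]; exact hpos w hw
  have hposS1 : ∀ w : V P p, w ≠ 0 → 0 < formM0 H S w w - 1 * formM1 H S w w := fun w hw => by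
    rw [hs.M0, hs.M1]; linarith [hpos1 w hw]
  have hposR1 : ∀ w : V P p, w ≠ 0 → 0 < formM0 H R w w - 1 / r * formM1 H R w w := fun w hw => by
    rw [ht.M0, ht.M1]; linarith [hpos1 w hw]
  have bS := hs.hasBilinForms hbil
  have bR := ht.hasBilinForms hbil
  obtain ⟨⟨a, ha⟩, ⟨b₀, hb₀⟩, ⟨b₁, hb₁⟩⟩ := hbil
  -- `A_h` and `M_1` of the subtent carry the factor `1/r`, and its masses are those of the tent at
  -- `n/r` and `(n+1)/r`. Each stage thus gains one factor `1/r`, as if the tent were run with step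
  -- `1/r`.
  have hX : opX H S 1 w = (1 / r : ℝ) • opX H R 1 w := by
    refine eq_of_formM_eq hN hL hH hc hP hT ht0 (by linarith) fun v => ?_
    have e1 := bS.formM0_opX_one hposS w v
    have e2 := bR.formM0_opX_one hposR w v
    rw [hs.M0, hs.A, hs.M1] at e1
    rw [ht.M0, ht.A, ht.M1] at e2
    rw [e1]
    simp only [hb₀, hb₁, ha, map_smul, LinearMap.smul_apply, smul_eq_mul] at e2 ⊢
    linear_combination (-(1 / r : ℝ)) * e2
  have hY : invM H S 1 (opM0 H S (opX H S 2 w)) =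
      (1 / r : ℝ) ^ 2 • invM H R (1 / r) (opM0 H R (opX H R 2 w)) := by
    refine eq_of_formM_eq hN hL hH hc hP hT (t := n / r + 1 / r) (by linarith) ht1 fun v => ?_
    have e1 := bS.formM_last hposS hposS1 w v
    have e2 := bR.formM_last hposR hposR1 w v
    rw [hX] at e1
    rw [hs.M0, hs.A, hs.M1, hs.M1] at e1
    rw [ht.M0, ht.A, ht.M1, ht.M1] at e2
    simp only [hb₀, hb₁, ha, map_smul, LinearMap.smul_apply, smul_eq_mul] at e1 e2 ⊢
    linear_combination e1 - (1 / r : ℝ) ^ 2 * e2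
  rw [satFlow_two, satFlow_two, hX, hY]
  module

lemma normM_sq (hN : 0 < N) (hL : 0 < L) (hH : H.IsAdmissible) (hc : H.waveSpeed < cHat)
    (hP : P.IsAdmissible H γ Cd) (hT : T.IsCausal P cHat) {t : ℝ} (h0 : 0 ≤ t) (h1 : t ≤ 1)
    (w : V P p) : normM H T t w ^ 2 = formM0 H T w w - t * formM1 H T w w := by
  have hb := hasBilinForms (p := p) hN hP hT
  rw [normM, hb.ip_opM, Real.sq_sqrt]
  obtain ⟨θ, hθ, h⟩ := exists_coercive p hL hH γ Cd hc
  exact (mul_nonneg hθ.le (ip_self_nonneg w)).trans (h P T hP hT t h0 h1 w)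

lemma normM_restart (hN : 0 < N) (hP : P.IsAdmissible H γ Cd) (hT : T.IsCausal P cHat) (t τ : ℝ)
    (w : V P p) : normM H (T.restart t) τ w = normM H T (t + τ) w := by
  have hb := hasBilinForms (p := p) hN hP hT
  have ht := isPiece_restart (p := p) hP hT t
  rw [normM, normM, hb.ip_opM, (ht.hasBilinForms hb).ip_opM, ht.M0, ht.M1]
  congr 1
  ring

lemma normM0_restart (hN : 0 < N) (hP : P.IsAdmissible H γ Cd) (hT : T.IsCausal P cHat) (t : ℝ)
    (w : V P p) : normM0 H (T.restart t) w = normM H T t w := by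
  have hb := hasBilinForms (p := p) hN hP hT
  have ht := isPiece_restart (p := p) hP hT t
  rw [normM0, normM, hb.ip_opM, (ht.hasBilinForms hb).ip_opM0, ht.M0]

/-- Removes the square roots from `Z`. `Real.sqrt` of a negative number is `0`, so dissipativity is
what makes `seminormD ^ 2` equal to its quadratic form. -/
lemma Z_restart_eq (hN : 0 < N) (hL : 0 < L) (hH : H.IsAdmissible) (hc : H.waveSpeed < cHat)
    (hP : P.IsAdmissible H γ Cd) (hT : T.IsCausal P cHat) {t τ : ℝ} (ht : 0 ≤ t) (hτ : 0 ≤ τ)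
    (h1 : t + τ ≤ 1) (w : V P p) :
    let x := opX H (T.restart t) 1 w
    let y := invM H (T.restart t) τ (opM0 H (T.restart t) (opX H (T.restart t) 2 w))
    Z H (T.restart t) τ w = (2 * formM1 H T x x + (2 * formA H T x x + formM1 H T x x) +
      τ * (formM0 H T y y - (t + τ) * formM1 H T y y)) / 4 := by
  intro x y
  have hb := hasBilinForms (p := p) hN hP hT
  have hR := isPiece_restart (p := p) hP hT t
  have hbR := hR.hasBilinForms hb
  have hd := diss_nonneg hN hH hP hT x
  rw [Z, normM_restart hN hP hT, normM_sq hN hL hH hc hP hT (by linarith) h1, seminormD, formD,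
    hbR.ip_opM1, hR.A, hR.M1, Real.sq_sqrt]
  · ring
  · linarith

lemma restart_formM_pos (hL : 0 < L) (hH : H.IsAdmissible) (hc : H.waveSpeed < cHat)
    (hP : P.IsAdmissible H γ Cd) (hT : T.IsCausal P cHat) {t τ : ℝ} (ht : 0 ≤ t) (hτ : 0 ≤ τ)
    (h1 : t + τ ≤ 1) (w : V P p) (hw : w ≠ 0) :
    0 < formM0 H (T.restart t) w w - τ * formM1 H (T.restart t) w w := by
  have hR := isPiece_restart (p := p) hP hT t
  rw [hR.M0, hR.M1]
  linarith [formM_pos hL hH hc hP hT (by linarith : 0 ≤ t + τ) h1 hw]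

/-- The defining equations of the stages of the flow. -/
lemma stages_restart (hN : 0 < N) (hL : 0 < L) (hH : H.IsAdmissible) (hc : H.waveSpeed < cHat)
    (hP : P.IsAdmissible H γ Cd) (hT : T.IsCausal P cHat) {t τ : ℝ} (ht : 0 ≤ t) (hτ : 0 ≤ τ)
    (h1 : t + τ ≤ 1) (w v : V P p) :
    let x := opX H (T.restart t) 1 w
    let y := invM H (T.restart t) τ (opM0 H (T.restart t) (opX H (T.restart t) 2 w))
    formM0 H T x v - t * formM1 H T x v = formA H T w v + formM1 H T w v ∧
    formM0 H T y v - (t + τ) * formM1 H T y v = formA H T x v + 2 * formM1 H T x v := by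
  intro x y
  have hb := hasBilinForms (p := p) hN hP hT
  have hR := isPiece_restart (p := p) hP hT t
  have hbR := hR.hasBilinForms hb
  have hpos : ∀ w : V P p, w ≠ 0 → 0 < formM0 H (T.restart t) w w := fun w hw => by
    simpa using restart_formM_pos hL hH hc hP hT ht le_rfl (by linarith) w hw
  have e1 := hbR.formM0_opX_one hpos w v
  have e2 := hbR.formM_last hpos (restart_formM_pos hL hH hc hP hT ht hτ h1) w v
  rw [hR.M0, hR.M1, hR.A] at e1
  rw [hR.M0, hR.M1, hR.M1, hR.A] at e2
  exact ⟨by linarith, by linarith⟩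

/-- The energy estimate of one step. -/
lemma normM_satFlow_le (hN : 0 < N) (hL : 0 < L) (hH : H.IsAdmissible) (hc : H.waveSpeed < cHat)
    (hP : P.IsAdmissible H γ Cd) (hT : T.IsCausal P cHat) {t τ : ℝ} (ht : 0 ≤ t) (hτ : 0 ≤ τ)
    (h1 : t + τ ≤ 1) (w : V P p) :
    normM H T (t + τ) (satFlow H (T.restart t) 2 τ w) ^ 2 ≤
      normM H T t w ^ 2 + τ ^ 3 * Z H (T.restart t) τ w := by
  rw [normM_sq hN hL hH hc hP hT (by linarith) h1, normM_sq hN hL hH hc hP hT ht (by linarith),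
    Z_restart_eq hN hL hH hc hP hT ht hτ h1, satFlow_two]
  have hst := stages_restart hN hL hH hc hP hT ht hτ h1 w
  set x := opX H (T.restart t) 1 w
  set y := invM H (T.restart t) τ (opM0 H (T.restart t) (opX H (T.restart t) 2 w))
  have exw := (hst w).1
  have exx := (hst x).1
  have eyw := (hst w).2
  have eyx := (hst x).2
  -- At this point the dissipation collects all terms of first and second order in `τ`, and `τ³/4`
  -- times that of `x`; the rest of the expansion is `τ³ Z`.
  have hd := mul_nonneg hτ (diss_nonneg hN hH hP hT (w + (τ / 2) • x))
  have s1 := formM1_comm hH hP hT w x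
  have s2 := formM1_comm hH hP hT w y
  have s3 := formM1_comm hH hP hT x y
  have s4 := formM0_comm hH hP hT w x
  have s5 := formM0_comm hH hP hT w y
  have s6 := formM0_comm hH hP hT x y
  obtain ⟨⟨a, ha⟩, ⟨b₀, hb₀⟩, ⟨b₁, hb₁⟩⟩ := hasBilinForms (p := p) hN hP hT
  simp only [ha, hb₀, hb₁, map_add, map_smul, LinearMap.add_apply, LinearMap.smul_apply,
    smul_eq_mul] at *
  rw [s1] at hd exx
  rw [s1, s2, s3, s4, s5, s6]
  linear_combination hd + (2 * τ) * exw + τ ^ 2 * exx + τ ^ 2 * eyw + τ ^ 3 * eyx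

end Operators

/-! ### Bounds on `Z`, growth over the subtents and their number -/

section Stability

variable {N L p : ℕ} {H : HyperbolicSystem N L} {P : DGPatch N L} {γ Cd cHat : ℝ} {T : Tent N}

/-- A functional `b (w, ·)` that dominates `θ` times the square norm at `u` bounds `u` by `w`. -/
lemma ip_le_of_coercive (b : V P p →ₗ[ℝ] V P p →ₗ[ℝ] ℝ) {C θ : ℝ} (hC : 0 ≤ C) (hθ : 0 < θ)
    (hb : ∀ w v, |b w v| ≤ C * (ip w w + ip v v)) {w u : V P p} (h : θ * ip u u ≤ b w u) :
    ip u u ≤ 2 * C * (2 * C / θ + 1) / θ * ip w w := by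
  -- The bound on `b` is used with `w` scaled by `√s` and `u` by its inverse, where `s` is large
  -- enough that `C / s ≤ θ / 2`; the term with `u` is then absorbed.
  set s := 2 * C / θ + 1 with hs
  have hs0 : 0 < s := by positivity
  have h1 := (le_abs_self _).trans (hb (√s • w) ((√s)⁻¹ • u))
  rw [LinearMap.map_smul₂, map_smul, smul_eq_mul, smul_eq_mul, ip_smul_self, ip_smul_self,
    mul_inv_cancel_left₀ (Real.sqrt_pos.2 hs0).ne', inv_pow, Real.sq_sqrt hs0.le] at h1
  have h2 : C * s⁻¹ ≤ θ / 2 := by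
    rw [← div_eq_mul_inv, div_le_iff₀ hs0, hs]
    have : θ / 2 * (2 * C / θ + 1) = C + θ / 2 := by field_simp
    linarith
  have h3 := mul_le_mul_of_nonneg_right h2 (ip_self_nonneg u)
  rw [div_mul_eq_mul_div, le_div_iff₀ hθ]
  linarith

/-- The uniform bound of `Z`. -/
lemma exists_Z_le (p : ℕ) (hN : 0 < N) (hL : 0 < L) (hH : H.IsAdmissible) (Cd : ℝ) (hγ : 0 < γ)
    (hc : H.waveSpeed < cHat) : ∃ C : ℝ, 0 ≤ C ∧
    ∀ (P : DGPatch N L) (T : Tent N), P.IsAdmissible H γ Cd → T.IsCausal P cHat →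
      ∀ t τ : ℝ, 0 ≤ t → 0 ≤ τ → t + τ ≤ 1 → ∀ w : V P p,
        Z H (T.restart t) τ w ≤ C * normM H T t w ^ 2 := by
  obtain ⟨θ, hθ, hcoer⟩ := exists_coercive p hL hH γ Cd hc
  obtain ⟨C₀, hC₀, hA⟩ := exists_abs_formA_le p hN hH Cd hγ ((waveSpeed_nonneg hH).trans_lt hc)
  obtain ⟨C₁, hC₁, hM⟩ := exists_abs_formM1_le p hH γ Cd cHat
  set C := C₀ + 2 * C₁ with hCdef
  have hC : 0 ≤ C := by positivity
  set q := 2 * C * (2 * C / θ + 1) / θ with hq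
  have hq0 : 0 ≤ q := by positivity
  -- `q` bounds each stage by the previous one. The summands bound `2 (M_1 x, x)` and `‖y‖²` in
  -- terms of the `L²` norm of `w`; the dissipation of `x` has the favourable sign and is dropped.
  -- Division by `θ` passes to the norm of `M(t)`.
  refine ⟨(4 * C₁ * q + C * (q + q * q)) / θ, by positivity,
    fun P T hP hT t τ ht hτ h1 w => ?_⟩
  rw [Z_restart_eq hN hL hH hc hP hT ht hτ h1, normM_sq hN hL hH hc hP hT ht (by linarith)]
  have hst := stages_restart hN hL hH hc hP hT ht hτ h1 w
  set x := opX H (T.restart t) 1 w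
  set y := invM H (T.restart t) τ (opM0 H (T.restart t) (opX H (T.restart t) 2 w))
  obtain ⟨⟨a, ha⟩, -, ⟨b₁, hb₁⟩⟩ := hasBilinForms (p := p) hN hP hT
  have hk : ∀ k : ℝ, 0 ≤ k → k ≤ 2 → ∀ w v, |(a + k • b₁) w v| ≤ C * (ip w w + ip v v) := by
    intro k hk0 hk2 w v
    have e1 := hA P T hP hT w v
    have e2 := hM P T hP hT w v
    rw [LinearMap.add_apply, LinearMap.add_apply, LinearMap.smul_apply, LinearMap.smul_apply,
      smul_eq_mul, ← ha, ← hb₁]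
    refine (abs_add_le _ _).trans ?_
    rw [abs_mul, abs_of_nonneg hk0]
    have e3 := mul_le_mul hk2 e2 (abs_nonneg _) (by norm_num)
    calc _ ≤ C₀ * (ip w w + ip v v) + 2 * (C₁ * (ip w w + ip v v)) := add_le_add e1 e3
      _ = _ := by rw [hCdef]; ring
  have hx : ip x x ≤ q * ip w w := by
    refine ip_le_of_coercive (a + (1 : ℝ) • b₁) hC hθ (hk 1 (by norm_num) (by norm_num)) ?_
    refine (hcoer P T hP hT t ht (by linarith) x).trans (le_of_eq ?_)
    rw [(hst x).1, ha, hb₁]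
    simp
  have hym : formM0 H T y y - (t + τ) * formM1 H T y y = (a + (2 : ℝ) • b₁) x y := by
    rw [(hst y).2, ha, hb₁]
    simp
  have hy : ip y y ≤ q * ip x x := by
    refine ip_le_of_coercive (a + (2 : ℝ) • b₁) hC hθ (hk 2 (by norm_num) (by norm_num)) ?_
    exact (hcoer P T hP hT (t + τ) (by linarith) h1 y).trans hym.le
  have hy2 : formM0 H T y y - (t + τ) * formM1 H T y y ≤ C * (ip x x + ip y y) :=
    hym.le.trans ((le_abs_self _).trans (hk 2 (by norm_num) (by norm_num) x y))
  have hx1 : formM1 H T x x ≤ C₁ * (ip x x + ip x x) :=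
    (le_abs_self _).trans (hM P T hP hT x x)
  have hd := diss_nonneg hN hH hP hT x
  have hw := hcoer P T hP hT t ht (by linarith) w
  have hw0 := ip_self_nonneg w
  have hx0 := ip_self_nonneg x
  have hy0 := ip_self_nonneg y
  have e1 : C₁ * ip x x ≤ C₁ * (q * ip w w) := by gcongr
  have e2 : C * (ip x x + ip y y) ≤ C * (q * ip w w + q * (q * ip w w)) := by
    have : q * ip x x ≤ q * (q * ip w w) := by gcongr
    gcongr
    linarith
  have e3 : τ * (formM0 H T y y - (t + τ) * formM1 H T y y) ≤ C * (ip x x + ip y y) := by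
    have h0 : 0 ≤ C * (ip x x + ip y y) := by positivity
    nlinarith
  have e4 : ip w w ≤ (formM0 H T w w - t * formM1 H T w w) / θ := by
    rw [le_div_iff₀ hθ]; linarith
  calc _ ≤ (4 * C₁ * q + C * (q + q * q)) * ip w w := by
        have : 0 ≤ C * (q + q * q) * ip w w := by positivity
        have : 0 ≤ C₁ * q * ip w w := by positivity
        linarith
    _ ≤ (4 * C₁ * q + C * (q + q * q)) *
        ((formM0 H T w w - t * formM1 H T w w) / θ) := by gcongr
    _ = _ := by ring

lemma normM_pos (hN : 0 < N) (hL : 0 < L) (hH : H.IsAdmissible) (hc : H.waveSpeed < cHat)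
    (hP : P.IsAdmissible H γ Cd) (hT : T.IsCausal P cHat) {t : ℝ} (h0 : 0 ≤ t) (h1 : t ≤ 1)
    {w : V P p} (hw : w ≠ 0) : 0 < normM H T t w ^ 2 := by
  rw [normM_sq hN hL hH hc hP hT h0 h1]
  exact formM_pos hL hH hc hP hT h0 h1 hw

lemma kappaSet_subset : kappaSet H P T p ⊆ kappaHatSet H P T p := by
  rintro q ⟨τ, h0, h1, w, hw, rfl⟩
  exact ⟨0, τ, le_rfl, h0, by linarith, w, hw, by rw [restart_zero]⟩

lemma normM_zero_right (hN : 0 < N) (hL : 0 < L) (hH : H.IsAdmissible) (hc : H.waveSpeed < cHat)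
    (hP : P.IsAdmissible H γ Cd) (hT : T.IsCausal P cHat) {t : ℝ} (h0 : 0 ≤ t) (h1 : t ≤ 1) :
    normM H T t (0 : V P p) ^ 2 = 0 := by
  obtain ⟨-, ⟨b₀, hb₀⟩, ⟨b₁, hb₁⟩⟩ := hasBilinForms (p := p) hN hP hT
  rw [normM_sq hN hL hH hc hP hT h0 h1, hb₀, hb₁]
  simp

section Kappa

variable (hN : 0 < N) (hL : 0 < L) (hH : H.IsAdmissible) (hc : H.waveSpeed < cHat)
  (hP : P.IsAdmissible H γ Cd) (hT : T.IsCausal P cHat) {C : ℝ} (hC : 0 ≤ C)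
  (hZ : ∀ t τ : ℝ, 0 ≤ t → 0 ≤ τ → t + τ ≤ 1 → ∀ w : V P p,
    Z H (T.restart t) τ w ≤ C * normM H T t w ^ 2)
include hN hL hH hc hP hT hC hZ

lemma le_of_mem_kappaHatSet {q : ℝ} (hq : q ∈ kappaHatSet H P T p) : q ≤ C := by
  obtain ⟨t, τ, ht, hτ, h1, w, hw, rfl⟩ := hq
  rw [normM0_restart hN hP hT, div_le_iff₀ (normM_pos hN hL hH hc hP hT ht (by linarith) hw)]
  exact hZ t τ ht hτ h1 w

lemma bddAbove_kappaHatSet : BddAbove (kappaHatSet H P T p) :=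
  ⟨C, fun _ hq => le_of_mem_kappaHatSet hN hL hH hc hP hT hC hZ hq⟩

lemma bddAbove_kappaSet : BddAbove (kappaSet H P T p) :=
  (bddAbove_kappaHatSet hN hL hH hc hP hT hC hZ).mono kappaSet_subset

lemma kappaHat_le : kappaHat H P T p ≤ C :=
  Real.sSup_le (fun _ hq => le_of_mem_kappaHatSet hN hL hH hc hP hT hC hZ hq) hC

lemma kappa_le_kappaHat : kappa H P T p ≤ kappaHat H P T p := by
  by_cases hV : ∃ w : V P p, w ≠ 0
  · obtain ⟨w, hw⟩ := hV
    exact csSup_le_csSup (bddAbove_kappaHatSet hN hL hH hc hP hT hC hZ)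
      ⟨_, 0, le_rfl, zero_le_one, w, hw, rfl⟩ kappaSet_subset
  · have h1 : kappaHatSet H P T p = ∅ := by
      ext q
      simp only [mem_empty_iff_false, iff_false]
      rintro ⟨t, τ, -, -, -, w, hw, -⟩
      exact hV ⟨w, hw⟩
    have h2 : kappaSet H P T p = ∅ := subset_empty_iff.1 (h1 ▸ kappaSet_subset)
    rw [kappa, kappaHat, h1, h2]

lemma Z_restart_le {t τ : ℝ} (ht : 0 ≤ t) (hτ : 0 ≤ τ) (h1 : t + τ ≤ 1) (w : V P p) :
    Z H (T.restart t) τ w ≤ kappaHat H P T p * normM H T t w ^ 2 := by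
  by_cases hw : w = 0
  · have h2 := hZ t τ ht hτ h1 w
    rw [hw, normM_zero_right hN hL hH hc hP hT ht (by linarith)] at h2 ⊢
    linarith
  have h2 := le_csSup (bddAbove_kappaHatSet hN hL hH hc hP hT hC hZ)
    (⟨t, τ, ht, hτ, h1, w, hw, rfl⟩ : _ ∈ kappaHatSet H P T p)
  rwa [normM0_restart hN hP hT, div_le_iff₀
    (normM_pos hN hL hH hc hP hT ht (by linarith) hw)] at h2

lemma Z_le {τ : ℝ} (hτ : 0 ≤ τ) (h1 : τ ≤ 1) (w : V P p) :
    Z H T τ w ≤ kappa H P T p * normM0 H T w ^ 2 := by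
  have e := normM0_restart hN hP hT 0 w
  rw [restart_zero] at e
  by_cases hw : w = 0
  · have h2 := hZ 0 τ le_rfl hτ (by linarith) w
    rw [restart_zero, ← e] at h2
    rw [e, hw, normM_zero_right hN hL hH hc hP hT le_rfl zero_le_one] at h2 ⊢
    linarith
  have h2 := le_csSup (bddAbove_kappaSet hN hL hH hc hP hT hC hZ)
    (⟨τ, hτ, h1, w, hw, rfl⟩ : _ ∈ kappaSet H P T p)
  rwa [e, div_le_iff₀ (normM_pos hN hL hH hc hP hT le_rfl zero_le_one hw), ← e] at h2

end Kappa

/-- Stability of the propagator that uses `r` subtents. -/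
lemma normM_satPropagator_le (hN : 0 < N) (hL : 0 < L) (hH : H.IsAdmissible)
    (hc : H.waveSpeed < cHat) (hP : P.IsAdmissible H γ Cd) (hT : T.IsCausal P cHat) {r : ℕ}
    (hr : 0 < r) {κ : ℝ} (hκ : 0 ≤ κ)
    (hZ : ∀ n : ℕ, n < r → ∀ w : V P p,
      Z H (T.restart (n / r)) (1 / r) w ≤ κ * normM H T (n / r) w ^ 2) (v : V P p) :
    normM H T 1 (satPropagator H T 2 r v) ≤ Real.exp (κ / r ^ 2 / 2) * normM H T 0 v := by
  have hr' : (0 : ℝ) < r := by exact_mod_cast hr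
  have key : ∀ n : ℕ, n ≤ r → normM H T (n / r) (satSubtents H T 2 r n v) ^ 2 ≤
      (1 + κ / r ^ 3) ^ n * normM H T 0 v ^ 2 := by
    intro n
    induction n with
    | zero => intro _; simp [satSubtents]
    | succ n ih =>
      intro hn
      have h1 : (n : ℝ) / r + 1 / r ≤ 1 := by
        rw [← add_div, div_le_one hr']; exact_mod_cast hn
      have h2 := normM_satFlow_le hN hL hH hc hP hT (t := n / r) (τ := 1 / r) (by positivity)
        (by positivity) h1 (satSubtents H T 2 r n v)
      rw [satSubtents, satFlow_subtent hN hL hH hc hP hT hn]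
      have h3 := hZ n hn (satSubtents H T 2 r n v)
      have h4 : ((n + 1 : ℕ) : ℝ) / r = n / r + 1 / r := by push_cast; ring
      rw [h4]
      calc _ ≤ _ := h2
        _ ≤ normM H T (n / r) (satSubtents H T 2 r n v) ^ 2 + (1 / r : ℝ) ^ 3 *
            (κ * normM H T (n / r) (satSubtents H T 2 r n v) ^ 2) := by gcongr
        _ = (1 + κ / r ^ 3) * normM H T (n / r) (satSubtents H T 2 r n v) ^ 2 := by
            field_simp
        _ ≤ (1 + κ / r ^ 3) * ((1 + κ / r ^ 3) ^ n * normM H T 0 v ^ 2) := by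
            gcongr
            exact ih (by omega)
        _ = _ := by ring
  have h1 := key r le_rfl
  rw [div_self hr'.ne'] at h1
  refine abs_le_of_sq_le_sq' ?_ (mul_nonneg (Real.exp_pos _).le (Real.sqrt_nonneg _)) |>.2
  refine h1.trans ?_
  rw [mul_pow]
  refine mul_le_mul_of_nonneg_right ?_ (sq_nonneg _)
  -- Its `r`-th power is `exp (κ / r ^ 2)`; the further `1/2` in the exponent comes from passing
  -- from squared norms to norms.
  have h2 : 1 + κ / r ^ 3 ≤ Real.exp (κ / r ^ 3) := by
    linarith [Real.add_one_le_exp (κ / r ^ 3)]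
  refine (pow_le_pow_left₀ (by positivity) h2 r).trans (le_of_eq ?_)
  rw [← Real.exp_nat_mul, ← Real.exp_nat_mul]
  congr 1
  push_cast
  field_simp

lemma diam_le_diam_closure (hH : H.IsAdmissible) (hP : P.IsAdmissible H γ Cd)
    (K : P.mesh.patch P.vertex) :
    Metric.diam (hull (K : Finset (Space N))) ≤ Metric.diam (closure H.Ω) :=
  Metric.diam_mono (hull_subset_closure hP.mesh_Ω (elem_mem K)) hH.bounded.closure

lemma h_le (hH : H.IsAdmissible) (hP : P.IsAdmissible H γ Cd) :
    P.h ≤ Metric.diam (closure H.Ω) :=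
  Real.iSup_le (diam_le_diam_closure hH hP) Metric.diam_nonneg

/-- Purity of the mesh yields an element at the vertex, so the supremum does not run over an empty
family. -/
lemma h_pos (hN : 0 < N) (hP : P.IsAdmissible H γ Cd) : 0 < P.h := by
  have hv : {P.vertex} ∈ P.mesh.complex.faces := hP.vertex_mem
  obtain ⟨K, hK, hsub, hcard⟩ := P.mesh.pure _ hv
  have hKp : K ∈ P.mesh.patch P.vertex := by
    rw [mem_patch]
    refine ⟨?_, hsub (Finset.mem_singleton_self _)⟩
    simp [Mesh.elements, hK, hcard]
  refine ((patch_isSimplex (⟨K, hKp⟩ : P.mesh.patch P.vertex)).diam_pos hN).trans_le ?_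
  exact le_ciSup (f := fun K : P.mesh.patch P.vertex => Metric.diam (hull (K : Finset (Space N))))
    (Set.finite_range _).bddAbove ⟨K, hKp⟩

lemma numSubtents_pos (κ h : ℝ) : 0 < numSubtents κ h := lt_of_lt_of_le one_pos (le_max_left _ _)

lemma cbrt_pow (κ : ℝ) : ((max κ 0) ^ (1 / 3 : ℝ)) ^ 3 = max κ 0 := by
  rw [← Real.rpow_natCast, ← Real.rpow_mul (le_max_right _ _)]
  norm_num

lemma cbrt_le_numSubtents {h : ℝ} (hh : 0 < h) (κ : ℝ) :
    (max κ 0) ^ (1 / 3 : ℝ) ≤ numSubtents κ h * √h := by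
  rw [← div_le_iff₀ (Real.sqrt_pos.2 hh), Real.sqrt_eq_rpow]
  refine (Nat.le_ceil _).trans ?_
  exact_mod_cast le_max_right 1 _

/-- The gain `τ³ κ` of a single step with `τ ≤ 1/r`. -/
lemma div_numSubtents_cube_le {h : ℝ} (hh : 0 < h) (κ : ℝ) :
    max κ 0 / numSubtents κ h ^ 3 ≤ h ^ (3 / 2 : ℝ) := by
  have hr : (0 : ℝ) < numSubtents κ h := by exact_mod_cast numSubtents_pos κ h
  have h1 : h ^ (3 / 2 : ℝ) = √h ^ 3 := by
    rw [Real.sqrt_eq_rpow, ← Real.rpow_natCast, ← Real.rpow_mul hh.le]; norm_num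
  rw [div_le_iff₀ (by positivity), h1, ← mul_pow, mul_comm, ← cbrt_pow κ]
  exact pow_le_pow_left₀ (by positivity) (cbrt_le_numSubtents hh κ) 3

/-- The gain over all `r` subtents has exponent `κ/r²`; two of the three cube roots of `κ` are spent
here, and the third remains as a constant. -/
lemma div_numSubtents_sq_le {h : ℝ} (hh : 0 < h) (κ : ℝ) :
    ((max κ 0) ^ (1 / 3 : ℝ)) ^ 2 / numSubtents κ h ^ 2 ≤ h := by
  have hr : (0 : ℝ) < numSubtents κ h := by exact_mod_cast numSubtents_pos κ h
  rw [div_le_iff₀ (by positivity)]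
  calc _ ≤ (numSubtents κ h * √h) ^ 2 :=
        pow_le_pow_left₀ (by positivity) (cbrt_le_numSubtents hh κ) 2
    _ = _ := by rw [mul_pow, Real.sq_sqrt hh.le]; ring

lemma numSubtents_eq_one {κ h : ℝ} (hh : 0 < h) (hκ : κ ≤ h ^ (3 / 2 : ℝ)) :
    numSubtents κ h = 1 := by
  rw [numSubtents, max_eq_left]
  rw [Nat.ceil_le, Nat.cast_one, div_le_one (by positivity)]
  calc (max κ 0) ^ (1 / 3 : ℝ) ≤ (h ^ (3 / 2 : ℝ)) ^ (1 / 3 : ℝ) :=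
        Real.rpow_le_rpow (le_max_right _ _) (max_le hκ (by positivity)) (by norm_num)
    _ = _ := by rw [← Real.rpow_mul hh.le]; norm_num

/-- From `e^x - 1 ≤ x e^x`, with the last exponential frozen at the largest possible mesh size `D`.
-/
lemma exp_le_of_le {E D h κ : ℝ} (hE : 0 ≤ E) (hh : 0 < h) (hD : h ≤ D) (hκ : κ ≤ E * h) :
    Real.exp (κ / 2) ≤ 1 + (E / 2 * Real.exp (E * D / 2)) * h := by
  have h1 : Real.exp (κ / 2) ≤ Real.exp (E * h / 2) := Real.exp_le_exp.2 (by linarith)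
  have h2 : Real.exp (E * h / 2) - 1 ≤ E * h / 2 * Real.exp (E * h / 2) := by
    have h3 := Real.add_one_le_exp (-(E * h / 2))
    have h4 := mul_le_mul_of_nonneg_right h3 (Real.exp_pos (E * h / 2)).le
    rw [← Real.exp_add, neg_add_cancel, Real.exp_zero] at h4
    linarith
  have h5 : Real.exp (E * h / 2) ≤ Real.exp (E * D / 2) := by
    refine Real.exp_le_exp.2 ?_
    have := mul_le_mul_of_nonneg_left hD hE
    linarith
  have h6 : E * h / 2 * Real.exp (E * h / 2) ≤ E * h / 2 * Real.exp (E * D / 2) :=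
    mul_le_mul_of_nonneg_left h5 (by positivity)
  linarith

end Stability

end MTP

end

/-! ### The proposition -/

theorem mainTheorem7 (N L p : ℕ) (hN : 0 < N) (hL : 0 < L)
    (H : MTP.HyperbolicSystem N L) (hH : H.IsAdmissible)
    (γ Cd cHat : ℝ) (hγ : 0 < γ) (hc : H.waveSpeed < cHat) :
    (∀ (P : MTP.DGPatch N L) (T : MTP.Tent N), P.IsAdmissible H γ Cd → T.IsCausal P cHat →
      BddAbove (MTP.kappaSet H P T p) ∧
      ∀ v : MTP.V P p, ∀ τ : ℝ, 0 ≤ τ →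
        τ ≤ 1 / (MTP.numSubtents (MTP.kappa H P T p) P.h : ℝ) →
        MTP.normM H T τ (MTP.satFlow H T 2 τ v) ≤
          (1 + P.h ^ (3 / 2 : ℝ)) ^ (1 / 2 : ℝ) * MTP.normM0 H T v) ∧
    (∀ κ₀ : ℝ, 0 < κ₀ → ∃ Csta : ℝ, 0 ≤ Csta ∧
      ∀ (P : MTP.DGPatch N L) (T : MTP.Tent N), P.IsAdmissible H γ Cd → T.IsCausal P cHat →
        (κ₀ ≤ MTP.kappa H P T p ∨ MTP.kappa H P T p ≤ P.h ^ (3 / 2 : ℝ)) →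
        ∀ v : MTP.V P p,
          MTP.normM H T 1
              (MTP.satPropagator H T 2 (MTP.numSubtents (MTP.kappa H P T p) P.h) v) ≤
            (1 + Csta * P.h) * MTP.normM H T 0 v) ∧
    (∃ Ckap Csta : ℝ, 0 ≤ Ckap ∧ 0 ≤ Csta ∧
      ∀ (P : MTP.DGPatch N L) (T : MTP.Tent N), P.IsAdmissible H γ Cd → T.IsCausal P cHat →
        BddAbove (MTP.kappaHatSet H P T p) ∧
        MTP.kappa H P T p ≤ MTP.kappaHat H P T p ∧
        MTP.kappaHat H P T p ≤ Ckap ∧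
        ∀ v : MTP.V P p,
          MTP.normM H T 1
              (MTP.satPropagator H T 2 (MTP.numSubtents (MTP.kappaHat H P T p) P.h) v) ≤
            (1 + Csta * P.h) * MTP.normM H T 0 v) := by
  obtain ⟨C, hC, hZall⟩ := MTP.exists_Z_le p hN hL hH Cd hγ hc
  set D := Metric.diam (closure H.Ω) with hD
  refine ⟨fun P T hP hT => ?_, fun κ₀ hκ₀ => ?_, ?_⟩
  · have hZ := hZall P T hP hT
    refine ⟨MTP.bddAbove_kappaSet hN hL hH hc hP hT hC hZ, fun v τ hτ hτr => ?_⟩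
    have hh := MTP.h_pos hN hP
    set r := MTP.numSubtents (MTP.kappa H P T p) P.h with hr
    have hr1 : (1 : ℝ) ≤ r := by exact_mod_cast MTP.numSubtents_pos _ _
    have hτ1 : τ ≤ 1 := hτr.trans ((div_le_one (by linarith)).2 hr1)
    have h1 := MTP.normM_satFlow_le hN hL hH hc hP hT le_rfl hτ (by linarith) v
    have h2 := MTP.Z_le hN hL hH hc hP hT hC hZ hτ hτ1 v
    have e := MTP.normM0_restart hN hP hT 0 v
    rw [MTP.restart_zero] at e h1
    rw [zero_add, ← e] at h1
    have h3 : τ ^ 3 * MTP.Z H T τ v ≤ P.h ^ (3 / 2 : ℝ) * MTP.normM0 H T v ^ 2 := by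
      calc τ ^ 3 * MTP.Z H T τ v
          ≤ τ ^ 3 * (max (MTP.kappa H P T p) 0 * MTP.normM0 H T v ^ 2) := by
            refine mul_le_mul_of_nonneg_left (h2.trans ?_) (by positivity)
            exact mul_le_mul_of_nonneg_right (le_max_left _ _) (sq_nonneg _)
        _ ≤ (1 / r) ^ 3 * (max (MTP.kappa H P T p) 0 * MTP.normM0 H T v ^ 2) := by
            have : 0 ≤ max (MTP.kappa H P T p) 0 := le_max_right _ _
            gcongr
        _ = max (MTP.kappa H P T p) 0 / r ^ 3 * MTP.normM0 H T v ^ 2 := by ring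
        _ ≤ _ := mul_le_mul_of_nonneg_right (MTP.div_numSubtents_cube_le hh _) (sq_nonneg _)
    have hn0 : 0 ≤ MTP.normM0 H T v := Real.sqrt_nonneg _
    rw [← Real.sqrt_eq_rpow]
    refine abs_le_of_sq_le_sq' ?_ (mul_nonneg (Real.sqrt_nonneg _) hn0) |>.2
    rw [mul_pow, Real.sq_sqrt (by positivity)]
    linarith
  -- For `κ_2 ≥ κ₀` one has `r² ≥ κ₀^{2/3}/h`. Later subtents start at positive pseudotimes, which
  -- `kappa` does not see; hence the numerator is the universal bound `C` of `Z`.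
  · set E := C / (κ₀ ^ (1 / 3 : ℝ)) ^ 2 with hE
    have hE0 : 0 ≤ E := by positivity
    have hD0 : 0 ≤ D := Metric.diam_nonneg
    -- One summand for each case; `√D` comes from `h^{3/2} ≤ √D h`.
    refine ⟨E / 2 * Real.exp (E * D / 2) + √D / 2 * Real.exp (√D * D / 2), by positivity,
      fun P T hP hT hcase v => ?_⟩
    have hZ := hZall P T hP hT
    have hh := MTP.h_pos hN hP
    have hhD := MTP.h_le hH hP
    have hn0 : 0 ≤ MTP.normM H T 0 v := Real.sqrt_nonneg _
    rcases hcase with hlow | hup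
    · set r := MTP.numSubtents (MTP.kappa H P T p) P.h with hr
      have hr0 : 0 < r := MTP.numSubtents_pos _ _
      have hr' : (0 : ℝ) < r := by exact_mod_cast hr0
      refine (MTP.normM_satPropagator_le hN hL hH hc hP hT hr0 hC (fun n hn w => ?_) v).trans ?_
      · refine hZ _ _ (by positivity) (by positivity) ?_ w
        rw [← add_div, div_le_one hr']
        exact_mod_cast hn
      refine mul_le_mul_of_nonneg_right ?_ hn0
      have h1 : (κ₀ ^ (1 / 3 : ℝ)) ^ 2 ≤ P.h * r ^ 2 := by
        rw [← div_le_iff₀ (by positivity)]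
        refine le_trans ?_ (MTP.div_numSubtents_sq_le hh (MTP.kappa H P T p))
        gcongr
        exact hlow.trans (le_max_left _ _)
      have h2 : C / r ^ 2 ≤ E * P.h := by
        rw [hE, div_mul_eq_mul_div, div_le_div_iff₀ (by positivity) (by positivity), mul_assoc]
        gcongr
      refine (MTP.exp_le_of_le hE0 hh hhD h2).trans ?_
      have : 0 ≤ √D / 2 * Real.exp (√D * D / 2) * P.h := by positivity
      linarith
    -- The only step starts at pseudotime `0` with `τ = 1`, where `kappa` does control `Z`.
    · rw [MTP.numSubtents_eq_one hh hup]
      refine (MTP.normM_satPropagator_le hN hL hH hc hP hT one_pos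
        (κ := P.h ^ (3 / 2 : ℝ)) (by positivity) (fun n hn w => ?_) v).trans ?_
      · obtain rfl : n = 0 := by omega
        have e := MTP.normM0_restart hN hP hT 0 w
        have h2 := MTP.Z_le hN hL hH hc hP hT hC hZ (τ := 1) zero_le_one le_rfl w
        rw [MTP.restart_zero] at e
        simp only [Nat.cast_zero, Nat.cast_one, div_one, MTP.restart_zero]
        rw [← e]
        exact h2.trans (mul_le_mul_of_nonneg_right hup (sq_nonneg _))
      refine mul_le_mul_of_nonneg_right ?_ hn0
      have h1 : P.h ^ (3 / 2 : ℝ) / ((1 : ℕ) : ℝ) ^ 2 ≤ √D * P.h := by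
        rw [Nat.cast_one, one_pow, div_one, show (3 / 2 : ℝ) = 1 / 2 + 1 by norm_num,
          Real.rpow_add hh, Real.rpow_one, ← Real.sqrt_eq_rpow]
        gcongr
      refine (MTP.exp_le_of_le (Real.sqrt_nonneg D) hh hhD h1).trans ?_
      have : 0 ≤ E / 2 * Real.exp (E * D / 2) * P.h := by positivity
      linarith
  -- Here `κ̂_2` controls every subtent, and `κ̂_2/r²` is at most `κ̂_2^{1/3} h`, hence at most
  -- `C^{1/3} h`.
  · set E := C ^ (1 / 3 : ℝ) with hE
    have hE0 : 0 ≤ E := by positivity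
    refine ⟨C, E / 2 * Real.exp (E * D / 2), hC, by positivity, fun P T hP hT => ?_⟩
    have hZ := hZall P T hP hT
    have hh := MTP.h_pos hN hP
    have hhD := MTP.h_le hH hP
    have hle := MTP.kappaHat_le hN hL hH hc hP hT hC hZ
    refine ⟨MTP.bddAbove_kappaHatSet hN hL hH hc hP hT hC hZ,
      MTP.kappa_le_kappaHat hN hL hH hc hP hT hC hZ, hle, fun v => ?_⟩
    set κ := MTP.kappaHat H P T p with hκ
    set r := MTP.numSubtents κ P.h with hr
    have hr0 : 0 < r := MTP.numSubtents_pos _ _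
    have hr' : (0 : ℝ) < r := by exact_mod_cast hr0
    refine (MTP.normM_satPropagator_le hN hL hH hc hP hT hr0 (le_max_right κ 0)
      (fun n hn w => ?_) v).trans ?_
    · have h1 : (n : ℝ) / r + 1 / r ≤ 1 := by
        rw [← add_div, div_le_one hr']
        exact_mod_cast hn
      refine (MTP.Z_restart_le hN hL hH hc hP hT hC hZ (by positivity) (by positivity) h1 w).trans ?_
      exact mul_le_mul_of_nonneg_right (le_max_left _ _) (sq_nonneg _)
    refine mul_le_mul_of_nonneg_right ?_ (Real.sqrt_nonneg _)
    refine MTP.exp_le_of_le hE0 hh hhD ?_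
    have hk : (max κ 0) ^ (1 / 3 : ℝ) ≤ E :=
      Real.rpow_le_rpow (le_max_right _ _) (max_le hle hC) (by norm_num)
    calc max κ 0 / r ^ 2 = (max κ 0) ^ (1 / 3 : ℝ) *
          (((max κ 0) ^ (1 / 3 : ℝ)) ^ 2 / r ^ 2) := by
          rw [← mul_div_assoc, ← pow_succ', MTP.cbrt_pow]
      _ ≤ E * P.h := by
          refine mul_le_mul hk (MTP.div_numSubtents_sq_le hh κ) (by positivity) hE0
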